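/- **Setting.** Let $A\in\mathbb R^{n\times n}$, $B\in\mathbb R^{n\times m}$, $Q\in\mathbb R^{n\times n}$, $R\in\mathbb R^{m\times m}$, $C_x\in\mathbb R^{p_x\times n}$, $c_x\in\mathbb R^{p_x}$, $C_u\in\mathbb R^{p_u\times m}$, $c_u\in\mathbb R^{p_u}$, $x_{\rm init}\in\mathbb R^n$. The constrained LQR problem is $$\min\ \tfrac12\sum_{i=0}^\infty \big(x_i^\top Qx_i+u_i^\top Ru_i\big)\quad\text{s.t.}\quad x_{i+1}=Ax_i+Bu_i,\ x_0=x_{\rm init},\ C_xx_i\le c_x,\ C_uu_i\le c_u\quad(i\in\mathbb N).$$ Assume that $(A,B)$ is stabilizable, $(A,\sqrt Q)$ is detectable, the optimal value is finite, $\{x: C_xx\le c_x\}$ contains the origin in its interior, $C_u$ has full column rank, $Q\succeq0$ and $R\succ0$. For $0<w<1$ with $w\,\rho(A)^2<1$ ($\rho$ the spectral radius), $\ell^2_w$ is the Hilbert space of sequences with $\sum_i w^i\|z_i\|^2<\infty$ and inner product $\langle z,y\rangle=\sum_i w^iz_i^\top y_i$; $\mathcal H_u,\mathcal H_x,\mathcal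 H_\lambda$ are the spaces $\ell^2_w$ of sequences in $\mathbb R^m$, $\mathbb R^n$, $\mathbb R^{p_u+p_x}$. For $u\in\mathcal H_u$ put $(\mathbf Bu)_i=\sum_{j\le i}A^{i-j}Bu_j$, $(\mathbf Cu)_i=(C_uu_i,\ C_x(\mathbf Bu)_i)$ and $\mathbf c_i=(c_u,\ c_x-C_xA^{i+1}x_{\rm init})$; thus $\mathbf B:\mathcal H_u\to\mathcal H_x$ and $\mathbf C:\mathcal H_u\to\mathcal H_\lambda$ are bounded, $\mathbf c\in\mathcal H_\lambda$, and the state sequence is $\mathbf x=(x_1,x_2,\dots)=(A^{i+1}x_{\rm init})_{i\ge 0}+\mathbf Bu$. Let $f(u)\in[0,\infty]$ be the cost above as a function of $u\in\mathcal H_u$, $f^\star$ its Fenchel conjugate, $h^\star(\lambda)=f^\star(\mathbf C^\star\lambda)-\langle\lambda,\mathbf c\rangle$, and $F=h^\star+\delta_-$, where $\delta_-$ is the indicator function of the nonpositive orthant of $\mathcal H_\lambda$. Let $\mu>0$ be a strong convexity modulus of $f$, let $L>0$ be a Lipschitz constant of the ($\mathcal H_\lambda$-)gradient $\nabla h^\star$,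 and let $a>2$. The AFBS iterates are $\lambda^0=0$, $\alpha^0=0$, $\alpha^k=\frac{k-1}{k+a}$ $(k\ge1)$, $$\hat\lambda^k=\lambda^k+\alpha^k(\lambda^k-\lambda^{k-1}),\qquad \lambda^{k+1}=\min\{\hat\lambda^k-\tfrac1L\nabla h^\star(\hat\lambda^k),0\}.$$ Let $P_{\rm LQ}\succeq0$ solve the discrete algebraic Riccati equation of $(A,B,Q,R)$, let $K$ be the corresponding feedback matrix ($u=Kx$), and let $S$ be a set with $0\in\operatorname{int}S$ contained in the maximal positively invariant set of $x^+=(A+BK)x$ subject to $C_xx\le c_x$, $C_uKx\le c_u$. For $\lambda\in\mathcal H_\lambda$ and $T\in\mathbb N$ let $u(\lambda,T)$, with states $x(\lambda,T)$, be the input sequence whose first $T$ entries minimize $$\tfrac12x_T^\top P_{\rm LQ}x_T+\sum_{i=0}^{T-1}\Big(\tfrac12x_i^\top Qx_i+\tfrac12u_i^\top Ru_i-w^i\lambda_i^\top\begin{bmatrix}C_uu_i-c_u\\ C_xx_{i+1}-c_x\end{bmatrix}\Big)$$ and with $u_i=Kx_i$ for $i\ge T$. Let $T^0=0$ and let $T^{k+1}$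 be the least $T\ge T^k$ for which there is $T^S\ge T$ such that the pair $(\hat x,\hat u)$ given by $(\hat\lambda^k,T^k)$ satisfies $C_x\hat x_{i+1}\lhd c_x$, $C_u\hat u_i\lhd c_u$ for $i=T,\dots,T^S$ and $\hat x_{T^S}\in S$; here $\lhd$ is $\le$, or, if all entries of $c_x$ and $c_u$ are positive, it may also be $<$. Put $u^k=u(\lambda^k,T^k)$, and let $\mathbf x^k$ be its state sequence. **Theorem.** The function $h^\star$ is finite and differentiable on $\mathcal H_\lambda$, the CLQR problem has a unique optimal input sequence $u^\infty$, which lies in $\mathcal H_u$ (with state sequence $\mathbf x^\infty$), the $T^k$ are well defined with $\lambda^k_i=\hat\lambda^k_i=0$ for $i\ge T^k$, the $u^k$ are well defined and lie in $\mathcal H_u$, and: 1. for every minimizer $\lambda^\infty$ of $F$ and every $k\ge0$, $F(\lambda^k)-F(\lambda^\infty)\le\dfrac{a^2L}{2(k+a-1)^2}\|\lambda^0-\lambda^\infty\|^2$; 2. $F$ has a minimizer, and $\lambda^k$ converges weakly in $\mathcal H_\lambda$ to some minimizer of $F$; 3. $u^k\to u^\infty$ strongly in $\mathcal H_u$, and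 for every minimizer $\lambda^\infty$ of $F$ and every $k\ge 0$, $\|u^k-u^\infty\|\le a\sqrt{\dfrac L\mu}\,\dfrac{\|\lambda^0-\lambda^\infty\|}{k+a-1}$; 4. $\mathbf x^k\to\mathbf x^\infty$ strongly in $\mathcal H_x$, and for every minimizer $\lambda^\infty$ of $F$ and every $k\ge 0$, $\|\mathbf x^k-\mathbf x^\infty\|\le a\sqrt{\dfrac{\|\mathbf B\|^2L}\mu}\,\dfrac{\|\lambda^0-\lambda^\infty\|}{k+a-1}$; 5. the sequence $(T^k)$ is bounded. -/

import Mathlib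

open scoped Matrix ENNReal NNReal Topology

/-! ### Weighted `ℓ²` spaces -/

section WeightedL2

variable {E : Type*} [NormedAddCommGroup E] [InnerProductSpace ℝ E]

theorem wl2_norm_add_sq_le {E : Type*} [NormedAddCommGroup E] {w : ℝ} (hw : 0 < w) (i : ℕ) (a b : E) :
    w ^ i * ‖a + b‖ ^ 2 ≤ 2 * (w ^ i * ‖a‖ ^ 2) + 2 * (w ^ i * ‖b‖ ^ 2) := by
  have h1 : ‖a + b‖ ^ 2 ≤ 2 * ‖a‖ ^ 2 + 2 * ‖b‖ ^ 2 := by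
    nlinarith [norm_add_le a b, norm_nonneg (a + b), norm_nonneg a, norm_nonneg b,
      sq_nonneg (‖a‖ - ‖b‖)]
  have h2 : 0 < w ^ i := pow_pos hw i
  nlinarith [mul_le_mul_of_nonneg_left h1 h2.le]

/-- The sequences `z` in `E` with `∑ wⁱ ‖zᵢ‖² < ∞`, as a linear subspace of all sequences. -/
def wl2Submodule (w : ℝ) [hw : Fact (0 < w)] (E : Type*) [NormedAddCommGroup E]
    [InnerProductSpace ℝ E] : Submodule ℝ (ℕ → E) where
  carrier := {z | Summable fun i => w ^ i * ‖z i‖ ^ 2}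
  zero_mem' := by simp
  add_mem' := by
    intro a b ha hb
    refine Summable.of_nonneg_of_le (fun i => ?_) (fun i => wl2_norm_add_sq_le hw.out i (a i) (b i))
      ((Summable.mul_left 2 ha).add (Summable.mul_left 2 hb))
    have := hw.out
    positivity
  smul_mem' := by
    intro c a ha
    have h : (fun i => w ^ i * ‖(c • a) i‖ ^ 2) = fun i => ‖c‖ ^ 2 * (w ^ i * ‖a i‖ ^ 2) := by
      funext i
      simp only [Pi.smul_apply, norm_smul]
      ring
    simp only [Set.mem_ofPred_eq] at ha ⊢
    rw [h]
    exact ha.mul_left _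

/-- The weighted space `ℓ²_w(E)` of sequences `z` in `E` with `∑ wⁱ ‖zᵢ‖² < ∞`. -/
def WL2 (w : ℝ) [Fact (0 < w)] (E : Type*) [NormedAddCommGroup E] [InnerProductSpace ℝ E] :
    Type _ :=
  ↥(wl2Submodule w E)

namespace WL2

variable {w : ℝ} [hw : Fact (0 < w)]

noncomputable instance : AddCommGroup (WL2 w E) := inferInstanceAs (AddCommGroup ↥(wl2Submodule w E))

noncomputable instance : Module ℝ (WL2 w E) := inferInstanceAs (Module ℝ ↥(wl2Submodule w E))

instance : CoeFun (WL2 w E) (fun _ => ℕ → E) := ⟨fun z => Subtype.val z⟩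

/-- A weighted square-summable sequence, as an element of `ℓ²_w(E)`. -/
def mk (z : ℕ → E) (hz : Summable fun i => w ^ i * ‖z i‖ ^ 2) : WL2 w E := ⟨z, hz⟩

@[simp] theorem mk_apply (z : ℕ → E) (hz : Summable fun i => w ^ i * ‖z i‖ ^ 2) (i : ℕ) :
    (mk z hz : WL2 w E) i = z i := rfl

@[simp] theorem add_apply (y z : WL2 w E) (i : ℕ) : (y + z) i = y i + z i := rfl

@[simp] theorem sub_apply (y z : WL2 w E) (i : ℕ) : (y - z) i = y i - z i := rfl

@[simp] theorem smul_apply (c : ℝ) (z : WL2 w E) (i : ℕ) : (c • z) i = c • z i := rfl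

@[simp] theorem zero_apply (i : ℕ) : (0 : WL2 w E) i = 0 := rfl

@[ext] theorem ext {y z : WL2 w E} (h : ∀ i, y i = z i) : y = z := Subtype.ext (funext h)

theorem summable_norm_sq (z : WL2 w E) : Summable fun i => w ^ i * ‖z i‖ ^ 2 := z.2

theorem summable_inner (y z : WL2 w E) : Summable fun i => w ^ i * inner ℝ (y i) (z i) := by
  refine Summable.of_norm_bounded (y.summable_norm_sq.add z.summable_norm_sq) (fun i => ?_)
  have h2 : 0 < w ^ i := pow_pos hw.out i
  rw [norm_mul, Real.norm_of_nonneg h2.le, ← mul_add]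
  refine mul_le_mul_of_nonneg_left ?_ h2.le
  have := norm_inner_le_norm (𝕜 := ℝ) (y i) (z i)
  nlinarith [sq_nonneg (‖y i‖ - ‖z i‖), sq_nonneg (‖y i‖), sq_nonneg (‖z i‖)]

/-- The inner product `⟨y, z⟩ = ∑ wⁱ ⟨yᵢ, zᵢ⟩`. -/
noncomputable abbrev core : InnerProductSpace.Core ℝ (WL2 w E) where
  inner y z := ∑' i, w ^ i * inner ℝ (y i) (z i)
  conj_inner_symm y z := by
    simp [real_inner_comm]
  re_inner_nonneg z := by
    have := hw.out
    refine tsum_nonneg fun i => mul_nonneg (by positivity) ?_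
    exact real_inner_self_nonneg
  add_left x y z := by
    rw [← (summable_inner x z).tsum_add (summable_inner y z)]
    simp [inner_add_left, mul_add]
  smul_left x y r := by
    simp only [smul_apply, real_inner_smul_left, conj_trivial]
    rw [← tsum_mul_left]
    congr 1
    funext i
    ring
  definite z hz := by
    have h0 : ∀ i, 0 ≤ w ^ i * inner ℝ (z i) (z i) := fun i =>
      mul_nonneg (pow_pos hw.out i).le real_inner_self_nonneg
    have h := (hasSum_zero_iff_of_nonneg h0).1 (hz ▸ (summable_inner z z).hasSum)
    ext i
    have hi := congrFun h i
    have := (pow_pos hw.out i).ne'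
    simpa [this] using hi

noncomputable instance : NormedAddCommGroup (WL2 w E) :=
  @InnerProductSpace.Core.toNormedAddCommGroup ℝ (WL2 w E) _ _ _ core

noncomputable instance : InnerProductSpace ℝ (WL2 w E) := InnerProductSpace.ofCore core.toCore

theorem inner_eq (y z : WL2 w E) : inner ℝ y z = ∑' i, w ^ i * inner ℝ (y i) (z i) := rfl

theorem norm_sq_eq (z : WL2 w E) : ‖z‖ ^ 2 = ∑' i, w ^ i * ‖z i‖ ^ 2 := by
  rw [← real_inner_self_eq_norm_sq, inner_eq]
  simp

/-- `z ↦ (√w ⁱ zᵢ)ᵢ` identifies `ℓ²_w(E)` with the unweighted space `ℓ²(E)`. -/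
noncomputable def equivLp : WL2 w E ≃ₗᵢ[ℝ] lp (fun _ : ℕ => E) 2 where
  toFun z := ⟨fun i => (√w) ^ i • z i, by
    refine (memℓp_gen_iff (by norm_num)).2 (z.summable_norm_sq.congr fun i => ?_)
    have h := Real.sqrt_nonneg w
    simp only [norm_smul, norm_pow, Real.norm_of_nonneg h, ENNReal.toReal_ofNat, Real.rpow_two]
    rw [mul_pow, ← pow_mul, mul_comm i 2, pow_mul, Real.sq_sqrt hw.out.le]⟩
  map_add' y z := by
    ext i
    exact smul_add _ _ _
  map_smul' c z := by
    ext i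
    exact smul_comm _ _ _
  invFun v := mk (fun i => ((√w) ^ i)⁻¹ • v i) (by
    have h := (memℓp_gen_iff (by norm_num)).1 v.2
    refine h.congr fun i => ?_
    have h := Real.sqrt_pos.2 hw.out
    simp only [norm_smul, norm_inv, norm_pow, Real.norm_of_nonneg h.le, ENNReal.toReal_ofNat,
      Real.rpow_two]
    rw [mul_pow, inv_pow, ← pow_mul, mul_comm i 2, pow_mul, Real.sq_sqrt hw.out.le, ← mul_assoc,
      mul_inv_cancel₀ (pow_pos hw.out i).ne', one_mul])
  left_inv z := by
    ext i
    have h := (pow_pos (Real.sqrt_pos.2 hw.out) i).ne'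
    simp [smul_smul, h]
  right_inv v := by
    ext i
    have h := (pow_pos (Real.sqrt_pos.2 hw.out) i).ne'
    simp [smul_smul, h]
  norm_map' z := by
    have h : ∀ v : lp (fun _ : ℕ => E) 2, ‖v‖ ^ 2 = ∑' i, ‖v i‖ ^ 2 := fun v => by
      rw [← real_inner_self_eq_norm_sq, lp.inner_eq_tsum]
      simp
    rw [← sq_eq_sq₀ (norm_nonneg _) (norm_nonneg _), h, norm_sq_eq]
    refine tsum_congr fun i => ?_
    have h := Real.sqrt_nonneg w
    simp only [LinearEquiv.coe_mk, LinearMap.coe_mk, AddHom.coe_mk, norm_smul, norm_pow,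
      Real.norm_of_nonneg h]
    rw [mul_pow, ← pow_mul, mul_comm i 2, pow_mul, Real.sq_sqrt hw.out.le]

instance [CompleteSpace E] : CompleteSpace (WL2 w E) :=
  (equivLp (w := w) (E := E)).toIsometryEquiv.completeSpace

variable {F : Type*} [NormedAddCommGroup F] [InnerProductSpace ℝ F]

/-- The block-diagonal operator `diag(M, M, …)`. -/
noncomputable def diag (M : E →L[ℝ] F) : WL2 w E →L[ℝ] WL2 w F :=
  LinearMap.mkContinuousOfExistsBound
    { toFun := fun z => mk (fun i => M (z i)) (by
        refine Summable.of_nonneg_of_le (fun i => ?_) (fun i => ?_)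
          (z.summable_norm_sq.mul_left (‖M‖ ^ 2))
        · have := hw.out
          positivity
        · have h2 : 0 < w ^ i := pow_pos hw.out i
          have h3 := pow_le_pow_left₀ (norm_nonneg _) (M.le_opNorm (z i)) 2
          rw [mul_pow] at h3
          nlinarith [mul_le_mul_of_nonneg_left h3 h2.le])
      map_add' := fun y z => by
        ext i
        simp
      map_smul' := fun c z => by
        ext i
        simp }
    ⟨‖M‖, fun z => by
      refine le_of_sq_le_sq ?_ (by positivity)
      rw [mul_pow, norm_sq_eq, norm_sq_eq, ← tsum_mul_left]
      refine Summable.tsum_le_tsum (fun i => ?_) (summable_norm_sq _)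
        (z.summable_norm_sq.mul_left (‖M‖ ^ 2))
      have h2 : 0 < w ^ i := pow_pos hw.out i
      have h3 := pow_le_pow_left₀ (norm_nonneg _) (M.le_opNorm (z i)) 2
      rw [mul_pow] at h3
      simp only [LinearMap.coe_mk, AddHom.coe_mk, mk_apply]
      nlinarith [mul_le_mul_of_nonneg_left h3 h2.le]⟩

@[simp] theorem diag_apply (M : E →L[ℝ] F) (z : WL2 w E) (i : ℕ) : diag M z i = M (z i) := rfl

/-- The componentwise clipping `min {z, 0}`. -/
noncomputable def clip {ι : Type*} [Fintype ι] (z : WL2 w (EuclideanSpace ℝ ι)) :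
    WL2 w (EuclideanSpace ℝ ι) :=
  mk (fun i => WithLp.toLp 2 fun j => min (z i j) 0) (by
    refine Summable.of_nonneg_of_le (fun i => ?_) (fun i => ?_) z.summable_norm_sq
    · have := hw.out
      positivity
    · refine mul_le_mul_of_nonneg_left ?_ (pow_pos hw.out i).le
      rw [EuclideanSpace.norm_sq_eq, EuclideanSpace.norm_sq_eq]
      refine Finset.sum_le_sum fun j _ => ?_
      simp only [Real.norm_eq_abs, sq_abs]
      rcases le_total (z i j) 0 with h | h
      · simp [h]
      · simp [h])

end WL2

end WeightedL2

/-! ### Matrices acting on Euclidean spaces -/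

section Matrices

/-- The linear map `x ↦ M x` between Euclidean spaces. -/
noncomputable def Matrix.toE {ι κ : Type*} [Fintype ι] [Fintype κ] [DecidableEq κ]
    (M : Matrix ι κ ℝ) : EuclideanSpace ℝ κ →L[ℝ] EuclideanSpace ℝ ι :=
  (Matrix.toEuclideanLin M).toContinuousLinearMap

theorem Matrix.toE_apply {ι κ : Type*} [Fintype ι] [Fintype κ] [DecidableEq κ]
    (M : Matrix ι κ ℝ) (x : EuclideanSpace ℝ κ) (i : ι) : M.toE x i = (M *ᵥ x.ofLp) i := rfl

/-- `z` is a (complex) eigenvalue of the real square matrix `M`. -/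
def Matrix.IsComplexEigenvalue {n : ℕ} (M : Matrix (Fin n) (Fin n) ℝ) (z : ℂ) : Prop :=
  z ∈ spectrum ℂ (M.map (fun t : ℝ => (t : ℂ)))

/-- All eigenvalues lie in the open unit disc. -/
def Matrix.SchurStable {n : ℕ} (M : Matrix (Fin n) (Fin n) ℝ) : Prop :=
  ∀ z, M.IsComplexEigenvalue z → ‖z‖ < 1

/-- `(A, B)` is stabilizable. -/
def Stabilizable {n m : ℕ} (A : Matrix (Fin n) (Fin n) ℝ) (B : Matrix (Fin n) (Fin m) ℝ) : Prop :=
  ∃ K : Matrix (Fin m) (Fin n) ℝ, (A + B * K).SchurStable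

/-- `(A, D)` is detectable. For `Q` positive semidefinite, `(A, √Q)` is detectable if and only if
`(A, Q)` is, because `√Q` and `Q` have the same kernel. -/
def Detectable {n p : ℕ} (A : Matrix (Fin n) (Fin n) ℝ) (D : Matrix (Fin p) (Fin n) ℝ) : Prop :=
  ∃ J : Matrix (Fin n) (Fin p) ℝ, (A + J * D).SchurStable

/-- `w` is an admissible weight for `A`: it lies in `(0, 1)` and `w` times the squared
spectral radius of `A` is less than one. -/
structure AdmissibleWeight {n : ℕ} (A : Matrix (Fin n) (Fin n) ℝ) (w : ℝ) : Prop where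
  pos : 0 < w
  lt_one : w < 1
  spectral : ∀ z, A.IsComplexEigenvalue z → w * ‖z‖ ^ 2 < 1

attribute [local instance] Matrix.linftyOpNormedRing Matrix.linftyOpNormedAlgebra in
theorem AdmissibleWeight.exists_bound {n : ℕ} {A : Matrix (Fin n) (Fin n) ℝ} {w : ℝ}
    (h : AdmissibleWeight A w) :
    ∃ c r : ℝ, 0 ≤ c ∧ 0 ≤ r ∧ r < 1 ∧ ∀ k : ℕ, (√w) ^ k * ‖(A ^ k).toE‖ ≤ c * r ^ k := by
  set s : ℝ := √w with hs
  have hs0 : 0 < s := Real.sqrt_pos.2 h.pos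
  set N : Matrix (Fin n) (Fin n) ℂ := A.map (fun t : ℝ => (t : ℂ)) with hN
  set M : Matrix (Fin n) (Fin n) ℂ := (s : ℂ) • N with hM
  have : CompleteSpace (Matrix (Fin n) (Fin n) ℂ) := FiniteDimensional.complete ℂ _
  have hrad : spectralRadius ℂ M < 1 := by
    rcases (spectrum ℂ M).eq_empty_or_nonempty with he | hne
    · simp [spectralRadius, he]
    · refine spectrum.spectralRadius_lt_of_forall_lt_of_nonempty hne (r := 1) fun k hk => ?_
      have hs' : (s : ℂ) ≠ 0 := by exact_mod_cast hs0.ne'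
      have hk' : (s : ℂ)⁻¹ * k ∈ spectrum ℂ N := by
        have := (spectrum.smul_mem_smul_iff (R := ℂ) (s := (s : ℂ)⁻¹ * k) (a := N)
          (r := Units.mk0 (s : ℂ) hs')).1
        apply this
        rw [Units.smul_def, Units.smul_def, Units.val_mk0, smul_eq_mul, ← mul_assoc,
          mul_inv_cancel₀ hs', one_mul]
        exact hk
      have h1 := h.spectral _ hk'
      rw [norm_mul, norm_inv, Complex.norm_real, Real.norm_of_nonneg hs0.le, mul_pow, inv_pow,
        hs, Real.sq_sqrt h.pos.le, ← mul_assoc, mul_inv_cancel₀ h.pos.ne', one_mul] at h1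
      have h2 : ‖k‖ < 1 := by
        nlinarith [norm_nonneg k]
      exact_mod_cast h2
  obtain ⟨r, hr1, hr2⟩ := ENNReal.lt_iff_exists_nnreal_btwn.1 hrad
  have hr1' : r < 1 := by exact_mod_cast hr2
  have hev := (spectrum.pow_nnnorm_pow_one_div_tendsto_nhds_spectralRadius M).eventually_lt_const hr1
  obtain ⟨k0, hk0⟩ := Filter.eventually_atTop.1 hev
  have hpow : ∀ k, max k0 1 ≤ k → ‖M ^ k‖ ≤ (r : ℝ) ^ k := by
    intro k hk
    have h1 := hk0 k (le_trans (le_max_left _ _) hk)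
    have hkpos : k ≠ 0 := by
      have := le_trans (le_max_right k0 1) hk
      omega
    have h2 : (‖M ^ k‖₊ : ℝ≥0∞) ≤ (r : ℝ≥0∞) ^ k := by
      have h3 := ENNReal.rpow_le_rpow h1.le (z := (k : ℝ)) (by positivity)
      rw [← ENNReal.rpow_mul, one_div, inv_mul_cancel₀ (by exact_mod_cast hkpos),
        ENNReal.rpow_one, ENNReal.rpow_natCast] at h3
      exact h3
    exact_mod_cast h2
  -- passing from the complex matrix to the real operator
  let Φ : Matrix (Fin n) (Fin n) ℂ →ₗ[ℝ]
      (EuclideanSpace ℝ (Fin n) →L[ℝ] EuclideanSpace ℝ (Fin n)) :=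
    { toFun := fun X => (X.map Complex.re).toE
      map_add' := fun X Y => by
        ext x i
        simp [Matrix.toE_apply, Matrix.mulVec, dotProduct, add_mul, Finset.sum_add_distrib]
      map_smul' := fun c X => by
        ext x i
        simp [Matrix.toE_apply, Matrix.mulVec, dotProduct, mul_assoc, Finset.mul_sum] }
  obtain ⟨C, hC0, hC⟩ : ∃ C : ℝ, 0 ≤ C ∧ ∀ X, ‖Φ X‖ ≤ C * ‖X‖ :=
    ⟨_, norm_nonneg _, (LinearMap.toContinuousLinearMap Φ).le_opNorm⟩
  have hΨ : ∀ k, Φ (M ^ k) = s ^ k • (A ^ k).toE := by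
    intro k
    have h1 : M ^ k = (s ^ k : ℝ) • (A ^ k).map (fun t : ℝ => (t : ℂ)) := by
      have h2 : N ^ k = (A ^ k).map (fun t : ℝ => (t : ℂ)) :=
        (map_pow (Complex.ofRealHom.mapMatrix (m := Fin n)) A k).symm
      rw [hM, smul_pow, h2]
      ext i j
      simp
    rw [h1, map_smul]
    congr 1
  have hb : ∀ k, s ^ k * ‖(A ^ k).toE‖ ≤ C * ‖M ^ k‖ := by
    intro k
    have h1 := hC (M ^ k)
    rwa [hΨ, norm_smul, norm_pow, Real.norm_of_nonneg hs0.le] at h1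
  set k1 := max k0 1
  -- enlarging `r` so that it is positive
  set q : ℝ := max (r : ℝ) (1 / 2) with hq
  have hq0 : 0 < q := lt_of_lt_of_le (by norm_num) (le_max_right _ _)
  have hq1 : q < 1 := max_lt (by exact_mod_cast hr1') (by norm_num)
  have hMb : ∀ k, ‖M ^ k‖ ≤ (1 + ∑ j ∈ Finset.range k1, ‖M ^ j‖ / q ^ j) * q ^ k := by
    intro k
    have hnn : ∀ j ∈ Finset.range k1, 0 ≤ ‖M ^ j‖ / q ^ j := fun j _ => by positivity
    rcases lt_or_ge k k1 with hk | hk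
    · have h1 := Finset.single_le_sum hnn (Finset.mem_range.2 hk)
      have h2 : ‖M ^ k‖ = ‖M ^ k‖ / q ^ k * q ^ k := by
        field_simp
      rw [h2]
      refine mul_le_mul_of_nonneg_right ?_ (by positivity)
      linarith
    · have h1 := hpow k hk
      have h2 : (r : ℝ) ^ k ≤ q ^ k := pow_le_pow_left₀ r.2 (le_max_left _ _) k
      have h3 := Finset.sum_nonneg hnn
      have h4 : 0 ≤ q ^ k := by positivity
      nlinarith
  refine ⟨C * (1 + ∑ j ∈ Finset.range k1, ‖M ^ j‖ / q ^ j), q, ?_, hq0.le, hq1, fun k => ?_⟩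
  · have : 0 ≤ ∑ j ∈ Finset.range k1, ‖M ^ j‖ / q ^ j := Finset.sum_nonneg fun j _ => by positivity
    positivity
  · refine (hb k).trans ?_
    rw [mul_assoc]
    exact mul_le_mul_of_nonneg_left (hMb k) hC0

end Matrices

/-! ### The constrained linear quadratic regulation problem -/

/-- The data of a CLQR problem: dynamics `x⁺ = A x + B u`, stage cost `½ (xᵀ Q x + uᵀ R u)`,
constraints `Cx x ≤ cx` and `Cu u ≤ cu`, and the initial state. -/
structure CLQR (n m px pu : ℕ) where
  A : Matrix (Fin n) (Fin n) ℝ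
  B : Matrix (Fin n) (Fin m) ℝ
  Q : Matrix (Fin n) (Fin n) ℝ
  R : Matrix (Fin m) (Fin m) ℝ
  Cx : Matrix (Fin px) (Fin n) ℝ
  cx : Fin px → ℝ
  Cu : Matrix (Fin pu) (Fin m) ℝ
  cu : Fin pu → ℝ
  xinit : EuclideanSpace ℝ (Fin n)

namespace CLQR

variable {n m px pu : ℕ} (P : CLQR n m px pu)

/-- The state trajectory `x₀ = xinit`, `xᵢ₊₁ = A xᵢ + B uᵢ`. -/
noncomputable def traj (u : ℕ → EuclideanSpace ℝ (Fin m)) : ℕ → EuclideanSpace ℝ (Fin n)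
  | 0 => P.xinit
  | i + 1 => P.A.toE (traj u i) + P.B.toE (u i)

/-- The stage cost `½ (xᵀ Q x + uᵀ R u)`. -/
noncomputable def stageCost (x : EuclideanSpace ℝ (Fin n)) (u : EuclideanSpace ℝ (Fin m)) : ℝ :=
  (1 / 2) * (inner ℝ x (P.Q.toE x) + inner ℝ u (P.R.toE u))

/-- The infinite-horizon cost `½ ∑ (xᵢᵀ Q xᵢ + uᵢᵀ R uᵢ) ∈ [0, ∞]` of an input sequence. -/
noncomputable def cost (u : ℕ → EuclideanSpace ℝ (Fin m)) : ℝ≥0∞ :=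
  ∑' i, ENNReal.ofReal (P.stageCost (P.traj u i) (u i))

/-- The input sequence and its state trajectory satisfy all the constraints. -/
def Feasible (u : ℕ → EuclideanSpace ℝ (Fin m)) : Prop :=
  ∀ i, (∀ j, P.Cx.toE (P.traj u i) j ≤ P.cx j) ∧ ∀ j, P.Cu.toE (u i) j ≤ P.cu j

/-- The optimal value of the CLQR problem. -/
noncomputable def value : ℝ≥0∞ :=
  ⨅ u : {u : ℕ → EuclideanSpace ℝ (Fin m) // P.Feasible u}, P.cost u.1

/-- `u` is an optimal input sequence of the CLQR problem. -/
def IsOptimal (u : ℕ → EuclideanSpace ℝ (Fin m)) : Prop :=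
  P.Feasible u ∧ ∀ v, P.Feasible v → P.cost u ≤ P.cost v

/-- The standing assumptions on the problem data. -/
structure StandingAssumption : Prop where
  stabilizable : Stabilizable P.A P.B
  value_finite : P.value ≠ ⊤
  origin_interior :
    (0 : EuclideanSpace ℝ (Fin n)) ∈ interior {x | ∀ j, P.Cx.toE x j ≤ P.cx j}
  rank_Cu : P.Cu.rank = m
  Q_psd : P.Q.PosSemidef
  R_posDef : P.R.PosDef

/-- `Plq` is a positive semidefinite solution of the discrete-time algebraic Riccati equation
and `K` is the corresponding state feedback matrix, `u = K x`. -/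
structure IsLQSolution (Plq : Matrix (Fin n) (Fin n) ℝ) (K : Matrix (Fin m) (Fin n) ℝ) : Prop where
  posSemidef : Plq.PosSemidef
  riccati : Plq = P.Q + P.Aᵀ * Plq * P.A -
    P.Aᵀ * Plq * P.B * (P.R + P.Bᵀ * Plq * P.B)⁻¹ * (P.Bᵀ * Plq * P.A)
  gain : K = -((P.R + P.Bᵀ * Plq * P.B)⁻¹ * (P.Bᵀ * Plq * P.A))

/-- The maximal positively invariant set of `x⁺ = (A + B K) x` subject to `Cx x ≤ cx` and
`Cu K x ≤ cu`. -/
def maxInvariantSet (K : Matrix (Fin m) (Fin n) ℝ) : Set (EuclideanSpace ℝ (Fin n)) :=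
  {x | ∀ i : ℕ, (∀ j, P.Cx.toE (((P.A + P.B * K) ^ i).toE x) j ≤ P.cx j) ∧
    ∀ j, P.Cu.toE (K.toE (((P.A + P.B * K) ^ i).toE x)) j ≤ P.cu j}

/-! ### The operators of the condensed problem -/

section Operators

variable {w : ℝ} [hw0 : Fact (0 < w)]

theorem summable_conv {P : CLQR n m px pu} (hw : AdmissibleWeight P.A w) :
    ∃ c : ℝ, 0 ≤ c ∧ ∀ u : WL2 w (EuclideanSpace ℝ (Fin m)),
      (Summable fun i => w ^ i *
        ‖∑ j ∈ Finset.range (i + 1), (P.A ^ (i - j)).toE (P.B.toE (u j))‖ ^ 2) ∧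
      ∑' i, w ^ i * ‖∑ j ∈ Finset.range (i + 1), (P.A ^ (i - j)).toE (P.B.toE (u j))‖ ^ 2
        ≤ c ^ 2 * ‖u‖ ^ 2 := by
  obtain ⟨c, r, hc, hr, hr1, hb⟩ := hw.exists_bound
  set b := ‖P.B.toE‖ with hbdef
  have hs0 : 0 < √w := Real.sqrt_pos.2 hw.pos
  have hpw : ∀ i : ℕ, w ^ i = ((√w) ^ i) ^ 2 := fun i => by
    rw [← pow_mul, mul_comm i 2, pow_mul, Real.sq_sqrt hw.pos.le]
  have hgeo : Summable fun k : ℕ => ‖r ^ k‖ := by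
    simpa [Real.norm_of_nonneg (pow_nonneg hr _), abs_of_nonneg hr] using
      summable_geometric_of_lt_one hr hr1
  have hS : ∀ i : ℕ, ∑ j ∈ Finset.range (i + 1), r ^ (i - j) ≤ (1 - r)⁻¹ := by
    intro i
    have h1 := Finset.sum_range_reflect (fun k => r ^ k) (i + 1)
    simp only [Nat.add_sub_cancel] at h1
    rw [h1, ← tsum_geometric_of_lt_one hr hr1]
    exact (summable_geometric_of_lt_one hr hr1).sum_le_tsum _ fun k _ => pow_nonneg hr k
  have h1r : 0 < 1 - r := by linarith
  refine ⟨c * b * (1 - r)⁻¹, by positivity, fun u => ?_⟩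
  set f : ℕ → ℝ := fun j => w ^ j * ‖u j‖ ^ 2 with hf
  have hf0 : ∀ j, 0 ≤ f j := fun j => mul_nonneg (pow_nonneg hw.pos.le j) (sq_nonneg _)
  have hfs : Summable fun j => ‖f j‖ := u.summable_norm_sq.norm
  have hprod := tsum_mul_tsum_eq_tsum_sum_range_of_summable_norm hfs hgeo
  have hsum := (summable_norm_sum_mul_range_of_summable_norm hfs hgeo).of_norm
  have hpt : ∀ i, w ^ i *
      ‖∑ j ∈ Finset.range (i + 1), (P.A ^ (i - j)).toE (P.B.toE (u j))‖ ^ 2 ≤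
      (c * b) ^ 2 * (1 - r)⁻¹ * ∑ j ∈ Finset.range (i + 1), f j * r ^ (i - j) := by
    intro i
    have e1 : (√w) ^ i * ‖∑ j ∈ Finset.range (i + 1), (P.A ^ (i - j)).toE (P.B.toE (u j))‖ ≤
        c * b * ∑ j ∈ Finset.range (i + 1), r ^ (i - j) * ((√w) ^ j * ‖u j‖) := by
      refine (mul_le_mul_of_nonneg_left (norm_sum_le _ _) (by positivity)).trans ?_
      rw [Finset.mul_sum, Finset.mul_sum]
      refine Finset.sum_le_sum fun j hj => ?_
      have hji : j ≤ i := by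
        have := Finset.mem_range.1 hj
        omega
      have e2 : ‖(P.A ^ (i - j)).toE (P.B.toE (u j))‖ ≤ ‖(P.A ^ (i - j)).toE‖ * (b * ‖u j‖) :=
        ((P.A ^ (i - j)).toE.le_opNorm _).trans
          (mul_le_mul_of_nonneg_left (P.B.toE.le_opNorm _) (norm_nonneg _))
      have e3 : (√w) ^ i = (√w) ^ (i - j) * (√w) ^ j := by
        rw [← pow_add, Nat.sub_add_cancel hji]
      calc (√w) ^ i * ‖(P.A ^ (i - j)).toE (P.B.toE (u j))‖
          ≤ (√w) ^ i * (‖(P.A ^ (i - j)).toE‖ * (b * ‖u j‖)) :=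
            mul_le_mul_of_nonneg_left e2 (by positivity)
        _ = ((√w) ^ (i - j) * ‖(P.A ^ (i - j)).toE‖) * (b * ((√w) ^ j * ‖u j‖)) := by
            rw [e3]
            ring
        _ ≤ (c * r ^ (i - j)) * (b * ((√w) ^ j * ‖u j‖)) :=
            mul_le_mul_of_nonneg_right (hb _) (by positivity)
        _ = c * b * (r ^ (i - j) * ((√w) ^ j * ‖u j‖)) := by ring
    have e4 : (∑ j ∈ Finset.range (i + 1), r ^ (i - j) * ((√w) ^ j * ‖u j‖)) ^ 2 ≤
        (∑ j ∈ Finset.range (i + 1), r ^ (i - j)) *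
          ∑ j ∈ Finset.range (i + 1), f j * r ^ (i - j) := by
      refine Finset.sum_sq_le_sum_mul_sum_of_sq_le_mul _ (fun j _ => pow_nonneg hr _)
        (fun j _ => mul_nonneg (hf0 j) (pow_nonneg hr _)) fun j _ => le_of_eq ?_
      simp only [hf, hpw j]
      ring
    have e5 : 0 ≤ ∑ j ∈ Finset.range (i + 1), f j * r ^ (i - j) :=
      Finset.sum_nonneg fun j _ => mul_nonneg (hf0 j) (pow_nonneg hr _)
    calc w ^ i * ‖∑ j ∈ Finset.range (i + 1), (P.A ^ (i - j)).toE (P.B.toE (u j))‖ ^ 2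
        = ((√w) ^ i * ‖∑ j ∈ Finset.range (i + 1), (P.A ^ (i - j)).toE (P.B.toE (u j))‖) ^ 2 := by
          rw [hpw i, mul_pow]
      _ ≤ (c * b * ∑ j ∈ Finset.range (i + 1), r ^ (i - j) * ((√w) ^ j * ‖u j‖)) ^ 2 :=
          pow_le_pow_left₀ (by positivity) e1 2
      _ = (c * b) ^ 2 * (∑ j ∈ Finset.range (i + 1), r ^ (i - j) * ((√w) ^ j * ‖u j‖)) ^ 2 := by
          ring
      _ ≤ (c * b) ^ 2 * ((∑ j ∈ Finset.range (i + 1), r ^ (i - j)) *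
          ∑ j ∈ Finset.range (i + 1), f j * r ^ (i - j)) :=
          mul_le_mul_of_nonneg_left e4 (sq_nonneg _)
      _ ≤ (c * b) ^ 2 * ((1 - r)⁻¹ * ∑ j ∈ Finset.range (i + 1), f j * r ^ (i - j)) :=
          mul_le_mul_of_nonneg_left (mul_le_mul_of_nonneg_right (hS i) e5) (sq_nonneg _)
      _ = _ := by ring
  have hs : Summable fun i => w ^ i *
      ‖∑ j ∈ Finset.range (i + 1), (P.A ^ (i - j)).toE (P.B.toE (u j))‖ ^ 2 :=
    Summable.of_nonneg_of_le (fun i => mul_nonneg (pow_nonneg hw.pos.le i) (sq_nonneg _)) hpt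
      (hsum.mul_left _)
  refine ⟨hs, (hs.tsum_le_tsum hpt (hsum.mul_left _)).trans (le_of_eq ?_)⟩
  rw [tsum_mul_left, ← hprod, tsum_geometric_of_lt_one hr hr1, WL2.norm_sq_eq]
  ring

/-- The operator `𝐁`: `(𝐁 u)ᵢ = ∑_{j ≤ i} A^{i-j} B uⱼ`, mapping inputs `(u₀, u₁, …)` to the
forced response in the states `(x₁, x₂, …)`. -/
noncomputable def opB (hw : AdmissibleWeight P.A w) :
    WL2 w (EuclideanSpace ℝ (Fin m)) →L[ℝ] WL2 w (EuclideanSpace ℝ (Fin n)) :=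
  LinearMap.mkContinuousOfExistsBound
    { toFun := fun u =>
        WL2.mk (fun i => ∑ j ∈ Finset.range (i + 1), (P.A ^ (i - j)).toE (P.B.toE (u j)))
          ((summable_conv hw).choose_spec.2 u).1
      map_add' := fun u v => by
        ext i
        simp [Finset.sum_add_distrib]
      map_smul' := fun c u => by
        ext i
        simp [Finset.mul_sum] }
    (by
      obtain ⟨c, hc, h⟩ := summable_conv hw
      refine ⟨c, fun u => le_of_sq_le_sq ?_ (by positivity)⟩
      rw [mul_pow, WL2.norm_sq_eq]
      exact (h u).2)

theorem opB_apply (hw : AdmissibleWeight P.A w) (u : WL2 w (EuclideanSpace ℝ (Fin m))) (i : ℕ) :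
    P.opB hw u i = ∑ j ∈ Finset.range (i + 1), (P.A ^ (i - j)).toE (P.B.toE (u j)) := rfl

/-- The free response `𝐀 xinit = (A xinit, A² xinit, …)`. -/
noncomputable def freeResponse (hw : AdmissibleWeight P.A w) :
    WL2 w (EuclideanSpace ℝ (Fin n)) :=
  WL2.mk (fun i => (P.A ^ (i + 1)).toE P.xinit) (by
    obtain ⟨c, r, hc, hr, hr1, hb⟩ := hw.exists_bound
    have hr2 : r ^ 2 < 1 := by nlinarith
    refine Summable.of_nonneg_of_le
      (fun i => mul_nonneg (pow_nonneg hw.pos.le i) (sq_nonneg _)) (fun i => ?_)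
      ((summable_geometric_of_lt_one (sq_nonneg r) hr2).mul_left
        (w⁻¹ * (c * r * ‖P.xinit‖) ^ 2))
    have hpw : w * w ^ i = ((√w) ^ (i + 1)) ^ 2 := by
      rw [← pow_mul, mul_comm (i + 1) 2, pow_mul, Real.sq_sqrt hw.pos.le, pow_succ]
      ring
    have h1 : (√w) ^ (i + 1) * ‖(P.A ^ (i + 1)).toE P.xinit‖ ≤ c * r ^ (i + 1) * ‖P.xinit‖ := by
      refine (mul_le_mul_of_nonneg_left ((P.A ^ (i + 1)).toE.le_opNorm _) (by positivity)).trans ?_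
      rw [← mul_assoc]
      exact mul_le_mul_of_nonneg_right (hb _) (norm_nonneg _)
    have h2 := pow_le_pow_left₀ (by positivity) h1 2
    rw [mul_pow, ← hpw] at h2
    have h3 := mul_le_mul_of_nonneg_left h2 (inv_nonneg.2 hw.pos.le)
    rw [← mul_assoc, ← mul_assoc, inv_mul_cancel₀ hw.pos.ne', one_mul] at h3
    refine h3.trans (le_of_eq ?_)
    ring)

/-- The state sequence `𝐀 xinit + 𝐁 u = (x₁, x₂, …)` of an input sequence in `ℓ²_w`. -/
noncomputable def stateSeq (hw : AdmissibleWeight P.A w)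
    (u : WL2 w (EuclideanSpace ℝ (Fin m))) : WL2 w (EuclideanSpace ℝ (Fin n)) :=
  P.freeResponse hw + P.opB hw u

theorem stateSeq_apply (hw : AdmissibleWeight P.A w) (u : WL2 w (EuclideanSpace ℝ (Fin m)))
    (i : ℕ) : P.stateSeq hw u i = P.traj u (i + 1) := by
  have hmul : ∀ (k : ℕ) (x : EuclideanSpace ℝ (Fin n)),
      P.A.toE ((P.A ^ k).toE x) = (P.A ^ (k + 1)).toE x := by
    intro k x
    ext j
    rw [Matrix.toE_apply, Matrix.toE_apply, pow_succ', ← Matrix.mulVec_mulVec]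
    rfl
  have hone : ∀ x : EuclideanSpace ℝ (Fin n), (P.A ^ 0).toE x = x := by
    intro x
    ext j
    rw [Matrix.toE_apply, pow_zero, Matrix.one_mulVec]
  induction i with
  | zero =>
    simp only [stateSeq, WL2.add_apply, opB_apply, freeResponse, WL2.mk_apply, traj, zero_add,
      Finset.sum_range_one, Nat.sub_self, hone, pow_one]
  | succ i ih =>
    rw [traj, ← ih]
    simp only [stateSeq, WL2.add_apply, opB_apply, freeResponse, WL2.mk_apply, map_add, map_sum,
      hmul]
    rw [Finset.sum_range_succ _ (i + 1), Nat.sub_self, hone, ← add_assoc]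
    congr 2
    refine Finset.sum_congr rfl fun j hj => ?_
    have := Finset.mem_range.1 hj
    rw [Nat.sub_add_comm (by omega)]

/-- The operator `𝐂`, whose `i`-th block row maps `u` to `(Cu uᵢ, Cx (𝐁 u)ᵢ)`. -/
noncomputable def opC (hw : AdmissibleWeight P.A w) :
    WL2 w (EuclideanSpace ℝ (Fin m)) →L[ℝ] WL2 w (EuclideanSpace ℝ (Fin pu ⊕ Fin px)) :=
  WL2.diag (Matrix.fromRows P.Cu (0 : Matrix (Fin px) (Fin m) ℝ)).toE +
    WL2.diag (Matrix.fromRows (0 : Matrix (Fin pu) (Fin n) ℝ) P.Cx).toE ∘L P.opB hw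

theorem opC_apply_inl (hw : AdmissibleWeight P.A w) (u : WL2 w (EuclideanSpace ℝ (Fin m)))
    (i : ℕ) (j : Fin pu) : P.opC hw u i (Sum.inl j) = P.Cu.toE (u i) j := by
  simp [opC, Matrix.toE_apply, Matrix.fromRows_mulVec]

theorem opC_apply_inr (hw : AdmissibleWeight P.A w) (u : WL2 w (EuclideanSpace ℝ (Fin m)))
    (i : ℕ) (j : Fin px) : P.opC hw u i (Sum.inr j) = P.Cx.toE (P.opB hw u i) j := by
  simp [opC, Matrix.toE_apply, Matrix.fromRows_mulVec]

/-- The right-hand side `𝐜`, with blocks `cᵢ = (cu, cx - Cx A^{i+1} xinit)`. -/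
noncomputable def vecC (hw : AdmissibleWeight P.A w) :
    WL2 w (EuclideanSpace ℝ (Fin pu ⊕ Fin px)) :=
  WL2.mk (fun _ => WithLp.toLp 2 (Sum.elim P.cu P.cx))
      ((summable_geometric_of_lt_one hw.pos.le hw.lt_one).mul_right _) -
    WL2.diag (Matrix.fromRows (0 : Matrix (Fin pu) (Fin n) ℝ) P.Cx).toE (P.freeResponse hw)

/-! ### The dual problem -/

/-- The objective `f` of the condensed primal problem: the cost as a function of the input
sequence in `ℓ²_w`, with values in `[0, ∞]`. -/
noncomputable def objective (u : WL2 w (EuclideanSpace ℝ (Fin m))) : ℝ≥0∞ := P.cost u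

/-- `f` is strongly convex with modulus `μ` on `ℓ²_w`. -/
def IsStrongConvexityModulus (w : ℝ) [Fact (0 < w)] (μ : ℝ) : Prop :=
  StrongConvexOn {u : WL2 w (EuclideanSpace ℝ (Fin m)) | P.objective u ≠ ⊤} μ
    fun u => (P.objective u).toReal

/-- The Fenchel conjugate `f⋆(y) = sup_u (⟨y, u⟩ - f(u))`. -/
noncomputable def conjObjective (y : WL2 w (EuclideanSpace ℝ (Fin m))) : EReal :=
  ⨆ u : WL2 w (EuclideanSpace ℝ (Fin m)), ((inner ℝ y u : ℝ) : EReal) - (P.objective u : EReal)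

/-- `h⋆(λ) = f⋆(𝐂⋆ λ) - ⟨λ, 𝐜⟩` as an extended real number. -/
noncomputable def hStarE (hw : AdmissibleWeight P.A w)
    (l : WL2 w (EuclideanSpace ℝ (Fin pu ⊕ Fin px))) : EReal :=
  P.conjObjective (ContinuousLinearMap.adjoint (P.opC hw) l) -
    ((inner ℝ l (P.vecC hw) : ℝ) : EReal)

/-- `h⋆` as a real-valued function. -/
noncomputable def hStar (hw : AdmissibleWeight P.A w)
    (l : WL2 w (EuclideanSpace ℝ (Fin pu ⊕ Fin px))) : ℝ :=
  (P.hStarE hw l).toReal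

open Classical in
/-- The dual objective `F = h⋆ + δ₋`, with `δ₋` the indicator of the nonpositive orthant. -/
noncomputable def dualObjective (hw : AdmissibleWeight P.A w)
    (l : WL2 w (EuclideanSpace ℝ (Fin pu ⊕ Fin px))) : EReal :=
  if ∀ i j, l i j ≤ 0 then P.hStarE hw l else ⊤

/-- `l` minimizes the dual objective `F`. -/
def IsDualOptimal (hw : AdmissibleWeight P.A w)
    (l : WL2 w (EuclideanSpace ℝ (Fin pu ⊕ Fin px))) : Prop :=
  ∀ l', P.dualObjective hw l ≤ P.dualObjective hw l'

/-! ### The accelerated forward-backward splitting iteration -/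

/-- The extrapolation factors `α⁰ = 0`, `αᵏ = (k - 1) / (k + a)` for `k ≥ 1`. -/
noncomputable def alpha (a : ℝ) (k : ℕ) : ℝ := if k = 0 then 0 else ((k : ℝ) - 1) / (k + a)

/-- The pairs `(λᵏ, λᵏ⁻¹)` of the AFBS iteration
`λ̂ᵏ = λᵏ + αᵏ (λᵏ - λᵏ⁻¹)`, `λᵏ⁺¹ = min {λ̂ᵏ - (1/L) ∇h⋆(λ̂ᵏ), 0}`, started at `λ⁰ = 0`
(with the immaterial convention `λ⁻¹ = 0`). -/
noncomputable def dualPair (hw : AdmissibleWeight P.A w) (a L : ℝ) :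
    ℕ → WL2 w (EuclideanSpace ℝ (Fin pu ⊕ Fin px)) × WL2 w (EuclideanSpace ℝ (Fin pu ⊕ Fin px))
  | 0 => (0, 0)
  | k + 1 =>
    let l := (dualPair hw a L k).1
    let lhat := l + alpha a k • (l - (dualPair hw a L k).2)
    (WL2.clip (lhat - (1 / L) • gradient (P.hStar hw) lhat), l)

/-- The dual iterates `λᵏ`. -/
noncomputable def dualIter (hw : AdmissibleWeight P.A w) (a L : ℝ) (k : ℕ) :
    WL2 w (EuclideanSpace ℝ (Fin pu ⊕ Fin px)) :=
  (P.dualPair hw a L k).1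

/-- The extrapolated dual iterates `λ̂ᵏ`. -/
noncomputable def dualHat (hw : AdmissibleWeight P.A w) (a L : ℝ) (k : ℕ) :
    WL2 w (EuclideanSpace ℝ (Fin pu ⊕ Fin px)) :=
  P.dualIter hw a L k + alpha a k • (P.dualIter hw a L k - (P.dualPair hw a L k).2)

/-! ### Primal sequences and truncation horizons -/

/-- The Lagrangian truncated at the horizon `T`, with terminal cost `½ x_Tᵀ Plq x_T`. The block
`λᵢ` is paired, with weight `wⁱ`, with the constraints `Cu uᵢ ≤ cu` and `Cx xᵢ₊₁ ≤ cx`. -/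
noncomputable def truncLagrangian (Plq : Matrix (Fin n) (Fin n) ℝ)
    (l : WL2 w (EuclideanSpace ℝ (Fin pu ⊕ Fin px))) (T : ℕ)
    (u : ℕ → EuclideanSpace ℝ (Fin m)) : ℝ :=
  (1 / 2) * inner ℝ (P.traj u T) (Plq.toE (P.traj u T)) +
    ∑ i ∈ Finset.range T, (P.stageCost (P.traj u i) (u i) -
      w ^ i * (∑ j, l i (Sum.inl j) * (P.Cu.toE (u i) j - P.cu j) +
        ∑ j, l i (Sum.inr j) * (P.Cx.toE (P.traj u (i + 1)) j - P.cx j)))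

/-- `u` is the input sequence associated with the multiplier `λ` and the horizon `T`: it minimizes
the truncated Lagrangian and follows the LQ feedback from time `T` on, so that
`xᵢ = (A + B K)^{i-T} x_T` for `i > T`. -/
def IsPrimalOf (Plq : Matrix (Fin n) (Fin n) ℝ) (K : Matrix (Fin m) (Fin n) ℝ)
    (l : WL2 w (EuclideanSpace ℝ (Fin pu ⊕ Fin px))) (T : ℕ)
    (u : ℕ → EuclideanSpace ℝ (Fin m)) : Prop :=
  (∀ v, P.truncLagrangian Plq l T u ≤ P.truncLagrangian Plq l T v) ∧
    ∀ i, T ≤ i → u i = K.toE (P.traj u i)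

/-- The candidates for the next horizon: the times `T' ≥ T` for which there is a time `TS ≥ T'`
such that the trajectory associated with `(λ, T)` lies in `S` at time `TS` and satisfies
`Cx xᵢ₊₁ ◁ cx` and `Cu uᵢ ◁ cu` for all `i ∈ {T', …, TS}`, where `◁` is `≤` or `<`. -/
def horizonCandidates (cmp : ℝ → ℝ → Prop) (Plq : Matrix (Fin n) (Fin n) ℝ)
    (K : Matrix (Fin m) (Fin n) ℝ) (S : Set (EuclideanSpace ℝ (Fin n)))
    (l : WL2 w (EuclideanSpace ℝ (Fin pu ⊕ Fin px))) (T : ℕ) : Set ℕ :=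
  {T' | T ≤ T' ∧ ∃ u, P.IsPrimalOf Plq K l T u ∧ ∃ TS, T' ≤ TS ∧ P.traj u TS ∈ S ∧
    ∀ i, T' ≤ i → i ≤ TS → (∀ j, cmp (P.Cx.toE (P.traj u (i + 1)) j) (P.cx j)) ∧
      ∀ j, cmp (P.Cu.toE (u i) j) (P.cu j)}

/-- The truncation horizons: `T⁰ = 0`, and `Tᵏ⁺¹` is the least candidate determined by
`λ̂ᵏ` and `Tᵏ`. -/
noncomputable def horizon (cmp : ℝ → ℝ → Prop) (Plq : Matrix (Fin n) (Fin n) ℝ)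
    (K : Matrix (Fin m) (Fin n) ℝ) (S : Set (EuclideanSpace ℝ (Fin n)))
    (hw : AdmissibleWeight P.A w) (a L : ℝ) : ℕ → ℕ
  | 0 => 0
  | k + 1 => sInf (P.horizonCandidates cmp Plq K S (P.dualHat hw a L k)
      (horizon cmp Plq K S hw a L k))

end Operators

end CLQR

/-! ### Summability of perturbed descent sequences -/

section Descent

/-! Everything reduces to a least-norm problem in a Hilbert space. Let `N` be a square factor of `R
+ Bᵀ Plq B`. Completing the square in the Riccati equation shows that an input with deviation `vᵢ =
N (uᵢ - K xᵢ)` costs `½ x₀ᵀ Plq x₀ + ½ ∑ ‖vᵢ‖²`. Detectability makes the terminal term vanish in the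
limit and makes the inputs of finite cost correspond exactly to `v ∈ ℓ²`, without weight. In this
coordinate the constraints read `D v + d ≤ 0` with a bounded causal operator `D` into the weighted
space. The dual function becomes the explicit quadratic `h⋆(λ) = ½ ‖D⋆ λ‖² + ⟨λ, d⟩ - const`, and
its gradient `D D⋆ λ + d` is the constraint residual of the input with deviation `D⋆ λ`.

The optimal input is given by the least-norm feasible `v`. Its state eventually enters the invariant
set. From then on `v` vanishes, and only finitely many constraints matter near `v`, so Farkas' lemma
yields a finitely supported multiplier with `D⋆ λ = v` and complementary slackness. No constraint
qualification is needed. Expanding the quadratic at this multiplier gives `F(λ) - min F ≥ ½ ‖D⋆ λ -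
v‖²` for `λ ≤ 0`, which turns dual rates into primal rates. Strong convexity of `f` with modulus `μ`
is the bound `μ ‖u - u'‖² ≤ ‖v - v'‖²` between inputs and deviations.

The rate for `F` comes from the usual Lyapunov function of accelerated descent. For `a > 2` it also
leaves summable remainders, from which the distances to the minimizers converge, and Opial's lemma
then gives weak convergence.

Truncation is exact. By causality `D⋆ λ` vanishes wherever a tail of `λ` does, so the truncated
Lagrangian is minimized by `D⋆ λ` itself. The choice of `Tᵏ⁺¹` makes the gradient nonpositive from
that time on, so clipping keeps the tail of the multiplier zero. Since the deviations `D⋆ λ̂ᵏ`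
converge strongly, the states they generate converge uniformly in time. Past a fixed time they all
lie near the origin, so the horizons stop growing. -/

theorem summable_of_descent {W p q : ℕ → ℝ} (hW : ∀ k, 0 ≤ W k) (hp : ∀ k, 0 ≤ p k)
    (hq : ∀ k, 0 ≤ q k) (hqs : Summable q) (h : ∀ k, W (k + 1) + p k ≤ W k + q k) :
    Summable p := by
  refine summable_of_sum_range_le (c := W 0 + ∑' k, q k) hp fun n => ?_
  have h1 : ∀ n, W n + ∑ k ∈ Finset.range n, p k ≤ W 0 + ∑ k ∈ Finset.range n, q k := by
    intro n
    induction n with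
    | zero => simp
    | succ n ih =>
      rw [Finset.sum_range_succ, Finset.sum_range_succ]
      linarith [h n]
  linarith [h1 n, hW n, hqs.sum_le_tsum (Finset.range n) fun k _ => hq k]

/-- Subtracting the partial sums of `q` leaves a sequence that is antitone and bounded below. -/
theorem exists_tendsto_of_descent {W q : ℕ → ℝ} (hW : ∀ k, 0 ≤ W k)
    (hq : ∀ k, 0 ≤ q k) (hqs : Summable q) (h : ∀ k, W (k + 1) ≤ W k + q k) :
    ∃ l, Filter.Tendsto W Filter.atTop (𝓝 l) := by
  have hanti : Antitone fun n => W n - ∑ k ∈ Finset.range n, q k := by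
    refine antitone_nat_of_succ_le fun n => ?_
    rw [Finset.sum_range_succ]
    linarith [h n]
  have hbdd : BddBelow (Set.range fun n => W n - ∑ k ∈ Finset.range n, q k) := by
    refine ⟨-∑' k, q k, ?_⟩
    rintro _ ⟨n, rfl⟩
    have := hqs.sum_le_tsum (Finset.range n) fun k _ => hq k
    simp only
    linarith [hW n]
  have h1 := (tendsto_atTop_ciInf hanti hbdd).add hqs.hasSum.tendsto_sum_nat
  exact ⟨_, h1.congr fun n => by simp⟩

end Descent

/-! ### Accelerated forward-backward splitting -/

section Accelerated

variable {E : Type*} [NormedAddCommGroup E] [InnerProductSpace ℝ E]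

/-- The sequences `x`, `xp` (the predecessors) and `y` (the extrapolations) are generated by an
accelerated forward-backward splitting for `F` on the convex set `C`; the forward-backward step
enters only through its descent inequality. -/
structure IsAcceleratedDescent (C : Set E) (F : E → ℝ) (a L : ℝ) (x xp y : ℕ → E) : Prop where
  convex : ConvexOn ℝ C F
  two_lt : 2 < a
  pos : 0 < L
  mem : ∀ k, x k ∈ C
  pred_zero : xp 0 = x 0
  pred_succ : ∀ k, xp (k + 1) = x k
  extrapolate : ∀ k, y k = x k + CLQR.alpha a k • (x k - xp k)
  descent : ∀ k, ∀ z ∈ C,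
    F (x (k + 1)) + L / 2 * ‖x (k + 1) - z‖ ^ 2 ≤ F z + L / 2 * ‖y k - z‖ ^ 2

namespace IsAcceleratedDescent

variable {C : Set E} {F : E → ℝ} {a L : ℝ} {x xp y : ℕ → E}

/-- This clears the denominator of the extrapolation factor uniformly in `k`. At `k = 0` the factor
is set to `0` rather than `-1 / a`, which is harmless because the predecessor of `x 0` is `x 0`. -/
theorem mul_alpha (h : IsAcceleratedDescent C F a L x xp y) (k : ℕ) :
    ((k : ℝ) + a) • (CLQR.alpha a k • (x k - xp k)) = ((k : ℝ) - 1) • (x k - xp k) := by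
  rcases Nat.eq_zero_or_pos k with rfl | hk
  · simp [h.pred_zero]
  · have h0 : (k : ℝ) + a ≠ 0 := by
      have := h.two_lt
      positivity
    rw [smul_smul, CLQR.alpha, if_neg hk.ne', mul_div_cancel₀ _ h0]

theorem alpha_bounds (ha : 2 < a) (k : ℕ) : 0 ≤ CLQR.alpha a k ∧ CLQR.alpha a k ≤ 1 := by
  unfold CLQR.alpha
  split_ifs with hk
  · simp
  · have h1 : (1 : ℝ) ≤ k := by exact_mod_cast Nat.one_le_iff_ne_zero.2 hk
    have h0 : 0 < (k : ℝ) + a := by linarith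
    exact ⟨div_nonneg (by linarith) h0.le, by rw [div_le_one h0]; linarith⟩

/-- The descent inequality is tested at the convex combination `z = (k x k + a s) / (k + a)` and
multiplied by `(k + a)²`. The two norms are then `(k + a) (x (k + 1) - z)` and `(k + a) (y k - z)`.
The right-hand vector at `k + 1` is the left-hand vector at `k`, so the estimates chain. -/
theorem lyapunov_step (h : IsAcceleratedDescent C F a L x xp y) {s : E} (hs : s ∈ C) (k : ℕ) :
    (k + a) ^ 2 * (F (x (k + 1)) - F s) +
        L / 2 * ‖a • x k + ((k : ℝ) + a) • (x (k + 1) - x k) - a • s‖ ^ 2 ≤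
      k * (k + a) * (F (x k) - F s) +
        L / 2 * ‖a • xp k + ((k : ℝ) + a - 1) • (x k - xp k) - a • s‖ ^ 2 := by
  have ha := h.two_lt
  have hk : (0 : ℝ) ≤ k := Nat.cast_nonneg k
  have h0 : 0 < (k : ℝ) + a := by linarith
  set σ : ℝ := (k : ℝ) + a with hσ
  set z : E := (k / σ : ℝ) • x k + (a / σ : ℝ) • s with hz
  have hsum : (k / σ : ℝ) + a / σ = 1 := by
    rw [← add_div, div_self h0.ne']
  have hk1 : (0 : ℝ) ≤ k / σ := by positivity
  have hk2 : (0 : ℝ) ≤ a / σ := by positivity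
  have hzC : z ∈ C := h.convex.1 (h.mem k) hs hk1 hk2 hsum
  have hFz : F z ≤ (k / σ : ℝ) * F (x k) + (a / σ : ℝ) * F s :=
    h.convex.2 (h.mem k) hs hk1 hk2 hsum
  have hd := h.descent k z hzC
  have hσz : σ • z = (k : ℝ) • x k + a • s := by
    rw [hz, smul_add, smul_smul, smul_smul, mul_div_cancel₀ _ h0.ne', mul_div_cancel₀ _ h0.ne']
  have e1 : a • x k + σ • (x (k + 1) - x k) - a • s = σ • (x (k + 1) - z) := by
    rw [smul_sub σ _ z, hσz, hσ]
    module
  have e2 : a • xp k + (σ - 1) • (x k - xp k) - a • s = σ • (y k - z) := by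
    rw [smul_sub σ _ z, hσz, h.extrapolate, smul_add, h.mul_alpha, hσ]
    module
  rw [e1, e2, norm_smul, norm_smul, mul_pow, mul_pow, Real.norm_of_nonneg h0.le]
  have h3 : σ ^ 2 * ((k / σ : ℝ) * F (x k) + (a / σ : ℝ) * F s) =
      k * σ * F (x k) + a * σ * F s := by
    field_simp
  have h4 := mul_le_mul_of_nonneg_left (hd.trans (add_le_add_left hFz _)) (sq_nonneg σ)
  have h5 : σ ^ 2 * F s = k * σ * F s + a * σ * F s := by rw [hσ]; ring
  nlinarith [h3, h4, h5]

variable {s : E}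

theorem energy_le (h : IsAcceleratedDescent C F a L x xp y) (hs : s ∈ C)
    (hmin : ∀ z ∈ C, F s ≤ F z) (k : ℕ) :
    (k + a) ^ 2 * (F (x (k + 1)) - F s) +
        L / 2 * ‖a • x k + ((k : ℝ) + a) • (x (k + 1) - x k) - a • s‖ ^ 2 ≤
      L / 2 * (a ^ 2 * ‖x 0 - s‖ ^ 2) := by
  have ha := h.two_lt
  induction k with
  | zero =>
    have h1 := h.lyapunov_step hs 0
    refine h1.trans (le_of_eq ?_)
    rw [h.pred_zero, sub_self, smul_zero, add_zero, ← smul_sub, norm_smul, mul_pow,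
      Real.norm_eq_abs, sq_abs]
    simp
  | succ k ih =>
    have h1 := h.lyapunov_step hs (k + 1)
    rw [h.pred_succ] at h1
    push_cast at h1 ⊢
    have e : (k : ℝ) + 1 + a - 1 = k + a := by ring
    rw [e] at h1
    have hF := hmin _ (h.mem (k + 1))
    have hk : (0 : ℝ) ≤ k := Nat.cast_nonneg k
    -- The difference of the two sides is `(a - 2) k + a² - a - 1`, which is nonnegative for `a >
    -- 2`.
    have h2 : (k + 1 : ℝ) * (k + 1 + a) ≤ (k + a) ^ 2 := by nlinarith
    nlinarith [mul_le_mul_of_nonneg_right h2 (sub_nonneg.2 hF)]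

theorem rate (h : IsAcceleratedDescent C F a L x xp y) (hs : s ∈ C)
    (hmin : ∀ z ∈ C, F s ≤ F z) (k : ℕ) :
    F (x (k + 1)) - F s ≤ a ^ 2 * L / (2 * ((k + 1 : ℕ) + a - 1) ^ 2) * ‖x 0 - s‖ ^ 2 := by
  have ha := h.two_lt
  have hk : (0 : ℝ) ≤ k := Nat.cast_nonneg k
  have h0 : 0 < (k : ℝ) + a := by linarith
  have h1 := h.energy_le hs hmin k
  have h2 : 0 ≤ L / 2 * ‖a • x k + ((k : ℝ) + a) • (x (k + 1) - x k) - a • s‖ ^ 2 := by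
    have := h.pos
    positivity
  have e : ((k + 1 : ℕ) : ℝ) + a - 1 = k + a := by
    push_cast
    ring
  rw [e, div_mul_eq_mul_div, le_div_iff₀ (by positivity)]
  nlinarith

/-- Strictness of `a > 2` is used here: the energy drops at each step by at least `(a - 2) (k + 1)`
times the gap, because `(k + a)² - (k + 1) (k + 1 + a) - (a - 2) (k + 1) = (a - 1)²`. -/
theorem summable_values (h : IsAcceleratedDescent C F a L x xp y) (hs : s ∈ C)
    (hmin : ∀ z ∈ C, F s ≤ F z) :
    Summable fun k : ℕ => ((k : ℝ) + 1) * (F (x (k + 1)) - F s) := by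
  have ha := h.two_lt
  have hL := h.pos
  have hφ : ∀ k, 0 ≤ F (x k) - F s := fun k => sub_nonneg.2 (hmin _ (h.mem k))
  have h1 : Summable fun k : ℕ => (a - 2) * (((k : ℝ) + 1) * (F (x (k + 1)) - F s)) := by
    refine summable_of_descent (q := fun _ => 0)
      (W := fun k => (k + a) ^ 2 * (F (x (k + 1)) - F s) +
        L / 2 * ‖a • x k + ((k : ℝ) + a) • (x (k + 1) - x k) - a • s‖ ^ 2)
      (fun k => ?_) (fun k => ?_) (fun _ => le_rfl) summable_zero fun k => ?_
    · have := hφ (k + 1)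
      positivity
    · have := hφ (k + 1)
      have : 0 ≤ a - 2 := by linarith
      positivity
    · have h1 := h.lyapunov_step hs (k + 1)
      rw [h.pred_succ] at h1
      push_cast at h1 ⊢
      have e : (k : ℝ) + 1 + a - 1 = k + a := by ring
      rw [e] at h1
      have hk : (0 : ℝ) ≤ k := Nat.cast_nonneg k
      have h2 : (k + 1 : ℝ) * (k + 1 + a) + (a - 2) * (k + 1) ≤ (k + a) ^ 2 := by nlinarith
      nlinarith [mul_le_mul_of_nonneg_right h2 (hφ (k + 1))]
  exact (summable_mul_left_iff (by linarith : a - 2 ≠ 0)).1 h1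

/-- Testing the descent inequality at the current iterate bounds the new gap plus the new squared
step by the old gap plus `α²` times the old squared step. After scaling by `(k + 1 + a)²` the
coefficient of the old step is `k²`, at least `k + 1` below `(k + a)²`. The growth of the scaling in
front of the gap is of order `k + 1` and is absorbed by `summable_values`. -/
theorem summable_steps (h : IsAcceleratedDescent C F a L x xp y) (hs : s ∈ C)
    (hmin : ∀ z ∈ C, F s ≤ F z) :
    Summable fun k : ℕ => ((k : ℝ) + 1) * ‖x (k + 1) - x k‖ ^ 2 := by
  have ha := h.two_lt
  have hL := h.pos
  have hφ : ∀ k, 0 ≤ F (x k) - F s := fun k => sub_nonneg.2 (hmin _ (h.mem k))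
  have h1 : Summable fun k : ℕ => L / 2 * (((k : ℝ) + 1) * ‖x (k + 1) - x k‖ ^ 2) := by
    refine summable_of_descent
      (q := fun k => (3 + 2 * a) * (((k : ℝ) + 1) * (F (x (k + 1)) - F s)))
      (W := fun k => (k + a) ^ 2 * (F (x (k + 1)) - F s + L / 2 * ‖x (k + 1) - x k‖ ^ 2))
      (fun k => ?_) (fun k => ?_) (fun k => ?_)
      ((h.summable_values hs hmin).mul_left _) fun k => ?_
    · have := hφ (k + 1)
      positivity
    · positivity
    · have := hφ (k + 1)
      have : 0 ≤ a := by linarith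
      positivity
    · have hk : (0 : ℝ) ≤ k := Nat.cast_nonneg k
      have h0 : 0 < (k : ℝ) + 1 + a := by linarith
      have hd := h.descent (k + 1) (x (k + 1)) (h.mem _)
      have hm := h.mul_alpha (k + 1)
      rw [h.extrapolate, h.pred_succ, add_sub_cancel_left] at hd
      rw [h.pred_succ] at hm
      have hn : ((k : ℝ) + 1 + a) ^ 2 * ‖CLQR.alpha a (k + 1) • (x (k + 1) - x k)‖ ^ 2 =
          (k : ℝ) ^ 2 * ‖x (k + 1) - x k‖ ^ 2 := by
        have := congrArg (fun v => ‖v‖ ^ 2) hm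
        simp only [norm_smul _ (_ • _), norm_smul (_ - _), mul_pow, Real.norm_eq_abs, sq_abs]
          at this
        push_cast at this
        rw [this]
        ring
      push_cast
      have h4 := mul_le_mul_of_nonneg_left hd (sq_nonneg ((k : ℝ) + 1 + a))
      have h5 : (k : ℝ) ^ 2 + (k + 1) ≤ (k + a) ^ 2 := by nlinarith
      have h6 : ((k : ℝ) + 1 + a) ^ 2 ≤ (k + a) ^ 2 + (3 + 2 * a) * (k + 1) := by nlinarith
      have h7 := mul_le_mul_of_nonneg_right h5
        (by positivity : 0 ≤ L / 2 * ‖x (k + 1) - x k‖ ^ 2)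
      have h8 := mul_le_mul_of_nonneg_right h6 (hφ (k + 1))
      have h9 : ((k : ℝ) + 1 + a) ^ 2 *
          (L / 2 * ‖CLQR.alpha a (k + 1) • (x (k + 1) - x k)‖ ^ 2) =
          L / 2 * (k : ℝ) ^ 2 * ‖x (k + 1) - x k‖ ^ 2 := by
        rw [mul_left_comm, hn]
        ring
      nlinarith [h4, h7, h8, h9]
  exact (summable_mul_left_iff (by positivity : L / 2 ≠ 0)).1 h1

/-- Testing the descent inequality at `s` shows that the positive parts `d` of the increments of the
squared distance satisfy `d (k + 1) ≤ α d k + 2 ‖x (k + 1) - x k‖²`. Since `(k + 1 + a) α = k`,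
multiplication by `k + 1 + a` leaves `a * d k` as a telescoping gain, so `d` is summable. -/
theorem exists_tendsto_dist (h : IsAcceleratedDescent C F a L x xp y) (hs : s ∈ C)
    (hmin : ∀ z ∈ C, F s ≤ F z) :
    ∃ l, Filter.Tendsto (fun k => ‖x k - s‖ ^ 2) Filter.atTop (𝓝 l) := by
  have ha := h.two_lt
  have hL := h.pos
  set Φ : ℕ → ℝ := fun k => ‖x k - s‖ ^ 2 with hΦ
  set d : ℕ → ℝ := fun k => max (Φ (k + 1) - Φ k) 0 with hd
  have hd0 : ∀ k, 0 ≤ d k := fun k => le_max_right _ _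
  have hstep : ∀ k : ℕ, (k + 1 + a) * d (k + 1) ≤
      k * d k + (k + 1 + a) * (2 * ‖x (k + 1) - x k‖ ^ 2) := by
    intro k
    have hk : (0 : ℝ) ≤ k := Nat.cast_nonneg k
    have h0 : 0 < (k : ℝ) + 1 + a := by linarith
    obtain ⟨hα0, hα1⟩ := alpha_bounds ha (k + 1)
    have hα : ((k : ℝ) + 1 + a) * CLQR.alpha a (k + 1) = k := by
      rw [CLQR.alpha, if_neg (Nat.succ_ne_zero k)]
      push_cast
      field_simp
      ring
    have h1 := h.descent (k + 1) s hs
    have hF := hmin _ (h.mem (k + 1 + 1))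
    have h2 : Φ (k + 1 + 1) ≤ ‖y (k + 1) - s‖ ^ 2 := by
      have : L / 2 * ‖x (k + 1 + 1) - s‖ ^ 2 ≤ L / 2 * ‖y (k + 1) - s‖ ^ 2 := by linarith
      exact le_of_mul_le_mul_left this (by positivity)
    have e1 : y (k + 1) - s = (x (k + 1) - s) + CLQR.alpha a (k + 1) • (x (k + 1) - x k) := by
      rw [h.extrapolate, h.pred_succ]
      abel
    have e2 : x k - s = (x (k + 1) - s) - (x (k + 1) - x k) := by abel
    have e3 : Φ k = Φ (k + 1) - 2 * inner ℝ (x (k + 1) - s) (x (k + 1) - x k) +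
        ‖x (k + 1) - x k‖ ^ 2 := by
      simp only [hΦ]
      rw [e2, norm_sub_sq_real]
    rw [e1, norm_add_sq_real, inner_smul_right, norm_smul, mul_pow, Real.norm_eq_abs, sq_abs] at h2
    set α := CLQR.alpha a (k + 1)
    set n2 := ‖x (k + 1) - x k‖ ^ 2
    have hn2 : 0 ≤ n2 := sq_nonneg _
    have h3 : Φ (k + 1 + 1) - Φ (k + 1) ≤ α * (Φ (k + 1) - Φ k) + 2 * n2 := by
      have h4 : α * n2 ≤ n2 := by nlinarith
      have h5 : α ^ 2 * n2 ≤ n2 := by nlinarith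
      have e4 : α * (Φ (k + 1) - Φ k) =
          2 * (α * inner ℝ (x (k + 1) - s) (x (k + 1) - x k)) - α * n2 := by
        rw [e3]
        ring
      have h2' : Φ (k + 1 + 1) ≤ Φ (k + 1) +
        2 * (α * inner ℝ (x (k + 1) - s) (x (k + 1) - x k)) + α ^ 2 * n2 := h2
      linarith
    have h6 : d (k + 1) ≤ α * d k + 2 * n2 := by
      refine max_le ?_ ?_
      · exact h3.trans (by linarith [mul_le_mul_of_nonneg_left (le_max_left (Φ (k + 1) - Φ k) 0) hα0])
      · have := hd0 k
        positivity
    have h7 := mul_le_mul_of_nonneg_left h6 h0.le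
    calc _ ≤ _ := h7
      _ = _ := by rw [mul_add, ← mul_assoc, hα]
  have hsum : Summable d := by
    have h1 : Summable fun k => a * d k := by
      refine summable_of_descent (W := fun k => (k + a) * d k)
        (q := fun k => (2 + 2 * a) * (((k : ℝ) + 1) * ‖x (k + 1) - x k‖ ^ 2))
        (fun k => mul_nonneg (by positivity) (hd0 k)) (fun k => mul_nonneg (by positivity) (hd0 k))
        (fun k => by positivity) ((h.summable_steps hs hmin).mul_left _) fun k => ?_
      have hk : (0 : ℝ) ≤ k := Nat.cast_nonneg k
      have h1 := hstep k
      push_cast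
      have h2 : ((k : ℝ) + 1 + a) * 2 ≤ (2 + 2 * a) * (k + 1) := by nlinarith
      nlinarith [mul_le_mul_of_nonneg_right h2 (sq_nonneg ‖x (k + 1) - x k‖)]
    exact (summable_mul_left_iff (by linarith : a ≠ 0)).1 h1
  refine exists_tendsto_of_descent (fun k => sq_nonneg _) hd0 hsum fun k => ?_
  linarith [le_max_left (Φ (k + 1) - Φ k) 0]

theorem tendsto_values (h : IsAcceleratedDescent C F a L x xp y) (hs : s ∈ C)
    (hmin : ∀ z ∈ C, F s ≤ F z) :
    Filter.Tendsto (fun k => F (x k)) Filter.atTop (𝓝 (F s)) := by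
  rw [← Filter.tendsto_add_atTop_iff_nat 1]
  have hφ : ∀ k, 0 ≤ F (x k) - F s := fun k => sub_nonneg.2 (hmin _ (h.mem k))
  have h1 := (h.summable_values hs hmin).tendsto_atTop_zero
  have h2 := squeeze_zero (fun k => hφ (k + 1)) (fun k => by
    have : (0 : ℝ) ≤ k := Nat.cast_nonneg k
    nlinarith [hφ (k + 1)]) h1
  simpa using h2.add_const (F s)

end IsAcceleratedDescent

end Accelerated

/-! ### Weak limits -/

section Weak

variable {E : Type*} [NormedAddCommGroup E] [InnerProductSpace ℝ E] [CompleteSpace E]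

/-- Along an ultrafilter every bounded real family converges, by compactness of intervals. The
limits of the inner products form a bounded functional, which the Riesz theorem represents. -/
theorem exists_weak_limit_ultrafilter {ι : Type*} (U : Ultrafilter ι) {x : ι → E} {r : ℝ}
    (hx : ∀ i, ‖x i‖ ≤ r) :
    ∃ z : E, ∀ y : E, Filter.Tendsto (fun i => (inner ℝ y (x i) : ℝ)) U (𝓝 (inner ℝ y z)) := by
  have hb : ∀ i y, |(inner ℝ y (x i) : ℝ)| ≤ r * ‖y‖ := fun i y => by
    have h1 := abs_real_inner_le_norm y (x i)
    nlinarith [hx i, norm_nonneg y]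
  have hlim : ∀ y : E, ∃ t : ℝ, |t| ≤ r * ‖y‖ ∧
      Filter.Tendsto (fun i => (inner ℝ y (x i) : ℝ)) U (𝓝 t) := by
    intro y
    obtain ⟨t, ht, hU⟩ := (isCompact_Icc (a := -(r * ‖y‖)) (b := r * ‖y‖)).ultrafilter_le_nhds
      (U.map fun i => (inner ℝ y (x i) : ℝ)) (by
        rw [Filter.le_principal_iff]
        exact Filter.mem_map.2 (Filter.univ_mem' fun i => abs_le.1 (hb i y)))
    exact ⟨t, abs_le.2 ht, hU⟩
  choose φ hφb hφ using hlim
  let Λ : E →ₗ[ℝ] ℝ :=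
    { toFun := φ
      map_add' := fun y z => by
        refine tendsto_nhds_unique (hφ (y + z)) (((hφ y).add (hφ z)).congr fun i => ?_)
        rw [inner_add_left]
      map_smul' := fun c y => by
        refine tendsto_nhds_unique (hφ (c • y)) (((hφ y).const_mul c).congr fun i => ?_)
        rw [real_inner_smul_left] }
  let Λc : StrongDual ℝ E := Λ.mkContinuous r hφb
  refine ⟨(InnerProductSpace.toDual ℝ E).symm Λc, fun y => ?_⟩
  rw [real_inner_comm, InnerProductSpace.toDual_symm_apply]
  exact hφ y

/-- Opial's lemma for sequences in a Hilbert space. -/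
theorem exists_weak_limit_of_opial {x : ℕ → E} {S : Set E} (hS : S.Nonempty)
    (hdist : ∀ s ∈ S, ∃ l, Filter.Tendsto (fun k => ‖x k - s‖ ^ 2) Filter.atTop (𝓝 l))
    (hcluster : ∀ (U : Ultrafilter ℕ) (z : E), (U : Filter ℕ) ≤ Filter.atTop →
      (∀ y : E, Filter.Tendsto (fun k => (inner ℝ y (x k) : ℝ)) U (𝓝 (inner ℝ y z))) → z ∈ S) :
    ∃ z ∈ S, ∀ y : E,
      Filter.Tendsto (fun k => (inner ℝ y (x k) : ℝ)) Filter.atTop (𝓝 (inner ℝ y z)) := by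
  obtain ⟨s, hs⟩ := hS
  obtain ⟨r, hr⟩ : ∃ r, ∀ k, ‖x k‖ ≤ r := by
    obtain ⟨l, hl⟩ := hdist s hs
    obtain ⟨b, hb⟩ := hl.bddAbove_range
    refine ⟨b + 1 + ‖s‖, fun k => ?_⟩
    have h1 : ‖x k - s‖ ^ 2 ≤ b := hb ⟨k, rfl⟩
    have h2 := norm_add_le (x k - s) s
    rw [sub_add_cancel] at h2
    nlinarith [sq_nonneg (‖x k - s‖ - 1), norm_nonneg (x k - s)]
  choose z hz using fun U : Ultrafilter ℕ => exists_weak_limit_ultrafilter U hr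
  have hzS : ∀ U : Ultrafilter ℕ, (U : Filter ℕ) ≤ Filter.atTop → z U ∈ S :=
    fun U hU => hcluster U (z U) hU (hz U)
  have huniq : ∀ U₁ U₂ : Ultrafilter ℕ, (U₁ : Filter ℕ) ≤ Filter.atTop →
      (U₂ : Filter ℕ) ≤ Filter.atTop → z U₁ = z U₂ := by
    intro U₁ U₂ h₁ h₂
    obtain ⟨l₁, hl₁⟩ := hdist _ (hzS U₁ h₁)
    obtain ⟨l₂, hl₂⟩ := hdist _ (hzS U₂ h₂)
    -- The difference of the squared distances to two cluster points is affine in the inner product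
    -- with `z U₂ - z U₁`. That inner product therefore converges along the whole sequence, and its
    -- limits along both ultrafilters agree.
    have hlim : Filter.Tendsto (fun k => (inner ℝ (z U₂ - z U₁) (x k) : ℝ)) Filter.atTop
        (𝓝 ((1 / 2) * (l₁ - l₂ - (‖z U₁‖ ^ 2 - ‖z U₂‖ ^ 2)))) := by
      refine (((hl₁.sub hl₂).sub_const _).const_mul (1 / 2)).congr fun k => ?_
      rw [norm_sub_sq_real, norm_sub_sq_real, inner_sub_left, real_inner_comm (x k),
        real_inner_comm (x k)]
      ring
    have h3 := tendsto_nhds_unique (hz U₁ (z U₂ - z U₁)) (hlim.mono_left h₁)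
    have h4 := tendsto_nhds_unique (hz U₂ (z U₂ - z U₁)) (hlim.mono_left h₂)
    have h5 : (inner ℝ (z U₂ - z U₁) (z U₂ - z U₁) : ℝ) = 0 := by
      rw [inner_sub_right, h3, h4, sub_self]
    exact (sub_eq_zero.1 (inner_self_eq_zero.1 h5)).symm
  set U₀ : Ultrafilter ℕ := Ultrafilter.of Filter.atTop
  have hU₀ : (U₀ : Filter ℕ) ≤ Filter.atTop := Ultrafilter.of_le _
  refine ⟨z U₀, hzS U₀ hU₀, fun y => ?_⟩
  refine (Filter.tendsto_iff_ultrafilter _ _ _).2 fun U hU => ?_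
  have := hz U y
  rwa [huniq U U₀ hU hU₀] at this

end Weak

/-! ### Farkas' lemma -/

/-- Induction on the number of functionals needs neither topology nor finite dimension. If `g i` is
not redundant, some `v₀` violates `b` while respecting the others, so `g i v₀ > 0`. Projecting along
`v₀` onto the kernel of `g i` reduces to the remaining functionals, and evaluation at `v₀` fixes the
coefficient of `g i`. -/
theorem exists_nonneg_combination_of_forall_le {V ι : Type*} [AddCommGroup V] [Module ℝ V]
    (s : Finset ι) (g : ι → V →ₗ[ℝ] ℝ) (b : V →ₗ[ℝ] ℝ)
    (h : ∀ v, (∀ j ∈ s, g j v ≤ 0) → b v ≤ 0) :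
    ∃ c : ι → ℝ, (∀ j, 0 ≤ c j) ∧ b = ∑ j ∈ s, c j • g j := by
  classical
  induction s using Finset.induction_on generalizing g b with
  | empty =>
    refine ⟨0, fun _ => le_rfl, ?_⟩
    ext v
    have h1 := h v (by simp)
    have h2 := h (-v) (by simp)
    rw [map_neg] at h2
    simp only [Finset.sum_empty, LinearMap.zero_apply]
    linarith
  | insert i s hi ih =>
    by_cases hb : ∀ v, (∀ j ∈ s, g j v ≤ 0) → b v ≤ 0
    · obtain ⟨c, hc, he⟩ := ih g b hb
      refine ⟨fun j => if j = i then 0 else c j, fun j => ?_, ?_⟩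
      · dsimp only
        split_ifs
        · exact le_rfl
        · exact hc j
      · simp only [Finset.sum_insert hi, if_true, zero_smul, zero_add]
        rw [he]
        refine Finset.sum_congr rfl fun j hj => ?_
        rw [if_neg]
        rintro rfl
        exact hi hj
    · push Not at hb
      obtain ⟨v₀, hv₀, hbv₀⟩ := hb
      have hg : 0 < g i v₀ := by
        by_contra hcon
        have := h v₀ fun j hj => by
          rcases Finset.mem_insert.1 hj with rfl | hj
          · exact not_lt.1 hcon
          · exact hv₀ j hj
        linarith
      obtain ⟨c, hc, he⟩ := ih (fun j => g j - (g j v₀ / g i v₀) • g i) (b - (b v₀ / g i v₀) • g i)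
        (by
          intro v hv
          have h1 := h (v - (g i v / g i v₀) • v₀) fun j hj => by
            rcases Finset.mem_insert.1 hj with rfl | hj
            · rw [map_sub, map_smul, smul_eq_mul, div_mul_cancel₀ _ hg.ne', sub_self]
            · have := hv j hj
              simp only [LinearMap.sub_apply, LinearMap.smul_apply, smul_eq_mul, map_sub,
                map_smul] at this ⊢
              calc _ = _ := by ring
                _ ≤ 0 := this
          simp only [LinearMap.sub_apply, LinearMap.smul_apply, smul_eq_mul, map_sub,
            map_smul] at h1 ⊢
          calc _ = _ := by ring
            _ ≤ 0 := h1)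
      refine ⟨fun j => if j = i then b v₀ / g i v₀ - ∑ j ∈ s, c j * (g j v₀ / g i v₀) else c j,
        fun j => ?_, ?_⟩
      · dsimp only
        split_ifs
        · have h1 : ∑ j ∈ s, c j * (g j v₀ / g i v₀) ≤ 0 := Finset.sum_nonpos fun j hj =>
            mul_nonpos_of_nonneg_of_nonpos (hc j) (div_nonpos_of_nonpos_of_nonneg (hv₀ j hj) hg.le)
          have h2 : 0 ≤ b v₀ / g i v₀ := by positivity
          linarith
        · exact hc j
      · simp only [Finset.sum_insert hi, if_true]
        have h1 : ∑ j ∈ s, (if j = i then b v₀ / g i v₀ - ∑ j ∈ s, c j * (g j v₀ / g i v₀)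
            else c j) • g j = ∑ j ∈ s, c j • g j := by
          refine Finset.sum_congr rfl fun j hj => ?_
          rw [if_neg]
          rintro rfl
          exact hi hj
        rw [h1]
        ext v
        have h2 := LinearMap.congr_fun he v
        simp only [LinearMap.sub_apply, LinearMap.add_apply, LinearMap.smul_apply,
          LinearMap.sum_apply, smul_eq_mul, mul_sub, Finset.sum_sub_distrib] at h2 ⊢
        rw [sub_mul, Finset.sum_mul]
        simp only [mul_assoc] at h2 ⊢
        linarith

/-! ### Matrices as operators -/

namespace Matrix

section ToE

variable {ι κ σ : Type*} [Fintype ι] [Fintype κ] [Fintype σ]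

theorem mulVec_dotProduct_mulVec (X : Matrix ι κ ℝ) (Y : Matrix ι σ ℝ) (a : κ → ℝ) (b : σ → ℝ) :
    (X *ᵥ a) ⬝ᵥ (Y *ᵥ b) = a ⬝ᵥ (Xᵀ * Y) *ᵥ b := by
  rw [← mulVec_mulVec, dotProduct_mulVec a, vecMul_transpose]

variable [DecidableEq κ] [DecidableEq σ]

theorem toE_mul (M : Matrix ι κ ℝ) (M' : Matrix κ σ ℝ) (x : EuclideanSpace ℝ σ) :
    (M * M').toE x = M.toE (M'.toE x) := by
  ext j
  rw [toE_apply, toE_apply, ← mulVec_mulVec]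
  rfl

theorem toE_add (M M' : Matrix ι κ ℝ) (x : EuclideanSpace ℝ κ) :
    (M + M').toE x = M.toE x + M'.toE x := by
  ext j
  simp [toE_apply, add_mulVec]

theorem toE_one (x : EuclideanSpace ℝ κ) : (1 : Matrix κ κ ℝ).toE x = x := by
  ext j
  simp [toE_apply]

theorem inner_toE (M : Matrix ι κ ℝ) (x : EuclideanSpace ℝ ι) (y : EuclideanSpace ℝ κ) :
    inner ℝ x (M.toE y) = x.ofLp ⬝ᵥ M *ᵥ y.ofLp := by
  rw [EuclideanSpace.inner_eq_star_dotProduct, dotProduct_comm]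
  rfl

open scoped MatrixOrder in
theorem PosSemidef.exists_norm_sq_eq [DecidableEq ι] {M : Matrix ι ι ℝ} (hM : M.PosSemidef) :
    ∃ N : Matrix ι ι ℝ, M = Nᵀ * N ∧ ∀ x, ‖N.toE x‖ ^ 2 = inner ℝ x (M.toE x) := by
  obtain ⟨N, rfl⟩ := CStarAlgebra.nonneg_iff_eq_star_mul_self.mp hM.nonneg
  have hN : star N = Nᵀ := by
    rw [star_eq_conjTranspose, conjTranspose_eq_transpose_of_trivial]
  refine ⟨N, by rw [hN], fun x => ?_⟩
  rw [hN, inner_toE, ← mulVec_dotProduct_mulVec, ← real_inner_self_eq_norm_sq, inner_toE]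
  rfl

theorem PosDef.exists_norm_sq_eq [DecidableEq ι] {M : Matrix ι ι ℝ} (hM : M.PosDef) :
    ∃ N N' : EuclideanSpace ℝ ι →L[ℝ] EuclideanSpace ℝ ι, (∀ x, N' (N x) = x) ∧
      (∀ x, N (N' x) = x) ∧ ∀ x, ‖N x‖ ^ 2 = inner ℝ x (M.toE x) := by
  obtain ⟨N, hN, h⟩ := hM.posSemidef.exists_norm_sq_eq
  have hu : IsUnit N.det := by
    have h1 := (isUnit_iff_isUnit_det _).1 hM.isUnit
    rw [hN, det_mul] at h1
    exact isUnit_of_mul_isUnit_right h1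
  refine ⟨N.toE, N⁻¹.toE, fun x => ?_, fun x => ?_, h⟩
  · rw [← toE_mul, nonsing_inv_mul _ hu, toE_one]
  · rw [← toE_mul, mul_nonsing_inv _ hu, toE_one]

/-- With `M = Nᵀ N` one has `‖M x‖ ≤ ‖Nᵀ‖ ‖N x‖`. Applied to `Q`, this lets the stage cost control
the output `Q x` used for detectability. -/
theorem PosSemidef.exists_norm_toE_sq_le [DecidableEq ι] {M : Matrix ι ι ℝ} (hM : M.PosSemidef) :
    ∃ κ : ℝ, 0 ≤ κ ∧ ∀ x, ‖M.toE x‖ ^ 2 ≤ κ * inner ℝ x (M.toE x) := by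
  obtain ⟨N, hN, h⟩ := hM.exists_norm_sq_eq
  refine ⟨‖Nᵀ.toE‖ ^ 2, sq_nonneg _, fun x => ?_⟩
  have h1 := Nᵀ.toE.le_opNorm (N.toE x)
  rw [← toE_mul, ← hN] at h1
  rw [← h, ← mul_pow]
  exact pow_le_pow_left₀ (norm_nonneg _) h1 2

theorem PosSemidef.inner_toE_nonneg [DecidableEq ι] {M : Matrix ι ι ℝ} (hM : M.PosSemidef)
    (x : EuclideanSpace ℝ ι) : 0 ≤ inner ℝ x (M.toE x) := by
  obtain ⟨N, -, h⟩ := hM.exists_norm_sq_eq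
  rw [← h]
  positivity

theorem PosDef.exists_le_inner_toE [DecidableEq ι] {M : Matrix ι ι ℝ} (hM : M.PosDef) :
    ∃ r : ℝ, 0 < r ∧ ∀ x, r * ‖x‖ ^ 2 ≤ inner ℝ x (M.toE x) := by
  obtain ⟨N, N', h1, -, h⟩ := hM.exists_norm_sq_eq
  refine ⟨(‖N'‖ ^ 2 + 1)⁻¹, by positivity, fun x => ?_⟩
  have h2 := N'.le_opNorm (N x)
  rw [h1] at h2
  rw [← h, inv_mul_le_iff₀ (by positivity)]
  have h3 := pow_le_pow_left₀ (norm_nonneg _) h2 2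
  nlinarith [sq_nonneg ‖N x‖]

end ToE

/-- Doubling the matrix multiplies the squared spectral radius by `4`, which the weight `1 / 4`
cancels. Unweighted summability for a stable system thus becomes a case of the weighted convolution
bound. -/
theorem SchurStable.admissibleWeight {n : ℕ} {M : Matrix (Fin n) (Fin n) ℝ} (hM : M.SchurStable) :
    AdmissibleWeight ((2 : ℝ) • M) (1 / 4) where
  pos := by norm_num
  lt_one := by norm_num
  spectral z hz := by
    have h2 : (2 : ℂ) ≠ 0 := two_ne_zero
    have hz' : M.IsComplexEigenvalue ((2 : ℂ)⁻¹ * z) := by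
      apply (spectrum.smul_mem_smul_iff (R := ℂ) (s := (2 : ℂ)⁻¹ * z)
        (r := Units.mk0 (2 : ℂ) h2)).1
      rw [Units.smul_def, Units.smul_def, Units.val_mk0, smul_eq_mul, ← mul_assoc,
        mul_inv_cancel₀ h2, one_mul]
      have h3 : (2 : ℂ) • M.map (fun t : ℝ => (t : ℂ)) =
          ((2 : ℝ) • M).map (fun t : ℝ => (t : ℂ)) := by
        ext i j
        simp
      rw [h3]
      exact hz
    have h1 := hM _ hz'
    rw [norm_mul, norm_inv] at h1
    have h4 : ‖(2 : ℂ)‖ = 2 := by simp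
    rw [h4] at h1
    nlinarith [norm_nonneg z]

/-- A Schur stable system driven by a square-summable disturbance has square-summable states. -/
theorem SchurStable.summable_norm_sq {n : ℕ} {M : Matrix (Fin n) (Fin n) ℝ} (hM : M.SchurStable)
    {x e : ℕ → EuclideanSpace ℝ (Fin n)} (hx : ∀ i, x (i + 1) = M.toE (x i) + e i)
    (he : Summable fun i => ‖e i‖ ^ 2) : Summable fun i => ‖x i‖ ^ 2 := by
  have : Fact (0 < (1 / 4 : ℝ)) := ⟨by norm_num⟩
  -- Only the dynamics of this auxiliary problem matter. The states are scaled by `2ⁱ` and the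
  -- disturbances by `2ⁱ⁺¹`, so that the weight `(1 / 4)ⁱ` undoes the scaling.
  let P : CLQR n n 0 0 :=
    { A := (2 : ℝ) • M, B := 1, Q := 0, R := 0, Cx := 0, cx := 0, Cu := 0, cu := 0, xinit := x 0 }
  have hpow : ∀ i : ℕ, (1 / 4 : ℝ) ^ i * ((2 : ℝ) ^ i) ^ 2 = 1 := fun i => by
    rw [← pow_mul, mul_comm i 2, pow_mul, ← mul_pow]
    norm_num
  let u : WL2 (1 / 4) (EuclideanSpace ℝ (Fin n)) := WL2.mk (fun i => (2 : ℝ) ^ (i + 1) • e i) (by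
    refine (he.mul_left 4).congr fun i => ?_
    rw [norm_smul, mul_pow, ← mul_assoc, norm_pow, Real.norm_ofNat, pow_succ (2 : ℝ) i, mul_pow,
      ← mul_assoc, hpow]
    norm_num)
  have htraj : ∀ i, P.traj u i = (2 : ℝ) ^ i • x i := by
    intro i
    induction i with
    | zero => simp [CLQR.traj, P]
    | succ i ih =>
      have h2 : ((2 : ℝ) • M).toE ((2 : ℝ) ^ i • x i) = (2 : ℝ) ^ (i + 1) • M.toE (x i) := by
        ext j
        rw [toE_apply]
        simp [toE_apply, smul_mulVec, mulVec_smul, pow_succ]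
        ring
      rw [CLQR.traj, ih]
      change ((2 : ℝ) • M).toE ((2 : ℝ) ^ i • x i) + (1 : Matrix (Fin n) (Fin n) ℝ).toE
        ((2 : ℝ) ^ (i + 1) • e i) = _
      rw [toE_one, h2, hx, smul_add]
  rw [← summable_nat_add_iff 1]
  refine ((P.stateSeq hM.admissibleWeight u).summable_norm_sq.mul_left (1 / 4)).congr fun i => ?_
  rw [P.stateSeq_apply, htraj, norm_smul, mul_pow, ← mul_assoc, ← mul_assoc, norm_pow,
    Real.norm_ofNat, ← pow_succ', hpow, one_mul]

end Matrix

namespace CLQR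

variable {n m px pu : ℕ} (P : CLQR n m px pu)

/-! ### Parametrization of the inputs by their deviation from the LQ feedback -/

section Feedback

/-- The quadratic form `½ xᵀ Plq x`. -/
noncomputable def lqCost (Plq : Matrix (Fin n) (Fin n) ℝ) (x : EuclideanSpace ℝ (Fin n)) : ℝ :=
  (1 / 2) * inner ℝ x (Plq.toE x)

/-- `N` is a factor of `R + Bᵀ Plq B` with inverse `N'`, so that completing the square in the
Riccati equation turns the cost into `½ ∑ ‖N (uᵢ - K xᵢ)‖²`. -/
structure FeedbackFactor (Plq : Matrix (Fin n) (Fin n) ℝ) (K : Matrix (Fin m) (Fin n) ℝ)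
    (N N' : EuclideanSpace ℝ (Fin m) →L[ℝ] EuclideanSpace ℝ (Fin m)) (r : ℝ) : Prop where
  left_inv : ∀ x, N' (N x) = x
  right_inv : ∀ x, N (N' x) = x
  energy : ∀ x u, lqCost Plq (P.A.toE x + P.B.toE u) + P.stageCost x u =
    lqCost Plq x + (1 / 2) * ‖N (u - K.toE x)‖ ^ 2
  lqCost_nonneg : ∀ x, 0 ≤ lqCost Plq x
  pos : 0 < r
  coercive : ∀ x u, r * ‖u‖ ^ 2 ≤ P.stageCost x u
  detect : ∀ u, Summable (fun i => P.stageCost (P.traj u i) (u i)) →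
    Filter.Tendsto (P.traj u) Filter.atTop (𝓝 0)

/-- With `M = R + Bᵀ Plq B`, the gain satisfies `M K = -Bᵀ Plq A`, and the Riccati equation reads
`Plq = Q + Aᵀ Plq A - Kᵀ M K`. These are the cross term and the pure state term of the completed
square. -/
theorem IsLQSolution.energy {P : CLQR n m px pu} {Plq : Matrix (Fin n) (Fin n) ℝ}
    {K : Matrix (Fin m) (Fin n) ℝ} (h : P.IsLQSolution Plq K)
    (hM : (P.R + P.Bᵀ * Plq * P.B).PosDef) (x : EuclideanSpace ℝ (Fin n))
    (u : EuclideanSpace ℝ (Fin m)) :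
    lqCost Plq (P.A.toE x + P.B.toE u) + P.stageCost x u =
      lqCost Plq x +
        (1 / 2) * inner ℝ (u - K.toE x) ((P.R + P.Bᵀ * Plq * P.B).toE (u - K.toE x)) := by
  set M := P.R + P.Bᵀ * Plq * P.B with hMdef
  have hPt : Plqᵀ = Plq := by
    rw [← Matrix.conjTranspose_eq_transpose_of_trivial]
    exact h.posSemidef.isHermitian
  have hMt : Mᵀ = M := by
    rw [← Matrix.conjTranspose_eq_transpose_of_trivial]
    exact hM.isHermitian
  have hMK : M * K = -(P.Bᵀ * Plq * P.A) := by
    rw [h.gain, Matrix.mul_neg, ← hMdef, Matrix.mul_nonsing_inv_cancel_left _ _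
      ((Matrix.isUnit_iff_isUnit_det _).1 hM.isUnit)]
  have hKM : Kᵀ * M = -(P.Aᵀ * Plq * P.B) := by
    have h1 := congrArg Matrix.transpose hMK
    simpa [Matrix.transpose_mul, hMt, hPt, Matrix.mul_assoc] using h1
  have hric : Plq = P.Q + P.Aᵀ * Plq * P.A - Kᵀ * M * K := by
    rw [hKM, h.gain, Matrix.neg_mul, Matrix.mul_neg, neg_neg,
      ← Matrix.mul_assoc (P.Aᵀ * Plq * P.B)]
    exact h.riccati
  have hx : x.ofLp ⬝ᵥ Plq *ᵥ x.ofLp = x.ofLp ⬝ᵥ P.Q *ᵥ x.ofLp +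
      x.ofLp ⬝ᵥ (P.Aᵀ * Plq * P.A) *ᵥ x.ofLp - x.ofLp ⬝ᵥ (Kᵀ * M * K) *ᵥ x.ofLp := by
    conv_lhs => rw [hric]
    rw [Matrix.sub_mulVec, Matrix.add_mulVec, dotProduct_sub, dotProduct_add]
  have e1 : (P.A.toE x + P.B.toE u).ofLp = P.A *ᵥ x.ofLp + P.B *ᵥ u.ofLp := rfl
  have e2 : (u - K.toE x).ofLp = u.ofLp - K *ᵥ x.ofLp := rfl
  simp only [lqCost, stageCost, Matrix.inner_toE, e1, e2]
  rw [hx]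
  simp only [Matrix.mulVec_add, Matrix.mulVec_sub, add_dotProduct, sub_dotProduct, dotProduct_add,
    dotProduct_sub, Matrix.mulVec_mulVec, Matrix.mulVec_dotProduct_mulVec, ← Matrix.mul_assoc]
  rw [hMK, hKM]
  have hu : u.ofLp ⬝ᵥ M *ᵥ u.ofLp =
      u.ofLp ⬝ᵥ P.R *ᵥ u.ofLp + u.ofLp ⬝ᵥ (P.Bᵀ * Plq * P.B) *ᵥ u.ofLp := by
    rw [hMdef, Matrix.add_mulVec, dotProduct_add]
  have hxx : x.ofLp ⬝ᵥ (-(P.Aᵀ * Plq * P.B) * K) *ᵥ x.ofLp =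
      x.ofLp ⬝ᵥ (Kᵀ * M * K) *ᵥ x.ofLp := by rw [hKM]
  rw [hu, hxx]
  simp only [Matrix.neg_mulVec, dotProduct_neg]
  ring

/-- By output injection, the trajectory follows the stable matrix `A + J Q` driven by `B u - J Q x`.
Both parts of this disturbance are square summable because the stage cost dominates `‖u‖²` and `‖Q
x‖²`. -/
theorem tendsto_traj_of_summable_stageCost {P : CLQR n m px pu} (hQ : P.Q.PosSemidef)
    (hR : P.R.PosDef) (hdet : Detectable P.A P.Q) (u : ℕ → EuclideanSpace ℝ (Fin m))
    (hu : Summable fun i => P.stageCost (P.traj u i) (u i)) :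
    Filter.Tendsto (P.traj u) Filter.atTop (𝓝 0) := by
  obtain ⟨J, hJ⟩ := hdet
  obtain ⟨r, hr, hru⟩ := hR.exists_le_inner_toE
  obtain ⟨κ, hκ, hκQ⟩ := hQ.exists_norm_toE_sq_le
  have hQ0 := hQ.inner_toE_nonneg
  have hR0 := hR.posSemidef.inner_toE_nonneg
  have he : Summable fun i => ‖P.B.toE (u i) - J.toE (P.Q.toE (P.traj u i))‖ ^ 2 := by
    refine Summable.of_nonneg_of_le (fun i => sq_nonneg _) (fun i => ?_)
      (hu.mul_left (4 * ‖P.B.toE‖ ^ 2 / r + 4 * ‖J.toE‖ ^ 2 * κ))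
    have h1 : ‖P.B.toE (u i) - J.toE (P.Q.toE (P.traj u i))‖ ≤
        ‖P.B.toE‖ * ‖u i‖ + ‖J.toE‖ * ‖P.Q.toE (P.traj u i)‖ :=
      (norm_sub_le _ _).trans (add_le_add (P.B.toE.le_opNorm _) (J.toE.le_opNorm _))
    have h2 := pow_le_pow_left₀ (norm_nonneg _) h1 2
    have h3 : (‖P.B.toE‖ * ‖u i‖ + ‖J.toE‖ * ‖P.Q.toE (P.traj u i)‖) ^ 2 ≤
        2 * (‖P.B.toE‖ ^ 2 * ‖u i‖ ^ 2) + 2 * (‖J.toE‖ ^ 2 * ‖P.Q.toE (P.traj u i)‖ ^ 2) := by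
      nlinarith [sq_nonneg (‖P.B.toE‖ * ‖u i‖ - ‖J.toE‖ * ‖P.Q.toE (P.traj u i)‖)]
    have h4 : ‖u i‖ ^ 2 ≤ 2 / r * P.stageCost (P.traj u i) (u i) := by
      rw [div_mul_eq_mul_div, le_div_iff₀ hr, stageCost]
      linarith [hru (u i), hQ0 (P.traj u i)]
    have h5 : ‖P.Q.toE (P.traj u i)‖ ^ 2 ≤ κ * (2 * P.stageCost (P.traj u i) (u i)) := by
      refine (hκQ _).trans (mul_le_mul_of_nonneg_left ?_ hκ)
      rw [stageCost]
      linarith [hR0 (u i)]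
    have h6 := mul_le_mul_of_nonneg_left h4 (sq_nonneg ‖P.B.toE‖)
    have h7 := mul_le_mul_of_nonneg_left h5 (sq_nonneg ‖J.toE‖)
    calc _ ≤ _ := h2.trans h3
      _ ≤ 2 * (‖P.B.toE‖ ^ 2 * (2 / r * P.stageCost (P.traj u i) (u i))) +
          2 * (‖J.toE‖ ^ 2 * (κ * (2 * P.stageCost (P.traj u i) (u i)))) := by linarith
      _ = _ := by ring
  have hs := hJ.summable_norm_sq (x := P.traj u) (fun i => by
    rw [Matrix.toE_add, Matrix.toE_mul, traj]
    abel) he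
  have h1 := hs.tendsto_atTop_zero
  refine tendsto_zero_iff_norm_tendsto_zero.2 ?_
  have h2 := h1.sqrt
  simpa using h2

theorem IsLQSolution.exists_feedbackFactor {P : CLQR n m px pu} {Plq : Matrix (Fin n) (Fin n) ℝ}
    {K : Matrix (Fin m) (Fin n) ℝ} (h : P.IsLQSolution Plq K) (hQ : P.Q.PosSemidef)
    (hR : P.R.PosDef) (hdet : Detectable P.A P.Q) :
    ∃ N N' r, P.FeedbackFactor Plq K N N' r := by
  have hM : (P.R + P.Bᵀ * Plq * P.B).PosDef := by
    have h1 := h.posSemidef.conjTranspose_mul_mul_same P.B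
    rw [Matrix.conjTranspose_eq_transpose_of_trivial] at h1
    exact hR.add_posSemidef h1
  obtain ⟨N, N', h1, h2, h3⟩ := hM.exists_norm_sq_eq
  obtain ⟨r, hr, hru⟩ := hR.exists_le_inner_toE
  refine ⟨N, N', r / 2, h1, h2, fun x u => ?_, fun x => ?_, by positivity, fun x u => ?_,
    tendsto_traj_of_summable_stageCost hQ hR hdet⟩
  · rw [h3]
    exact h.energy hM x u
  · have := h.posSemidef.inner_toE_nonneg x
    unfold lqCost
    positivity
  · rw [stageCost]
    linarith [hru u, hQ.inner_toE_nonneg x]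

variable (K : Matrix (Fin m) (Fin n) ℝ)
  (N N' : EuclideanSpace ℝ (Fin m) →L[ℝ] EuclideanSpace ℝ (Fin m))

/-- The states under the input `u = K x + N' v`. -/
noncomputable def feedbackState (x : EuclideanSpace ℝ (Fin n))
    (v : ℕ → EuclideanSpace ℝ (Fin m)) : ℕ → EuclideanSpace ℝ (Fin n)
  | 0 => x
  | i + 1 => P.A.toE (feedbackState x v i) + P.B.toE (K.toE (feedbackState x v i) + N' (v i))

/-- The input `u = K x + N' v`. -/
noncomputable def feedbackInput (x : EuclideanSpace ℝ (Fin n))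
    (v : ℕ → EuclideanSpace ℝ (Fin m)) (i : ℕ) : EuclideanSpace ℝ (Fin m) :=
  K.toE (P.feedbackState K N' x v i) + N' (v i)

/-- The scaled deviation `N (u - K x)` of an input from the LQ feedback. -/
noncomputable def feedbackDeviation (u : ℕ → EuclideanSpace ℝ (Fin m)) (i : ℕ) :
    EuclideanSpace ℝ (Fin m) :=
  N (u i - K.toE (P.traj u i))

variable {P K N N'}

/-- Linearity is joint in the initial state and the deviation. The splitting `xinit = xinit + 0`
later separates the LQ response from the part linear in `v`. -/
theorem feedbackState_add (x y : EuclideanSpace ℝ (Fin n)) (v v' : ℕ → EuclideanSpace ℝ (Fin m))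
    (i : ℕ) : P.feedbackState K N' (x + y) (fun i => v i + v' i) i =
      P.feedbackState K N' x v i + P.feedbackState K N' y v' i := by
  induction i with
  | zero => rfl
  | succ i ih =>
    simp only [feedbackState, ih, map_add]
    abel

theorem feedbackState_smul (c : ℝ) (x : EuclideanSpace ℝ (Fin n))
    (v : ℕ → EuclideanSpace ℝ (Fin m)) (i : ℕ) :
    P.feedbackState K N' (c • x) (fun i => c • v i) i = c • P.feedbackState K N' x v i := by
  induction i with
  | zero => rfl
  | succ i ih => simp only [feedbackState, ih, map_add, map_smul, smul_add]

theorem feedbackInput_add (x y : EuclideanSpace ℝ (Fin n)) (v v' : ℕ → EuclideanSpace ℝ (Fin m))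
    (i : ℕ) : P.feedbackInput K N' (x + y) (fun i => v i + v' i) i =
      P.feedbackInput K N' x v i + P.feedbackInput K N' y v' i := by
  simp only [feedbackInput, feedbackState_add, map_add]
  abel

theorem feedbackInput_smul (c : ℝ) (x : EuclideanSpace ℝ (Fin n))
    (v : ℕ → EuclideanSpace ℝ (Fin m)) (i : ℕ) :
    P.feedbackInput K N' (c • x) (fun i => c • v i) i = c • P.feedbackInput K N' x v i := by
  simp only [feedbackInput, feedbackState_smul, map_smul, smul_add]

theorem feedbackState_congr (x : EuclideanSpace ℝ (Fin n)) {v v' : ℕ → EuclideanSpace ℝ (Fin m)}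
    {i : ℕ} (h : ∀ j < i, v j = v' j) :
    P.feedbackState K N' x v i = P.feedbackState K N' x v' i := by
  induction i with
  | zero => rfl
  | succ i ih =>
    simp only [feedbackState, ih fun j hj => h j (hj.trans i.lt_succ_self), h i i.lt_succ_self]

theorem feedbackInput_congr (x : EuclideanSpace ℝ (Fin n)) {v v' : ℕ → EuclideanSpace ℝ (Fin m)}
    {i : ℕ} (h : ∀ j ≤ i, v j = v' j) :
    P.feedbackInput K N' x v i = P.feedbackInput K N' x v' i := by
  rw [feedbackInput, feedbackInput, feedbackState_congr x fun j hj => h j hj.le, h i le_rfl]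

theorem feedbackState_add_of_eq_zero (x : EuclideanSpace ℝ (Fin n))
    {v : ℕ → EuclideanSpace ℝ (Fin m)} {T : ℕ} (h : ∀ i, T ≤ i → v i = 0) (i : ℕ) :
    P.feedbackState K N' x v (T + i) =
      ((P.A + P.B * K) ^ i).toE (P.feedbackState K N' x v T) := by
  induction i with
  | zero => rw [add_zero, pow_zero, Matrix.toE_one]
  | succ i ih =>
    rw [← add_assoc, feedbackState, h _ (Nat.le_add_right _ _), ih, pow_succ', Matrix.toE_mul,
      Matrix.toE_add, Matrix.toE_mul, map_zero, add_zero]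

theorem traj_feedbackInput (v : ℕ → EuclideanSpace ℝ (Fin m)) (i : ℕ) :
    P.traj (P.feedbackInput K N' P.xinit v) i = P.feedbackState K N' P.xinit v i := by
  induction i with
  | zero => rfl
  | succ i ih => rw [traj, feedbackState, ih, feedbackInput]

variable {Plq : Matrix (Fin n) (Fin n) ℝ} {r : ℝ}

namespace FeedbackFactor

theorem feedbackState_deviation (h : P.FeedbackFactor Plq K N N' r)
    (u : ℕ → EuclideanSpace ℝ (Fin m)) (i : ℕ) :
    P.feedbackState K N' P.xinit (P.feedbackDeviation K N u) i = P.traj u i := by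
  induction i with
  | zero => rfl
  | succ i ih => rw [feedbackState, ih, traj, feedbackDeviation, h.left_inv, add_sub_cancel]

theorem feedbackInput_deviation (h : P.FeedbackFactor Plq K N N' r)
    (u : ℕ → EuclideanSpace ℝ (Fin m)) :
    P.feedbackInput K N' P.xinit (P.feedbackDeviation K N u) = u := by
  funext i
  rw [feedbackInput, h.feedbackState_deviation, feedbackDeviation, h.left_inv, add_sub_cancel]

theorem deviation_feedbackInput (h : P.FeedbackFactor Plq K N N' r)
    (v : ℕ → EuclideanSpace ℝ (Fin m)) :
    P.feedbackDeviation K N (P.feedbackInput K N' P.xinit v) = v := by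
  funext i
  rw [feedbackDeviation, traj_feedbackInput, feedbackInput, add_sub_cancel_left, h.right_inv]

theorem stageCost_nonneg (h : P.FeedbackFactor Plq K N N' r) (x : EuclideanSpace ℝ (Fin n))
    (u : EuclideanSpace ℝ (Fin m)) : 0 ≤ P.stageCost x u :=
  (mul_nonneg h.pos.le (sq_nonneg _)).trans (h.coercive x u)

/-- The one-step energy identity telescopes. With terminal cost `Plq` the formula is exact at every
finite horizon, and both the infinite-horizon cost and the truncated Lagrangian rest on it. -/
theorem sum_stageCost (h : P.FeedbackFactor Plq K N N' r) (x : EuclideanSpace ℝ (Fin n))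
    (v : ℕ → EuclideanSpace ℝ (Fin m)) (T : ℕ) :
    lqCost Plq (P.feedbackState K N' x v T) + ∑ i ∈ Finset.range T,
        P.stageCost (P.feedbackState K N' x v i) (P.feedbackInput K N' x v i) =
      lqCost Plq x + (1 / 2) * ∑ i ∈ Finset.range T, ‖v i‖ ^ 2 := by
  induction T with
  | zero => simp [feedbackState]
  | succ T ih =>
    have h1 := h.energy (P.feedbackState K N' x v T) (P.feedbackInput K N' x v T)
    have h2 : N (P.feedbackInput K N' x v T - K.toE (P.feedbackState K N' x v T)) = v T := by
      rw [feedbackInput, add_sub_cancel_left, h.right_inv]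
    rw [h2] at h1
    rw [Finset.sum_range_succ, Finset.sum_range_succ, mul_add, feedbackState]
    rw [feedbackInput] at h1 ⊢
    linarith

theorem sum_norm_feedbackInput_le (h : P.FeedbackFactor Plq K N N' r)
    (x : EuclideanSpace ℝ (Fin n)) (v : ℕ → EuclideanSpace ℝ (Fin m)) (T : ℕ) :
    ∑ i ∈ Finset.range T, ‖P.feedbackInput K N' x v i‖ ^ 2 ≤
      r⁻¹ * (lqCost Plq x + (1 / 2) * ∑ i ∈ Finset.range T, ‖v i‖ ^ 2) := by
  rw [le_inv_mul_iff₀ h.pos, ← h.sum_stageCost, Finset.mul_sum]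
  have h1 := h.lqCost_nonneg (P.feedbackState K N' x v T)
  have h2 := Finset.sum_le_sum fun i (_ : i ∈ Finset.range T) =>
    h.coercive (P.feedbackState K N' x v i) (P.feedbackInput K N' x v i)
  linarith

theorem feedbackInput_summable (h : P.FeedbackFactor Plq K N N' r)
    (x : EuclideanSpace ℝ (Fin n)) {v : ℕ → EuclideanSpace ℝ (Fin m)}
    (hv : Summable fun i => ‖v i‖ ^ 2) :
    (Summable fun i => ‖P.feedbackInput K N' x v i‖ ^ 2) ∧
      ∑' i, ‖P.feedbackInput K N' x v i‖ ^ 2 ≤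
        r⁻¹ * (lqCost Plq x + (1 / 2) * ∑' i, ‖v i‖ ^ 2) := by
  have hb : ∀ T, ∑ i ∈ Finset.range T, ‖P.feedbackInput K N' x v i‖ ^ 2 ≤
      r⁻¹ * (lqCost Plq x + (1 / 2) * ∑' i, ‖v i‖ ^ 2) := fun T => by
    refine (h.sum_norm_feedbackInput_le x v T).trans
      (mul_le_mul_of_nonneg_left ?_ (inv_nonneg.2 h.pos.le))
    have := hv.sum_le_tsum (Finset.range T) fun i _ => sq_nonneg _
    linarith
  have hs := summable_of_sum_range_le (fun i => sq_nonneg ‖P.feedbackInput K N' x v i‖) hb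
  exact ⟨hs, hs.tsum_le_of_sum_range_le hb⟩

/-! ### The infinite-horizon cost as a function of the deviations -/

theorem cost_ne_top_iff (h : P.FeedbackFactor Plq K N N' r) (u : ℕ → EuclideanSpace ℝ (Fin m)) :
    P.cost u ≠ ⊤ ↔ Summable fun i => P.stageCost (P.traj u i) (u i) := by
  constructor
  · intro hu
    refine (ENNReal.summable_toReal hu).congr fun i => ?_
    rw [ENNReal.toReal_ofReal (h.stageCost_nonneg _ _)]
  · intro hu
    rw [cost, ← ENNReal.ofReal_tsum_of_nonneg (fun i => h.stageCost_nonneg _ _) hu]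
    exact ENNReal.ofReal_ne_top

theorem tendsto_lqCost {x : ℕ → EuclideanSpace ℝ (Fin n)}
    (hx : Filter.Tendsto x Filter.atTop (𝓝 0)) :
    Filter.Tendsto (fun i => lqCost Plq (x i)) Filter.atTop (𝓝 0) := by
  have hc : Continuous (lqCost Plq) := by
    unfold lqCost
    fun_prop
  have h1 := (hc.tendsto 0).comp hx
  have h0 : lqCost Plq 0 = 0 := by simp [lqCost]
  rwa [h0] at h1

theorem summable_stageCost (h : P.FeedbackFactor Plq K N N' r)
    {v : ℕ → EuclideanSpace ℝ (Fin m)} (hv : Summable fun i => ‖v i‖ ^ 2) :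
    Summable fun i => P.stageCost (P.traj (P.feedbackInput K N' P.xinit v) i)
      (P.feedbackInput K N' P.xinit v i) := by
  refine summable_of_sum_range_le (c := lqCost Plq P.xinit + (1 / 2) * ∑' i, ‖v i‖ ^ 2)
    (fun i => h.stageCost_nonneg _ _) fun T => ?_
  have h1 := h.sum_stageCost P.xinit v T
  have h2 := h.lqCost_nonneg (P.feedbackState K N' P.xinit v T)
  have h3 := hv.sum_le_tsum (Finset.range T) fun i _ => sq_nonneg _
  simp only [traj_feedbackInput]
  linarith

theorem tendsto_feedbackState (h : P.FeedbackFactor Plq K N N' r)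
    {v : ℕ → EuclideanSpace ℝ (Fin m)} (hv : Summable fun i => ‖v i‖ ^ 2) :
    Filter.Tendsto (P.feedbackState K N' P.xinit v) Filter.atTop (𝓝 0) :=
  (h.detect _ (h.summable_stageCost hv)).congr fun i => traj_feedbackInput v i

/-- This is the limit of `sum_stageCost`: finite cost forces the states to zero by detectability, so
the terminal cost disappears. -/
theorem cost_feedbackInput (h : P.FeedbackFactor Plq K N N' r)
    {v : ℕ → EuclideanSpace ℝ (Fin m)} (hv : Summable fun i => ‖v i‖ ^ 2) :
    P.cost (P.feedbackInput K N' P.xinit v) =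
      ENNReal.ofReal (lqCost Plq P.xinit + (1 / 2) * ∑' i, ‖v i‖ ^ 2) := by
  have hs := h.summable_stageCost hv
  rw [cost, ← ENNReal.ofReal_tsum_of_nonneg (fun i => h.stageCost_nonneg _ _) hs]
  congr 1
  have h1 := (tendsto_lqCost (Plq := Plq) (h.tendsto_feedbackState hv)).add
    hs.hasSum.tendsto_sum_nat
  have h2 := (hv.hasSum.tendsto_sum_nat.const_mul (1 / 2)).const_add (lqCost Plq P.xinit)
  rw [zero_add] at h1
  refine tendsto_nhds_unique h1 (h2.congr fun T => ?_)
  simp only [traj_feedbackInput]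
  exact (h.sum_stageCost P.xinit v T).symm

/-- Finite cost makes the states tend to zero, so the terminal costs in `sum_stageCost` are bounded.
Together with `cost_feedbackInput` this identifies the domain of the cost with `ℓ²`. -/
theorem summable_deviation (h : P.FeedbackFactor Plq K N N' r)
    {u : ℕ → EuclideanSpace ℝ (Fin m)} (hu : P.cost u ≠ ⊤) :
    Summable fun i => ‖P.feedbackDeviation K N u i‖ ^ 2 := by
  have hs := (h.cost_ne_top_iff u).1 hu
  obtain ⟨b, hb⟩ := (tendsto_lqCost (Plq := Plq) (h.detect u hs)).bddAbove_range
  refine summable_of_sum_range_le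
    (c := 2 * (b + ∑' i, P.stageCost (P.traj u i) (u i))) (fun i => sq_nonneg _) fun T => ?_
  have h1 := h.sum_stageCost P.xinit (P.feedbackDeviation K N u) T
  simp only [h.feedbackInput_deviation, h.feedbackState_deviation] at h1
  have h2 := h.lqCost_nonneg P.xinit
  have h3 := hs.sum_le_tsum (Finset.range T) fun i _ => h.stageCost_nonneg _ _
  have h4 : lqCost Plq (P.traj u T) ≤ b := hb ⟨T, rfl⟩
  linarith

end FeedbackFactor

end Feedback

end CLQR

/-! ### Convex quadratic functions `½ ‖D⋆ l‖² + ⟨l, d⟩` -/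

section DualQuadratic

variable {V H : Type*} [NormedAddCommGroup V] [InnerProductSpace ℝ V] [CompleteSpace V]
  [NormedAddCommGroup H] [InnerProductSpace ℝ H] [CompleteSpace H] (D : V →L[ℝ] H) (d : H)

/-- The convex quadratic function `½ ‖D⋆ l‖² + ⟨l, d⟩`. -/
noncomputable def dualQuadratic (l : H) : ℝ :=
  (1 / 2) * ‖ContinuousLinearMap.adjoint D l‖ ^ 2 + inner ℝ l d

/-- The gradient `D D⋆ l + d` of `½ ‖D⋆ l‖² + ⟨l, d⟩`. -/
noncomputable def dualQuadraticGrad (l : H) : H := D (ContinuousLinearMap.adjoint D l) + d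

theorem dualQuadratic_expand (l l₀ : H) :
    dualQuadratic D d l = dualQuadratic D d l₀ + inner ℝ (dualQuadraticGrad D d l₀) (l - l₀) +
      (1 / 2) * ‖ContinuousLinearMap.adjoint D (l - l₀)‖ ^ 2 := by
  obtain ⟨z, rfl⟩ : ∃ z, l = l₀ + z := ⟨l - l₀, by abel⟩
  simp only [dualQuadratic, dualQuadraticGrad, add_sub_cancel_left, map_add, norm_add_sq_real,
    inner_add_left]
  rw [← ContinuousLinearMap.adjoint_inner_right D (ContinuousLinearMap.adjoint D l₀) z,
    real_inner_comm z d]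
  ring

theorem hasGradientAt_dualQuadratic_sub_const (c : ℝ) (l : H) :
    HasGradientAt (fun l => dualQuadratic D d l - c) (dualQuadraticGrad D d l) l := by
  rw [hasGradientAt_iff_isLittleO]
  set κ := ‖ContinuousLinearMap.adjoint D‖
  have h1 : (fun x' : H => dualQuadratic D d x' - c - (dualQuadratic D d l - c) -
      inner ℝ (dualQuadraticGrad D d l) (x' - l)) =
      fun x' => (1 / 2) * ‖ContinuousLinearMap.adjoint D (x' - l)‖ ^ 2 := by
    funext x'
    rw [dualQuadratic_expand D d x' l]
    ring
  rw [h1]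
  have h2 : (fun x' : H => (1 / 2) * ‖ContinuousLinearMap.adjoint D (x' - l)‖ ^ 2) =O[𝓝 l]
      fun x' => ‖x' - l‖ ^ 2 := by
    refine Asymptotics.IsBigO.of_bound (κ ^ 2) (Filter.Eventually.of_forall fun x' => ?_)
    have h3 := pow_le_pow_left₀ (norm_nonneg _)
      ((ContinuousLinearMap.adjoint D).le_opNorm (x' - l)) 2
    rw [mul_pow] at h3
    rw [Real.norm_of_nonneg (by positivity), Real.norm_of_nonneg (by positivity)]
    nlinarith [sq_nonneg ‖ContinuousLinearMap.adjoint D (x' - l)‖]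
  refine h2.trans_isLittleO ?_
  have h4 : (fun x' : H => ‖x' - l‖ ^ 2) =o[𝓝 l] fun x' => ‖x' - l‖ ^ 1 :=
    Asymptotics.IsLittleO.comp_tendsto (Asymptotics.isLittleO_pow_pow one_lt_two)
      (tendsto_norm_sub_self l)
  simp only [pow_one] at h4
  exact h4.of_norm_right

/-- The gradient has linear part `D D⋆`, so `‖D⋆ l‖² = ⟨l, D D⋆ l⟩ ≤ L ‖l‖²`. This is the only form
in which the Lipschitz constant enters. -/
theorem norm_adjoint_sq_le_of_lipschitz {L : ℝ≥0} (h : LipschitzWith L (dualQuadraticGrad D d))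
    (l : H) : ‖ContinuousLinearMap.adjoint D l‖ ^ 2 ≤ L * ‖l‖ ^ 2 := by
  have h1 := h.norm_sub_le l 0
  simp only [dualQuadraticGrad, map_zero, zero_add, add_sub_cancel_right, sub_zero] at h1
  rw [← real_inner_self_eq_norm_sq, ContinuousLinearMap.adjoint_inner_right]
  refine (real_inner_le_norm _ _).trans ?_
  nlinarith [norm_nonneg l]

theorem convexOn_dualQuadratic {C : Set H} (hC : Convex ℝ C) :
    ConvexOn ℝ C (dualQuadratic D d) := by
  refine ⟨hC, fun x _ y _ a b ha hb hab => ?_⟩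
  set z := a • x + b • y
  have hx := dualQuadratic_expand D d x z
  have hy := dualQuadratic_expand D d y z
  have h0 : a • (x - z) + b • (y - z) = 0 := by
    have : a • (x - z) + b • (y - z) = z - (a + b) • z := by
      simp only [z]
      module
    rw [this, hab, one_smul, sub_self]
  have h1 := congrArg (fun v => (inner ℝ (dualQuadraticGrad D d z) v : ℝ)) h0
  simp only [inner_add_right, inner_smul_right, inner_zero_right] at h1
  have h2 : dualQuadratic D d z = a * dualQuadratic D d z + b * dualQuadratic D d z := by
    rw [← add_mul, hab, one_mul]
  rw [smul_eq_mul, smul_eq_mul, h2, hx, hy]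
  nlinarith [mul_nonneg ha (sq_nonneg ‖ContinuousLinearMap.adjoint D (x - z)‖),
    mul_nonneg hb (sq_nonneg ‖ContinuousLinearMap.adjoint D (y - z)‖)]

/-- The hypothesis on `p` is the variational inequality of the projection of a gradient step from
`y`. The exact expansion at `y` supplies the quadratic upper bound at `p` and the linear lower bound
at `z`. Expanding `‖y - z‖²` around `p` does the rest. -/
theorem dualQuadratic_descent {L : ℝ} (hL : 0 < L)
    (h : ∀ l, ‖ContinuousLinearMap.adjoint D l‖ ^ 2 ≤ L * ‖l‖ ^ 2) {y p z : H}
    (hp : inner ℝ (y - (1 / L) • dualQuadraticGrad D d y - p) (z - p) ≤ 0) :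
    dualQuadratic D d p + L / 2 * ‖p - z‖ ^ 2 ≤ dualQuadratic D d z + L / 2 * ‖y - z‖ ^ 2 := by
  set g := dualQuadraticGrad D d y
  have h1 := dualQuadratic_expand D d p y
  have h2 := dualQuadratic_expand D d z y
  have h3 := h (p - y)
  have e1 : y - (1 / L) • g - p = (y - p) - (1 / L) • g := by abel
  rw [e1, inner_sub_left, real_inner_smul_left] at hp
  have hp' : L * inner ℝ (y - p) (z - p) - inner ℝ g (z - p) ≤ 0 := by
    have h4 := mul_nonpos_of_nonneg_of_nonpos hL.le hp
    have e3 : L * (inner ℝ (y - p) (z - p) - 1 / L * inner ℝ g (z - p)) =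
        L * inner ℝ (y - p) (z - p) - inner ℝ g (z - p) := by
      field_simp
    linarith
  have e2 : y - z = (y - p) - (z - p) := by abel
  have e4 : (inner ℝ g (z - p) : ℝ) = inner ℝ g (z - y) - inner ℝ g (p - y) := by
    rw [← inner_sub_right]
    congr 1
    abel
  rw [e2, norm_sub_rev p z, norm_sub_sq_real (y - p) (z - p)]
  rw [norm_sub_rev p y] at h3
  nlinarith [sq_nonneg ‖ContinuousLinearMap.adjoint D (z - y)‖]

end DualQuadratic

/-! ### Weighted sequences -/

namespace WL2

variable {w : ℝ} [hw : Fact (0 < w)] {E : Type*} [NormedAddCommGroup E] [InnerProductSpace ℝ E]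

instance : Fact ((0 : ℝ) < 1) := ⟨one_pos⟩

theorem summable_norm_sq_one (v : WL2 1 E) : Summable fun i => ‖v i‖ ^ 2 := by
  simpa using v.summable_norm_sq

theorem norm_sq_eq_one (v : WL2 1 E) : ‖v‖ ^ 2 = ∑' i, ‖v i‖ ^ 2 := by
  rw [norm_sq_eq]
  simp

theorem norm_apply_sq_le (z : WL2 w E) (i : ℕ) : w ^ i * ‖z i‖ ^ 2 ≤ ‖z‖ ^ 2 := by
  rw [norm_sq_eq]
  exact z.summable_norm_sq.le_tsum i fun j _ => mul_nonneg (pow_pos hw.out j).le (sq_nonneg _)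

/-- The evaluation at an index. -/
noncomputable def eval (i : ℕ) : WL2 w E →L[ℝ] E :=
  LinearMap.mkContinuousOfExistsBound
    { toFun := fun z => z i
      map_add' := fun _ _ => rfl
      map_smul' := fun _ _ => rfl }
    ⟨√((w ^ i)⁻¹), fun z => by
      refine Real.le_sqrt_of_sq_le ?_ |>.trans_eq ?_ (b := √((w ^ i)⁻¹ * ‖z‖ ^ 2))
      · rw [le_inv_mul_iff₀ (pow_pos hw.out i)]
        exact norm_apply_sq_le z i
      · rw [Real.sqrt_mul (inv_nonneg.2 (pow_pos hw.out i).le), Real.sqrt_sq (norm_nonneg _)]⟩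

@[simp] theorem eval_apply (i : ℕ) (z : WL2 w E) : eval i z = z i := rfl

theorem clip_apply {ι : Type*} [Fintype ι] (z : WL2 w (EuclideanSpace ℝ ι)) (i : ℕ) (j : ι) :
    clip z i j = min (z i j) 0 := rfl

/-- Clipping is the projection onto the nonpositive orthant also for the weighted inner product,
because the weights are positive and constant within each block. -/
theorem inner_sub_clip_nonpos {ι : Type*} [Fintype ι] (x z : WL2 w (EuclideanSpace ℝ ι))
    (hz : ∀ i j, z i j ≤ 0) : inner ℝ (x - clip x) (z - clip x) ≤ 0 := by
  rw [inner_eq]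
  refine tsum_nonpos fun i => mul_nonpos_of_nonneg_of_nonpos (pow_pos hw.out i).le ?_
  rw [PiLp.inner_apply]
  refine Finset.sum_nonpos fun j _ => ?_
  simp only [sub_apply, PiLp.sub_apply, clip_apply, RCLike.inner_apply, conj_trivial]
  rcases le_total (x i j) 0 with h | h
  · simp [h]
  · rw [min_eq_right h]
    nlinarith [hz i j]

/-- The sequence truncated after its first `T` entries. -/
noncomputable def trunc (T : ℕ) (z : WL2 w E) : WL2 w E :=
  mk (fun i => if i < T then z i else 0) (by
    refine Summable.of_nonneg_of_le
      (fun i => mul_nonneg (pow_pos hw.out i).le (sq_nonneg _)) (fun i => ?_) z.summable_norm_sq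
    split_ifs
    · exact le_rfl
    · simpa using mul_nonneg (pow_pos hw.out i).le (sq_nonneg _))

theorem trunc_apply_of_lt {T i : ℕ} (h : i < T) (z : WL2 w E) : trunc T z i = z i := if_pos h

theorem trunc_apply_of_le {T i : ℕ} (h : T ≤ i) (z : WL2 w E) : trunc T z i = 0 :=
  if_neg (not_lt.2 h)

theorem inner_trunc (T : ℕ) (y z : WL2 w E) : (inner ℝ y (trunc T z) : ℝ) =
    ∑ i ∈ Finset.range T, w ^ i * inner ℝ (y i) (z i) := by
  rw [inner_eq, tsum_eq_sum (s := Finset.range T)]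
  · refine Finset.sum_congr rfl fun i hi => ?_
    rw [trunc_apply_of_lt (Finset.mem_range.1 hi)]
  · intro i hi
    rw [trunc_apply_of_le (not_lt.1 fun hlt => hi (Finset.mem_range.2 hlt)), inner_zero_right,
      mul_zero]

theorem trunc_eq_self {T : ℕ} {z : WL2 w E} (h : ∀ i, T ≤ i → z i = 0) : trunc T z = z := by
  ext i
  rcases lt_or_ge i T with hi | hi
  · rw [trunc_apply_of_lt hi]
  · rw [trunc_apply_of_le hi, h i hi]

theorem inner_eq_sum_of_eq_zero {T : ℕ} (z y : WL2 w E) (h : ∀ i, T ≤ i → z i = 0) :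
    (inner ℝ z y : ℝ) = ∑ i ∈ Finset.range T, w ^ i * inner ℝ (z i) (y i) := by
  rw [← trunc_eq_self h, real_inner_comm, inner_trunc]
  refine Finset.sum_congr rfl fun i hi => ?_
  rw [trunc_apply_of_lt (Finset.mem_range.1 hi), real_inner_comm]

theorem inner_trunc_sub_self (T : ℕ) (y z : WL2 w E) :
    (inner ℝ (trunc T y) (z - trunc T z) : ℝ) = 0 := by
  rw [inner_eq_sum_of_eq_zero _ _ fun i hi => trunc_apply_of_le hi y]
  refine Finset.sum_eq_zero fun i hi => ?_
  rw [sub_apply, trunc_apply_of_lt (Finset.mem_range.1 hi) z, sub_self, inner_zero_right, mul_zero]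

end WL2

namespace CLQR

variable {n m px pu : ℕ} {P : CLQR n m px pu}

/-! ### The condensed problem in the deviations from the LQ feedback -/

section Condensed

variable {K : Matrix (Fin m) (Fin n) ℝ}
  {N N' : EuclideanSpace ℝ (Fin m) →L[ℝ] EuclideanSpace ℝ (Fin m)}
  {Plq : Matrix (Fin n) (Fin n) ℝ} {r : ℝ} {w : ℝ} [Fact (0 < w)]

/-- The blocks `(Cu uᵢ - cu, Cx xᵢ₊₁ - cx)`. -/
noncomputable def residual (P : CLQR n m px pu) (u : ℕ → EuclideanSpace ℝ (Fin m)) (i : ℕ) :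
    EuclideanSpace ℝ (Fin pu ⊕ Fin px) :=
  WithLp.toLp 2 (Sum.elim (fun j => P.Cu.toE (u i) j - P.cu j)
    fun j => P.Cx.toE (P.traj u (i + 1)) j - P.cx j)

theorem opC_sub_vecC (hw : AdmissibleWeight P.A w) (u : WL2 w (EuclideanSpace ℝ (Fin m)))
    (i : ℕ) : (P.opC hw u - P.vecC hw) i = P.residual u i := by
  have hs := P.stateSeq_apply hw u i
  ext j
  rcases j with j | j
  · rw [WL2.sub_apply, PiLp.sub_apply, opC_apply_inl]
    simp [vecC, residual, Matrix.toE_apply, Matrix.fromRows_mulVec]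
  · rw [WL2.sub_apply, PiLp.sub_apply, opC_apply_inr]
    simp only [residual, Sum.elim_inr, ← hs, stateSeq, WL2.add_apply, map_add, PiLp.add_apply,
      vecC, WL2.sub_apply, PiLp.sub_apply, WL2.mk_apply, WL2.diag_apply]
    have h1 : (Matrix.fromRows (0 : Matrix (Fin pu) (Fin n) ℝ) P.Cx).toE (P.freeResponse hw i)
        (Sum.inr j) = P.Cx.toE (P.freeResponse hw i) j := by
      simp [Matrix.toE_apply, Matrix.fromRows_mulVec]
    rw [h1]
    ring

theorem residual_congr {v v' : ℕ → EuclideanSpace ℝ (Fin m)} {i : ℕ}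
    (hv : ∀ j ≤ i, v j = v' j) :
    P.residual (P.feedbackInput K N' P.xinit v) i =
      P.residual (P.feedbackInput K N' P.xinit v') i := by
  simp only [residual, traj_feedbackInput, feedbackInput_congr P.xinit hv,
    feedbackState_congr P.xinit fun j (hj : j < i + 1) => hv j (Nat.lt_succ_iff.1 hj)]

/-- The residual pairs `uᵢ` with `xᵢ₊₁`, so the constraint on the initial state appears separately.
No input can influence it. -/
theorem feasible_iff {u : ℕ → EuclideanSpace ℝ (Fin m)} :
    P.Feasible u ↔ (∀ j, P.Cx.toE P.xinit j ≤ P.cx j) ∧ ∀ i j, P.residual u i j ≤ 0 := by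
  constructor
  · intro h
    refine ⟨(h 0).1, fun i j => ?_⟩
    rcases j with j | j
    · exact sub_nonpos.2 ((h i).2 j)
    · exact sub_nonpos.2 ((h (i + 1)).1 j)
  · rintro ⟨h0, h⟩ i
    refine ⟨fun j => ?_, fun j => sub_nonpos.1 (h i (Sum.inl j))⟩
    cases i with
    | zero => exact h0 j
    | succ i => exact sub_nonpos.1 (h i (Sum.inr j))

theorem residual_nonpos_of_mem_maxInvariantSet {v : ℕ → EuclideanSpace ℝ (Fin m)} {T : ℕ}
    (hv : ∀ i, T ≤ i → v i = 0)
    (hT : P.feedbackState K N' P.xinit v T ∈ P.maxInvariantSet K) (i : ℕ) (hi : T ≤ i)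
    (j : Fin pu ⊕ Fin px) : P.residual (P.feedbackInput K N' P.xinit v) i j ≤ 0 := by
  obtain ⟨k, rfl⟩ := Nat.exists_eq_add_of_le hi
  rcases j with j | j
  · refine sub_nonpos.2 ?_
    rw [feedbackInput, hv _ hi, map_zero, add_zero, feedbackState_add_of_eq_zero _ hv]
    exact (hT k).2 j
  · refine sub_nonpos.2 ?_
    rw [traj_feedbackInput, add_assoc, feedbackState_add_of_eq_zero _ hv]
    exact (hT (k + 1)).1 j

theorem IsStrongConvexityModulus.midpoint_le {μ : ℝ}
    (h : P.IsStrongConvexityModulus w μ) {x y : WL2 w (EuclideanSpace ℝ (Fin m))}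
    (hx : P.objective x ≠ ⊤) (hy : P.objective y ≠ ⊤) :
    (P.objective ((1 / 2 : ℝ) • x + (1 / 2 : ℝ) • y)).toReal + μ / 8 * ‖x - y‖ ^ 2 ≤
      (1 / 2) * (P.objective x).toReal + (1 / 2) * (P.objective y).toReal := by
  have h0 : StrongConvexOn _ _ _ := h
  have h1 := h0.2 hx hy (show (0 : ℝ) ≤ 1 / 2 by norm_num)
    (show (0 : ℝ) ≤ 1 / 2 by norm_num) (by norm_num)
  simp only [smul_eq_mul] at h1
  linarith

namespace FeedbackFactor

/-- The part of the input which is linear in the deviation from the LQ feedback. -/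
noncomputable def inputOp (h : P.FeedbackFactor Plq K N N' r) (hw : AdmissibleWeight P.A w) :
    WL2 1 (EuclideanSpace ℝ (Fin m)) →L[ℝ] WL2 w (EuclideanSpace ℝ (Fin m)) :=
  -- Since `w < 1`, unweighted square summability is stronger than weighted. The bound on the inputs
  -- comes from coercivity of the stage cost.
  have hle : ∀ (z : EuclideanSpace ℝ (Fin m)) (i : ℕ), w ^ i * ‖z‖ ^ 2 ≤ ‖z‖ ^ 2 := fun z i =>
    mul_le_of_le_one_left (sq_nonneg _) (pow_le_one₀ hw.pos.le hw.lt_one.le)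
  have hs : ∀ v : WL2 1 (EuclideanSpace ℝ (Fin m)),
      Summable fun i => w ^ i * ‖P.feedbackInput K N' 0 v i‖ ^ 2 := fun v =>
    Summable.of_nonneg_of_le (fun i => mul_nonneg (pow_nonneg hw.pos.le i) (sq_nonneg _))
      (fun i => hle _ i) (h.feedbackInput_summable 0 v.summable_norm_sq_one).1
  LinearMap.mkContinuousOfExistsBound
    { toFun := fun v => WL2.mk (P.feedbackInput K N' 0 v) (hs v)
      map_add' := fun v v' => by
        ext1 i
        have h1 := feedbackInput_add (P := P) (K := K) (N' := N') 0 0 v v' i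
        rw [add_zero] at h1
        exact h1
      map_smul' := fun c v => by
        ext1 i
        have h1 := feedbackInput_smul (P := P) (K := K) (N' := N') c 0 v i
        rw [smul_zero] at h1
        exact h1 }
    ⟨√(r⁻¹ * (1 / 2)), fun v => by
      have hr := h.pos
      refine le_of_sq_le_sq ?_ (by positivity)
      rw [mul_pow, Real.sq_sqrt (by positivity), WL2.norm_sq_eq, WL2.norm_sq_eq_one]
      obtain ⟨h1, h2⟩ := h.feedbackInput_summable 0 v.summable_norm_sq_one
      refine ((hs v).tsum_le_tsum (fun i => hle _ i) h1).trans (h2.trans (le_of_eq ?_))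
      simp [lqCost, mul_assoc]⟩

/-- The input of the LQ feedback. -/
noncomputable def lqInput (h : P.FeedbackFactor Plq K N N' r) (hw : AdmissibleWeight P.A w) :
    WL2 w (EuclideanSpace ℝ (Fin m)) :=
  WL2.mk (P.feedbackInput K N' P.xinit 0) (Summable.of_nonneg_of_le
    (fun i => mul_nonneg (pow_nonneg hw.pos.le i) (sq_nonneg _))
    (fun i => mul_le_of_le_one_left (sq_nonneg _) (pow_le_one₀ hw.pos.le hw.lt_one.le))
    (h.feedbackInput_summable P.xinit (v := 0) (by simp [summable_zero])).1)

theorem lqCost_add_nonneg (h : P.FeedbackFactor Plq K N N' r)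
    (v : WL2 1 (EuclideanSpace ℝ (Fin m))) : 0 ≤ lqCost Plq P.xinit + (1 / 2) * ‖v‖ ^ 2 := by
  have := h.lqCost_nonneg P.xinit
  positivity

variable (h : P.FeedbackFactor Plq K N N' r) (hw : AdmissibleWeight P.A w)

theorem lqInput_add_inputOp (v : WL2 1 (EuclideanSpace ℝ (Fin m))) :
    ((h.lqInput hw + h.inputOp hw v : WL2 w (EuclideanSpace ℝ (Fin m))) :
      ℕ → EuclideanSpace ℝ (Fin m)) = P.feedbackInput K N' P.xinit v := by
  funext i
  have h1 := feedbackInput_add (P := P) (K := K) (N' := N') P.xinit 0 0 v i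
  rw [add_zero] at h1
  simp only [Pi.zero_apply, zero_add] at h1
  exact h1.symm

theorem objective_add_inputOp (v : WL2 1 (EuclideanSpace ℝ (Fin m))) :
    P.objective (h.lqInput hw + h.inputOp hw v) =
      ENNReal.ofReal (lqCost Plq P.xinit + (1 / 2) * ‖v‖ ^ 2) := by
  rw [objective, h.lqInput_add_inputOp, h.cost_feedbackInput v.summable_norm_sq_one,
    WL2.norm_sq_eq_one]

/-- The deviation from the LQ feedback of an input of finite cost. -/
noncomputable def deviation {u : ℕ → EuclideanSpace ℝ (Fin m)} (hu : P.cost u ≠ ⊤) :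
    WL2 1 (EuclideanSpace ℝ (Fin m)) :=
  WL2.mk (P.feedbackDeviation K N u) (by simpa using h.summable_deviation hu)

theorem feedbackInput_deviation_mk {u : ℕ → EuclideanSpace ℝ (Fin m)} (hu : P.cost u ≠ ⊤) :
    P.feedbackInput K N' P.xinit (h.deviation hu) = u :=
  h.feedbackInput_deviation u

theorem exists_of_objective_ne_top {u : WL2 w (EuclideanSpace ℝ (Fin m))}
    (hu : P.objective u ≠ ⊤) : ∃ v, u = h.lqInput hw + h.inputOp hw v :=
  ⟨h.deviation hu, WL2.ext fun i => (congrFun ((h.lqInput_add_inputOp hw _).trans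
    (h.feedbackInput_deviation_mk hu)) i).symm⟩

/-- The constraint operator in terms of the deviations. -/
noncomputable def constraintOp :
    WL2 1 (EuclideanSpace ℝ (Fin m)) →L[ℝ] WL2 w (EuclideanSpace ℝ (Fin pu ⊕ Fin px)) :=
  P.opC hw ∘L h.inputOp hw

/-- The residual of the constraints under the LQ feedback. -/
noncomputable def constraintVec : WL2 w (EuclideanSpace ℝ (Fin pu ⊕ Fin px)) :=
  P.opC hw (h.lqInput hw) - P.vecC hw

theorem constraint_apply (v : WL2 1 (EuclideanSpace ℝ (Fin m))) (i : ℕ) :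
    (h.constraintOp hw v + h.constraintVec hw) i =
      P.residual (P.feedbackInput K N' P.xinit v) i := by
  have h1 : h.constraintOp hw v + h.constraintVec hw =
      P.opC hw (h.lqInput hw + h.inputOp hw v) - P.vecC hw := by
    rw [map_add, constraintOp, constraintVec, ContinuousLinearMap.comp_apply]
    abel
  rw [h1, opC_sub_vecC hw, h.lqInput_add_inputOp hw]

theorem constraintOp_congr {v v' : WL2 1 (EuclideanSpace ℝ (Fin m))} {i : ℕ}
    (hv : ∀ j ≤ i, v j = v' j) : h.constraintOp hw v i = h.constraintOp hw v' i := by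
  have h1 := h.constraint_apply hw v i
  rw [residual_congr hv, ← h.constraint_apply hw v' i] at h1
  simpa using h1

/-! ### The conjugate function and its gradient -/

theorem conjObjective_adjoint (l : WL2 w (EuclideanSpace ℝ (Fin pu ⊕ Fin px))) :
    P.conjObjective (ContinuousLinearMap.adjoint (P.opC hw) l) =
      (((1 / 2) * ‖ContinuousLinearMap.adjoint (h.constraintOp hw) l‖ ^ 2 +
        inner ℝ l (P.opC hw (h.lqInput hw)) - lqCost Plq P.xinit : ℝ) : EReal) := by
  -- Along the inputs of finite cost the expression under the supremum is a concave quadratic in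
  -- `v`. Completing the square exhibits its maximizer as the adjoint image of `l`.
  have key : ∀ v, ((inner ℝ (ContinuousLinearMap.adjoint (P.opC hw) l)
      (h.lqInput hw + h.inputOp hw v) : ℝ) : EReal) -
      (P.objective (h.lqInput hw + h.inputOp hw v) : EReal) =
      (((1 / 2) * ‖ContinuousLinearMap.adjoint (h.constraintOp hw) l‖ ^ 2 +
        inner ℝ l (P.opC hw (h.lqInput hw)) - lqCost Plq P.xinit -
        (1 / 2) * ‖v - ContinuousLinearMap.adjoint (h.constraintOp hw) l‖ ^ 2 : ℝ) : EReal) := by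
    intro v
    rw [h.objective_add_inputOp, EReal.coe_ennreal_ofReal, max_eq_left (h.lqCost_add_nonneg v),
      ← EReal.coe_sub, ContinuousLinearMap.adjoint_inner_left, map_add, inner_add_right,
      norm_sub_sq_real, ContinuousLinearMap.adjoint_inner_right]
    congr 1
    rw [constraintOp, ContinuousLinearMap.comp_apply, real_inner_comm l]
    ring
  apply le_antisymm
  · refine iSup_le fun u => ?_
    by_cases hu : P.objective u = ⊤
    · rw [hu, EReal.coe_ennreal_top, EReal.sub_top]
      exact bot_le
    · obtain ⟨v, rfl⟩ := h.exists_of_objective_ne_top hw hu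
      rw [key]
      exact EReal.coe_le_coe_iff.2 (by
        have := sq_nonneg ‖v - ContinuousLinearMap.adjoint (h.constraintOp hw) l‖
        linarith)
  · refine le_trans (le_of_eq ?_) (le_iSup _
      (h.lqInput hw + h.inputOp hw (ContinuousLinearMap.adjoint (h.constraintOp hw) l)))
    rw [key, sub_self, norm_zero]
    congr 1
    ring

theorem hStarE_eq (l : WL2 w (EuclideanSpace ℝ (Fin pu ⊕ Fin px))) :
    P.hStarE hw l =
      ((dualQuadratic (h.constraintOp hw) (h.constraintVec hw) l - lqCost Plq P.xinit : ℝ) :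
        EReal) := by
  rw [hStarE, h.conjObjective_adjoint hw, ← EReal.coe_sub]
  congr 1
  rw [dualQuadratic, constraintVec, inner_sub_right]
  ring

theorem hStar_eq : P.hStar hw = fun l =>
    dualQuadratic (h.constraintOp hw) (h.constraintVec hw) l - lqCost Plq P.xinit := by
  funext l
  rw [hStar, h.hStarE_eq hw, EReal.toReal_coe]

theorem hasGradientAt_hStar (l : WL2 w (EuclideanSpace ℝ (Fin pu ⊕ Fin px))) :
    HasGradientAt (P.hStar hw) (dualQuadraticGrad (h.constraintOp hw) (h.constraintVec hw) l)
      l := by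
  rw [h.hStar_eq hw]
  exact hasGradientAt_dualQuadratic_sub_const _ _ _ l

theorem gradient_hStar : gradient (P.hStar hw) =
    dualQuadraticGrad (h.constraintOp hw) (h.constraintVec hw) :=
  funext fun l => (h.hasGradientAt_hStar hw l).gradient

/-- On its domain `f` is a constant plus `½ ‖v‖²`. Strong convexity at the midpoint of `v` and `0`
reads `⅛ ‖v‖² + (μ / 8) ‖u - u'‖² ≤ ¼ ‖v‖²`, where `u - u'` is the image of `v`. -/
theorem norm_inputOp_sq_le {μ : ℝ} (hmod : P.IsStrongConvexityModulus w μ)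
    (v : WL2 1 (EuclideanSpace ℝ (Fin m))) : μ * ‖h.inputOp hw v‖ ^ 2 ≤ ‖v‖ ^ 2 := by
  have hfin : ∀ v, P.objective (h.lqInput hw + h.inputOp hw v) ≠ ⊤ := fun v => by
    rw [h.objective_add_inputOp]
    exact ENNReal.ofReal_ne_top
  have h1 := hmod.midpoint_le (hfin v) (hfin 0)
  have e1 : (1 / 2 : ℝ) • (h.lqInput hw + h.inputOp hw v) +
      (1 / 2 : ℝ) • (h.lqInput hw + h.inputOp hw 0) =
      h.lqInput hw + h.inputOp hw ((1 / 2 : ℝ) • v) := by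
    rw [map_zero, map_smul]
    module
  have e2 : h.lqInput hw + h.inputOp hw v - (h.lqInput hw + h.inputOp hw 0) = h.inputOp hw v := by
    rw [map_zero]
    abel
  rw [e1, e2, h.objective_add_inputOp, h.objective_add_inputOp, h.objective_add_inputOp,
    ENNReal.toReal_ofReal (h.lqCost_add_nonneg _), ENNReal.toReal_ofReal (h.lqCost_add_nonneg _),
    ENNReal.toReal_ofReal (h.lqCost_add_nonneg _), norm_smul, norm_zero, mul_pow] at h1
  norm_num at h1
  linarith

/-- This is causality: a deviation supported from `T` on does not affect the residuals before `T`,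
where `l` lives. The tail of the adjoint image is therefore orthogonal to that image, hence zero. -/
theorem adjoint_apply_eq_zero {l : WL2 w (EuclideanSpace ℝ (Fin pu ⊕ Fin px))} {T : ℕ}
    (hl : ∀ i, T ≤ i → l i = 0) (i : ℕ) (hi : T ≤ i) :
    ContinuousLinearMap.adjoint (h.constraintOp hw) l i = 0 := by
  set z := ContinuousLinearMap.adjoint (h.constraintOp hw) l with hz
  have h1 : (inner ℝ z (z - WL2.trunc T z) : ℝ) = 0 := by
    rw [hz, ContinuousLinearMap.adjoint_inner_left,
      WL2.inner_eq_sum_of_eq_zero _ _ hl]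
    refine Finset.sum_eq_zero fun i hi => ?_
    have h2 : h.constraintOp hw (z - WL2.trunc T z) i = h.constraintOp hw 0 i :=
      h.constraintOp_congr hw fun j hj => by
        rw [WL2.sub_apply, WL2.trunc_apply_of_lt (hj.trans_lt (Finset.mem_range.1 hi)), sub_self,
          WL2.zero_apply]
    rw [h2, map_zero, WL2.zero_apply, inner_zero_right, mul_zero]
  have h3 : z - WL2.trunc T z = 0 := by
    rw [← inner_self_eq_zero (𝕜 := ℝ), inner_sub_left, h1, WL2.inner_trunc_sub_self, sub_zero]
  rw [sub_eq_zero.1 h3, WL2.trunc_apply_of_le hi]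

/-! ### Minimizers of the truncated Lagrangian -/

/-- The terminal cost makes the cost part exact, and `l` sees only residuals before `T`. What
remains is a quadratic in the first `T` deviations, completed to a square. -/
theorem truncLagrangian_eq {l : WL2 w (EuclideanSpace ℝ (Fin pu ⊕ Fin px))} {T : ℕ}
    (hl : ∀ i, T ≤ i → l i = 0) (u : ℕ → EuclideanSpace ℝ (Fin m))
    {v : WL2 1 (EuclideanSpace ℝ (Fin m))} (hv : ∀ i < T, v i = P.feedbackDeviation K N u i)
    (hvT : ∀ i, T ≤ i → v i = 0) :
    P.truncLagrangian Plq l T u = lqCost Plq P.xinit - inner ℝ l (h.constraintVec hw) -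
      (1 / 2) * ‖ContinuousLinearMap.adjoint (h.constraintOp hw) l‖ ^ 2 +
      (1 / 2) * ‖v - ContinuousLinearMap.adjoint (h.constraintOp hw) l‖ ^ 2 := by
  have h1 := h.sum_stageCost P.xinit (P.feedbackDeviation K N u) T
  simp only [h.feedbackInput_deviation, h.feedbackState_deviation] at h1
  have h2 : ‖v‖ ^ 2 = ∑ i ∈ Finset.range T, ‖P.feedbackDeviation K N u i‖ ^ 2 := by
    rw [← real_inner_self_eq_norm_sq, WL2.inner_eq_sum_of_eq_zero _ _ hvT]
    refine Finset.sum_congr rfl fun i hi => ?_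
    rw [hv i (Finset.mem_range.1 hi), one_pow, one_mul, real_inner_self_eq_norm_sq]
  have h3 : (inner ℝ l (h.constraintOp hw v + h.constraintVec hw) : ℝ) =
      ∑ i ∈ Finset.range T, w ^ i * (∑ j, l i (Sum.inl j) * (P.Cu.toE (u i) j - P.cu j) +
        ∑ j, l i (Sum.inr j) * (P.Cx.toE (P.traj u (i + 1)) j - P.cx j)) := by
    rw [WL2.inner_eq_sum_of_eq_zero _ _ hl]
    refine Finset.sum_congr rfl fun i hi => ?_
    rw [h.constraint_apply, residual_congr fun j hj => hv j (hj.trans_lt (Finset.mem_range.1 hi)),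
      h.feedbackInput_deviation, PiLp.inner_apply, Fintype.sum_sum_type]
    simp [residual, mul_comm]
  rw [truncLagrangian, Finset.sum_sub_distrib, ← h3, norm_sub_sq_real, h2,
    ContinuousLinearMap.adjoint_inner_right, real_inner_comm l, inner_add_right]
  simp only [lqCost] at h1 ⊢
  linarith

/-- The unconstrained minimizer already vanishes from `T` on, so it is admissible for the horizon
`T`. In particular the primal sequence does not depend on `T`, once `l` vanishes from `T` on. -/
theorem isPrimalOf_iff {l : WL2 w (EuclideanSpace ℝ (Fin pu ⊕ Fin px))} {T : ℕ}
    (hl : ∀ i, T ≤ i → l i = 0) (u : ℕ → EuclideanSpace ℝ (Fin m)) :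
    P.IsPrimalOf Plq K l T u ↔ u = P.feedbackInput K N' P.xinit
      (ContinuousLinearMap.adjoint (h.constraintOp hw) l) := by
  set z := ContinuousLinearMap.adjoint (h.constraintOp hw) l with hz
  have hz0 : ∀ i, T ≤ i → z i = 0 := h.adjoint_apply_eq_zero hw hl
  have hval := h.truncLagrangian_eq hw hl (P.feedbackInput K N' P.xinit z) (v := z)
    (fun i _ => by rw [h.deviation_feedbackInput]) hz0
  rw [← hz, sub_self, norm_zero] at hval
  have hgen : ∀ u, ∃ v : WL2 1 (EuclideanSpace ℝ (Fin m)),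
      (∀ i < T, v i = P.feedbackDeviation K N u i) ∧ ∀ i, T ≤ i → v i = 0 := fun u =>
    ⟨WL2.mk (fun i => if i < T then P.feedbackDeviation K N u i else 0)
      (summable_of_ne_finset_zero (s := Finset.range T) fun i hi => by
        rw [if_neg fun hlt => hi (Finset.mem_range.2 hlt)]
        simp),
      fun i hi => if_pos hi, fun i hi => if_neg (not_lt.2 hi)⟩
  constructor
  · rintro ⟨hmin, htail⟩
    obtain ⟨v, hv, hvT⟩ := hgen u
    have h1 := hmin (P.feedbackInput K N' P.xinit z)
    rw [hval, h.truncLagrangian_eq hw hl u hv hvT, ← hz] at h1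
    have h2 : ‖v - z‖ ^ 2 = 0 := le_antisymm (by linarith) (sq_nonneg _)
    have h3 : v = z := sub_eq_zero.1 (norm_eq_zero.1 (pow_eq_zero_iff two_ne_zero |>.1 h2))
    rw [← h.feedbackInput_deviation u]
    congr 1
    funext i
    rcases lt_or_ge i T with hi | hi
    · rw [← hv i hi, h3]
    · rw [hz0 i hi, feedbackDeviation, ← htail i hi, sub_self, map_zero]
  · rintro rfl
    refine ⟨fun u => ?_, fun i hi => ?_⟩
    · obtain ⟨v, hv, hvT⟩ := hgen u
      rw [hval, h.truncLagrangian_eq hw hl u hv hvT, ← hz]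
      have := sq_nonneg ‖v - z‖
      linarith
    · rw [traj_feedbackInput, feedbackInput, hz0 i hi, map_zero, add_zero]

end FeedbackFactor

end Condensed

end CLQR

namespace CLQR

variable {n m px pu : ℕ} {P : CLQR n m px pu}

/-! ### The optimal primal-dual pair -/

section Optimal

variable {K : Matrix (Fin m) (Fin n) ℝ}
  {N N' : EuclideanSpace ℝ (Fin m) →L[ℝ] EuclideanSpace ℝ (Fin m)}
  {Plq : Matrix (Fin n) (Fin n) ℝ} {r : ℝ} {w : ℝ} [Fact (0 < w)]

/-- `v` is the deviation of minimal norm which satisfies the constraints, described by the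
variational inequality. -/
structure FeedbackFactor.IsMinimal (h : P.FeedbackFactor Plq K N N' r)
    (hw : AdmissibleWeight P.A w) (v : WL2 1 (EuclideanSpace ℝ (Fin m))) : Prop where
  feasible : ∀ i j, (h.constraintOp hw v + h.constraintVec hw) i j ≤ 0
  inner_nonneg : ∀ v' : WL2 1 (EuclideanSpace ℝ (Fin m)),
    (∀ i j, (h.constraintOp hw v' + h.constraintVec hw) i j ≤ 0) → 0 ≤ inner ℝ v (v' - v)

namespace FeedbackFactor

variable {h : P.FeedbackFactor Plq K N N' r} {hw : AdmissibleWeight P.A w}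

/-- The minimal deviation is the projection of the origin onto a closed convex set, which is
nonempty because the optimal value is finite. -/
theorem exists_isMinimal (h : P.FeedbackFactor Plq K N N' r) (hw : AdmissibleWeight P.A w)
    (hval : P.value ≠ ⊤) :
    (∀ j, P.Cx.toE P.xinit j ≤ P.cx j) ∧ ∃ v, h.IsMinimal hw v := by
  obtain ⟨⟨u, hu⟩, hcost⟩ : ∃ u : {u // P.Feasible u}, P.cost u.1 ≠ ⊤ := by
    by_contra! hcon
    exact hval (iInf_eq_top.2 hcon)
  refine ⟨(feasible_iff.1 hu).1, ?_⟩
  set F : Set (WL2 1 (EuclideanSpace ℝ (Fin m))) :=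
    {v | ∀ i j, (h.constraintOp hw v + h.constraintVec hw) i j ≤ 0} with hF
  have hne : F.Nonempty := ⟨h.deviation hcost, fun i j => by
    rw [h.constraint_apply, h.feedbackInput_deviation_mk]
    exact (feasible_iff.1 hu).2 i j⟩
  have hclosed : IsClosed F := by
    rw [hF]
    simp only [Set.ofPred_forall]
    refine isClosed_iInter fun i => isClosed_iInter fun j => isClosed_le ?_ continuous_const
    have h1 : Continuous fun v : WL2 1 (EuclideanSpace ℝ (Fin m)) =>
        WL2.eval i (h.constraintOp hw v + h.constraintVec hw) := by fun_prop
    exact (EuclideanSpace.proj (𝕜 := ℝ) j).continuous.comp h1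
  have hconv : Convex ℝ F := by
    intro x hx y hy a b ha hb hab i j
    have h1 : h.constraintOp hw (a • x + b • y) + h.constraintVec hw =
        a • (h.constraintOp hw x + h.constraintVec hw) +
          b • (h.constraintOp hw y + h.constraintVec hw) := by
      rw [map_add, map_smul, map_smul]
      have : h.constraintVec hw = a • h.constraintVec hw + b • h.constraintVec hw := by
        rw [← add_smul, hab, one_smul]
      conv_lhs => rw [this]
      module
    rw [h1]
    have h2 := mul_nonpos_of_nonneg_of_nonpos ha (hx i j)
    have h3 := mul_nonpos_of_nonneg_of_nonpos hb (hy i j)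
    exact add_nonpos h2 h3
  obtain ⟨v, hvF, hv⟩ := exists_norm_eq_iInf_of_complete_convex hne hclosed.isComplete hconv 0
  refine ⟨v, hvF, fun v' hv' => ?_⟩
  have h1 := (norm_eq_iInf_iff_real_inner_le_zero hconv hvF).1 hv v' hv'
  rw [zero_sub, inner_neg_left] at h1
  linarith

variable {v : WL2 1 (EuclideanSpace ℝ (Fin m))}

theorem IsMinimal.isOptimal_iff (hv : h.IsMinimal hw v)
    (h0 : ∀ j, P.Cx.toE P.xinit j ≤ P.cx j) (u : ℕ → EuclideanSpace ℝ (Fin m)) :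
    P.IsOptimal u ↔ u = P.feedbackInput K N' P.xinit v := by
  have hcost : ∀ v : WL2 1 (EuclideanSpace ℝ (Fin m)),
      P.cost (P.feedbackInput K N' P.xinit v) =
        ENNReal.ofReal (lqCost Plq P.xinit + (1 / 2) * ‖v‖ ^ 2) := fun v => by
    rw [h.cost_feedbackInput v.summable_norm_sq_one, WL2.norm_sq_eq_one]
  have hfeas : ∀ v' : WL2 1 (EuclideanSpace ℝ (Fin m)),
      P.Feasible (P.feedbackInput K N' P.xinit v') ↔
        ∀ i j, (h.constraintOp hw v' + h.constraintVec hw) i j ≤ 0 := fun v' => by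
    simp only [feasible_iff, h.constraint_apply, h0, implies_true, true_and]
  have hdist : ∀ v' : WL2 1 (EuclideanSpace ℝ (Fin m)),
      (∀ i j, (h.constraintOp hw v' + h.constraintVec hw) i j ≤ 0) →
        ‖v‖ ^ 2 + ‖v' - v‖ ^ 2 ≤ ‖v'‖ ^ 2 := fun v' hv' => by
    have h1 := hv.inner_nonneg v' hv'
    have h2 := norm_add_sq_real v (v' - v)
    rw [add_sub_cancel] at h2
    linarith
  constructor
  · rintro ⟨hu, hmin⟩
    have h1 := hmin _ ((hfeas v).2 hv.feasible)
    have hfin : P.cost u ≠ ⊤ := by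
      refine ne_top_of_le_ne_top ?_ h1
      rw [hcost]
      exact ENNReal.ofReal_ne_top
    have h2 := h.feedbackInput_deviation_mk hfin
    rw [← h2, hcost, hcost, ENNReal.ofReal_le_ofReal_iff (h.lqCost_add_nonneg _)] at h1
    rw [← h2, hfeas] at hu
    have h3 := hdist _ hu
    have h4 : ‖h.deviation hfin - v‖ ^ 2 = 0 := le_antisymm (by linarith) (sq_nonneg _)
    have h5 : h.deviation hfin = v :=
      sub_eq_zero.1 (norm_eq_zero.1 ((pow_eq_zero_iff two_ne_zero).1 h4))
    rw [← h2, h5]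
  · rintro rfl
    refine ⟨(hfeas v).2 hv.feasible, fun u hu => ?_⟩
    by_cases hfin : P.cost u = ⊤
    · rw [hfin]
      exact le_top
    · have h2 := h.feedbackInput_deviation_mk hfin
      rw [← h2, hfeas] at hu
      rw [← h2, hcost, hcost]
      refine ENNReal.ofReal_le_ofReal ?_
      have := hdist _ hu
      have := sq_nonneg ‖h.deviation hfin - v‖
      linarith

/-- Once the state is in the invariant set, switching to the LQ feedback stays feasible. Minimality
tested against the truncation gives `-‖v - trunc T v‖² ≥ 0`. -/
theorem IsMinimal.apply_eq_zero (hv : h.IsMinimal hw v) {T : ℕ}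
    (hT : P.feedbackState K N' P.xinit v T ∈ P.maxInvariantSet K) (i : ℕ) (hi : T ≤ i) :
    v i = 0 := by
  have hstate : P.feedbackState K N' P.xinit (WL2.trunc T v) T =
      P.feedbackState K N' P.xinit v T :=
    feedbackState_congr _ fun j hj => WL2.trunc_apply_of_lt hj v
  have h1 := hv.inner_nonneg (WL2.trunc T v) fun i j => by
    rw [h.constraint_apply]
    rcases lt_or_ge i T with hi | hi
    · rw [residual_congr fun k hk => WL2.trunc_apply_of_lt (hk.trans_lt hi) v,
        ← h.constraint_apply hw]
      exact hv.feasible i j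
    · exact residual_nonpos_of_mem_maxInvariantSet
        (fun k hk => WL2.trunc_apply_of_le hk v) (hstate ▸ hT) i hi j
  have h2 := WL2.inner_trunc_sub_self T v v
  have h3 : ‖v - WL2.trunc T v‖ ^ 2 = -(inner ℝ v (WL2.trunc T v - v) : ℝ) := by
    rw [← real_inner_self_eq_norm_sq, inner_sub_left, h2, sub_zero, ← inner_neg_right, neg_sub]
  have h4 : ‖v - WL2.trunc T v‖ ^ 2 = 0 := le_antisymm (by linarith) (sq_nonneg _)
  rw [sub_eq_zero.1 (norm_eq_zero.1 ((pow_eq_zero_iff two_ne_zero).1 h4)),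
    WL2.trunc_apply_of_le hi]

/-- A nonpositive multiplier which generates `v` and is complementary to its residual. -/
structure IsMultiplier (h : P.FeedbackFactor Plq K N N' r) (hw : AdmissibleWeight P.A w)
    (v : WL2 1 (EuclideanSpace ℝ (Fin m)))
    (l : WL2 w (EuclideanSpace ℝ (Fin pu ⊕ Fin px))) : Prop where
  nonpos : ∀ i j, l i j ≤ 0
  adjoint_eq : ContinuousLinearMap.adjoint (h.constraintOp hw) l = v
  complementary : (inner ℝ l (h.constraintOp hw v + h.constraintVec hw) : ℝ) = 0

/-- Only finitely many constraints precede `T`: the active ones are handled by the sign condition on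
`e`, the inactive ones by continuity. All later ones hold because the state at time `T` stays in the
invariant set under small changes. -/
theorem IsMinimal.eventually_feasible (hv : h.IsMinimal hw v) {T : ℕ}
    (hvT : ∀ i, T ≤ i → v i = 0)
    (hT : P.feedbackState K N' P.xinit v T ∈ interior (P.maxInvariantSet K))
    {e : WL2 1 (EuclideanSpace ℝ (Fin m))} (heT : ∀ i, T ≤ i → e i = 0)
    (he : ∀ i < T, ∀ j, (h.constraintOp hw v + h.constraintVec hw) i j = 0 →
      h.constraintOp hw e i j ≤ 0) :
    ∀ᶠ t : ℝ in 𝓝[>] 0,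
      ∀ i j, (h.constraintOp hw (v + t • e) + h.constraintVec hw) i j ≤ 0 := by
  have hres : ∀ (t : ℝ) i j, (h.constraintOp hw (v + t • e) + h.constraintVec hw) i j =
      (h.constraintOp hw v + h.constraintVec hw) i j + t * h.constraintOp hw e i j := by
    intro t i j
    rw [map_add, map_smul]
    simp only [WL2.add_apply, WL2.smul_apply, PiLp.add_apply, PiLp.smul_apply, smul_eq_mul]
    ring
  have h1 : ∀ᶠ t : ℝ in 𝓝[>] 0, ∀ i ∈ Finset.range T, ∀ j,
      (h.constraintOp hw (v + t • e) + h.constraintVec hw) i j ≤ 0 := by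
    rw [Filter.eventually_all_finset]
    intro i hi
    rw [Filter.eventually_all]
    intro j
    rcases (hv.feasible i j).eq_or_lt with h0 | h0
    · filter_upwards [self_mem_nhdsWithin] with t ht
      rw [hres, h0, zero_add]
      exact mul_nonpos_of_nonneg_of_nonpos (le_of_lt ht) (he i (Finset.mem_range.1 hi) j h0)
    · have h2 : Filter.Tendsto (fun t : ℝ =>
          (h.constraintOp hw v + h.constraintVec hw) i j + t * h.constraintOp hw e i j) (𝓝 0)
          (𝓝 ((h.constraintOp hw v + h.constraintVec hw) i j + 0 * h.constraintOp hw e i j)) :=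
        (Continuous.tendsto (by fun_prop) 0)
      rw [zero_mul, add_zero] at h2
      filter_upwards [(h2.mono_left nhdsWithin_le_nhds).eventually_lt_const h0] with t ht
      rw [hres]
      exact ht.le
  have h2 : ∀ᶠ t : ℝ in 𝓝[>] 0, P.feedbackState K N' P.xinit (v + t • e) T ∈
      P.maxInvariantSet K := by
    have h3 : ∀ t : ℝ, P.feedbackState K N' P.xinit (v + t • e) T =
        P.feedbackState K N' P.xinit v T + t • P.feedbackState K N' 0 e T := fun t => by
      rw [← feedbackState_smul, ← feedbackState_add, smul_zero, add_zero]
      rfl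
    have h4 : Filter.Tendsto (fun t : ℝ => P.feedbackState K N' P.xinit v T +
        t • P.feedbackState K N' 0 e T) (𝓝 0)
        (𝓝 (P.feedbackState K N' P.xinit v T + (0 : ℝ) • P.feedbackState K N' 0 e T)) :=
      (Continuous.tendsto (by fun_prop) 0)
    rw [zero_smul, add_zero] at h4
    filter_upwards [(h4.mono_left nhdsWithin_le_nhds).eventually_mem
      (mem_interior_iff_mem_nhds.1 hT)] with t ht
    rw [h3]
    exact ht
  filter_upwards [h1, h2] with t ht1 ht2 i j
  rcases lt_or_ge i T with hi | hi
  · exact ht1 i (Finset.mem_range.2 hi) j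
  · rw [h.constraint_apply]
    refine residual_nonpos_of_mem_maxInvariantSet (fun k hk => ?_) ht2 i hi j
    change v k + t • e k = 0
    rw [hvT k hk, heT k hk, smul_zero, add_zero]

theorem IsMinimal.exists_isMultiplier (hv : h.IsMinimal hw v)
    (hint : (0 : EuclideanSpace ℝ (Fin n)) ∈ interior (P.maxInvariantSet K)) :
    ∃ l, h.IsMultiplier hw v l := by
  classical
  obtain ⟨T, hT⟩ := ((h.tendsto_feedbackState v.summable_norm_sq_one).eventually_mem
    (isOpen_interior.mem_nhds hint)).exists
  have hvT : ∀ i, T ≤ i → v i = 0 := hv.apply_eq_zero (interior_subset hT)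
  set D := h.constraintOp hw
  set y := D v + h.constraintVec hw with hy
  let g : ℕ × (Fin pu ⊕ Fin px) → WL2 1 (EuclideanSpace ℝ (Fin m)) →ₗ[ℝ] ℝ := fun p =>
    { toFun := fun e => D e p.1 p.2
      map_add' := fun e e' => by simp
      map_smul' := fun c e => by simp }
  set s := (Finset.range T ×ˢ Finset.univ).filter
    fun p : ℕ × (Fin pu ⊕ Fin px) => y p.1 p.2 = 0 with hs
  obtain ⟨c, hc, hsum⟩ := exists_nonneg_combination_of_forall_le s g
    (-(innerSL ℝ v).toLinearMap) (by
      intro e he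
      have hloc : ∀ i < T, D (WL2.trunc T e) i = D e i := fun i hi =>
        h.constraintOp_congr hw fun j hj => WL2.trunc_apply_of_lt (hj.trans_lt hi) e
      -- Truncating the direction changes neither the constraint values before `T`, by causality,
      -- nor the inner product with `v`, which vanishes from `T` on.
      have h1 := hv.eventually_feasible hvT hT (e := WL2.trunc T e)
        (fun i hi => WL2.trunc_apply_of_le hi e) (fun i hi j hij => by
          have := he (i, j) (Finset.mem_filter.2
            ⟨Finset.mem_product.2 ⟨Finset.mem_range.2 hi, Finset.mem_univ j⟩, hij⟩)
          have h2 : D (WL2.trunc T e) i j = D e i j := by rw [hloc i hi]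
          exact h2.trans_le this)
      obtain ⟨t, ht, ht0⟩ := (h1.and self_mem_nhdsWithin).exists
      have h2 := hv.inner_nonneg _ ht
      rw [add_sub_cancel_left, inner_smul_right, WL2.inner_trunc,
        ← WL2.inner_eq_sum_of_eq_zero v e hvT] at h2
      have h3 : 0 ≤ (inner ℝ v e : ℝ) := nonneg_of_mul_nonneg_right h2 ht0
      simpa using h3)
  -- Dividing by `wⁱ` compensates the weight in the inner product. The sign makes the multiplier
  -- nonpositive.
  let l : WL2 w (EuclideanSpace ℝ (Fin pu ⊕ Fin px)) := WL2.mk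
    (fun i => WithLp.toLp 2 fun j => if (i, j) ∈ s then -(c (i, j) / w ^ i) else 0)
    (summable_of_ne_finset_zero (s := Finset.range T) fun i hi => by
      have : ∀ j, (i, j) ∉ s := fun j hij => hi (by
        rw [hs, Finset.mem_filter, Finset.mem_product] at hij
        exact hij.1.1)
      simp [this, EuclideanSpace.norm_eq])
  have hw0 : ∀ i : ℕ, w ^ i ≠ 0 := fun i => pow_ne_zero _ hw.pos.ne'
  have hlT : ∀ i, T ≤ i → l i = 0 := fun i hi => by
    ext j
    refine if_neg fun hij => ?_
    rw [hs, Finset.mem_filter, Finset.mem_product] at hij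
    exact absurd (Finset.mem_range.1 hij.1.1) (not_lt.2 hi)
  have hinner : ∀ z : WL2 w (EuclideanSpace ℝ (Fin pu ⊕ Fin px)),
      (inner ℝ l z : ℝ) = ∑ p ∈ s, -(c p) * z p.1 p.2 := fun z => by
    rw [WL2.inner_eq_sum_of_eq_zero _ _ hlT, hs, Finset.sum_filter, Finset.sum_product]
    refine Finset.sum_congr rfl fun i hi => ?_
    rw [PiLp.inner_apply, Finset.mul_sum]
    refine Finset.sum_congr rfl fun j _ => ?_
    have hmem : (i, j) ∈ s ↔ y i j = 0 := by
      simp [hs, Finset.mem_range.1 hi]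
    have hl : l i j = if (i, j) ∈ s then -(c (i, j) / w ^ i) else 0 := rfl
    rw [hl]
    simp only [hmem]
    split_ifs
    · have := hw0 i
      simp only [RCLike.inner_apply, conj_trivial]
      field_simp
    · simp
  refine ⟨l, fun i j => ?_, ?_, ?_⟩
  · have hl : l i j = if (i, j) ∈ s then -(c (i, j) / w ^ i) else 0 := rfl
    rw [hl]
    split_ifs
    · exact neg_nonpos.2 (div_nonneg (hc _) (pow_nonneg hw.pos.le i))
    · exact le_rfl
  · refine ext_inner_right ℝ fun e => ?_
    have h1 := LinearMap.congr_fun hsum e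
    simp only [LinearMap.neg_apply, LinearMap.sum_apply, LinearMap.smul_apply, smul_eq_mul] at h1
    rw [ContinuousLinearMap.adjoint_inner_left, hinner]
    simp only [neg_mul, Finset.sum_neg_distrib]
    rw [neg_eq_iff_eq_neg]
    exact h1.symm
  · rw [hinner]
    refine Finset.sum_eq_zero fun p hp => ?_
    have : y p.1 p.2 = 0 := (Finset.mem_filter.1 hp).2
    rw [this, mul_zero]

/-- The gradient at the multiplier is the residual of `v`, which is orthogonal to `ls` and has a
nonnegative product with every nonpositive `l`. The quadratic remainder of the exact expansion is
the squared primal error. -/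
theorem IsMultiplier.le_dualQuadratic {ls : WL2 w (EuclideanSpace ℝ (Fin pu ⊕ Fin px))}
    (hls : h.IsMultiplier hw v ls) (hv : h.IsMinimal hw v)
    {l : WL2 w (EuclideanSpace ℝ (Fin pu ⊕ Fin px))} (hl : ∀ i j, l i j ≤ 0) :
    dualQuadratic (h.constraintOp hw) (h.constraintVec hw) ls +
        (1 / 2) * ‖ContinuousLinearMap.adjoint (h.constraintOp hw) l - v‖ ^ 2 ≤
      dualQuadratic (h.constraintOp hw) (h.constraintVec hw) l := by
  rw [dualQuadratic_expand _ _ l ls, map_sub, hls.adjoint_eq, dualQuadraticGrad, hls.adjoint_eq,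
    inner_sub_right, real_inner_comm ls, hls.complementary]
  have h1 : 0 ≤ (inner ℝ (h.constraintOp hw v + h.constraintVec hw) l : ℝ) := by
    rw [WL2.inner_eq]
    refine tsum_nonneg fun i => mul_nonneg (pow_nonneg hw.pos.le i) ?_
    rw [PiLp.inner_apply]
    refine Finset.sum_nonneg fun j _ => ?_
    simp only [RCLike.inner_apply, conj_trivial]
    exact mul_nonneg_of_nonpos_of_nonpos (hl i j) (hv.feasible i j)
  linarith

end FeedbackFactor

end Optimal

end CLQR

namespace CLQR

variable {n m px pu : ℕ} {P : CLQR n m px pu}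

/-! ### The dual iterates -/

section Iterates

variable {K : Matrix (Fin m) (Fin n) ℝ}
  {N N' : EuclideanSpace ℝ (Fin m) →L[ℝ] EuclideanSpace ℝ (Fin m)}
  {Plq : Matrix (Fin n) (Fin n) ℝ} {r : ℝ} {w : ℝ} [Fact (0 < w)]

namespace FeedbackFactor

variable {hw : AdmissibleWeight P.A w} {a : ℝ} {L : ℝ≥0}

theorem isAcceleratedDescent (h : P.FeedbackFactor Plq K N N' r) (ha : 2 < a) (hL : 0 < L)
    (hLip : LipschitzWith L (gradient (P.hStar hw))) :
    IsAcceleratedDescent {l | ∀ i j, l i j ≤ 0}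
      (dualQuadratic (h.constraintOp hw) (h.constraintVec hw)) a L (P.dualIter hw a L)
      (fun k => (P.dualPair hw a L k).2) (P.dualHat hw a L) where
  convex := by
    refine convexOn_dualQuadratic _ _ fun x hx y hy a b ha hb _ i j => ?_
    exact add_nonpos (mul_nonpos_of_nonneg_of_nonpos ha (hx i j))
      (mul_nonpos_of_nonneg_of_nonpos hb (hy i j))
  two_lt := ha
  pos := hL
  mem k := by
    cases k with
    | zero => exact fun i j => le_rfl
    | succ k => exact fun i j => min_le_right _ _
  pred_zero := rfl
  pred_succ _ := rfl
  extrapolate _ := rfl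
  descent k z hz := by
    rw [h.gradient_hStar hw] at hLip
    refine dualQuadratic_descent _ _ (by exact_mod_cast hL)
      (norm_adjoint_sq_le_of_lipschitz _ _ hLip) ?_
    rw [← h.gradient_hStar hw]
    exact WL2.inner_sub_clip_nonpos _ z hz

variable {v : WL2 1 (EuclideanSpace ℝ (Fin m))}
  {ls : WL2 w (EuclideanSpace ℝ (Fin pu ⊕ Fin px))} {h : P.FeedbackFactor Plq K N N' r}

theorem IsMultiplier.isMinimizer (hls : h.IsMultiplier hw v ls) (hv : h.IsMinimal hw v) :
    ∀ z ∈ {l : WL2 w (EuclideanSpace ℝ (Fin pu ⊕ Fin px)) | ∀ i j, l i j ≤ 0},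
      dualQuadratic (h.constraintOp hw) (h.constraintVec hw) ls ≤
        dualQuadratic (h.constraintOp hw) (h.constraintVec hw) z := fun z hz => by
  have h1 := hls.le_dualQuadratic hv hz
  have := sq_nonneg ‖ContinuousLinearMap.adjoint (h.constraintOp hw) z - v‖
  linarith

theorem tendsto_adjoint_dualIter (ha : 2 < a) (hL : 0 < L)
    (hLip : LipschitzWith L (gradient (P.hStar hw))) (hv : h.IsMinimal hw v)
    (hls : h.IsMultiplier hw v ls) :
    Filter.Tendsto (fun k => ContinuousLinearMap.adjoint (h.constraintOp hw) (P.dualIter hw a L k))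
      Filter.atTop (𝓝 v) := by
  have hacc := h.isAcceleratedDescent ha hL hLip
  have h1 := hacc.tendsto_values hls.nonpos (hls.isMinimizer hv)
  have h2 : Filter.Tendsto (fun k => 2 * (dualQuadratic (h.constraintOp hw) (h.constraintVec hw)
      (P.dualIter hw a L k) - dualQuadratic (h.constraintOp hw) (h.constraintVec hw) ls))
      Filter.atTop (𝓝 0) := by
    simpa using (h1.sub_const (dualQuadratic (h.constraintOp hw) (h.constraintVec hw)
      ls)).const_mul 2
  have h3 : Filter.Tendsto (fun k => ‖ContinuousLinearMap.adjoint (h.constraintOp hw)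
      (P.dualIter hw a L k) - v‖ ^ 2) Filter.atTop (𝓝 0) :=
    squeeze_zero (fun k => sq_nonneg _) (fun k => by
      have := hls.le_dualQuadratic hv (hacc.mem k)
      linarith) h2
  rw [tendsto_iff_norm_sub_tendsto_zero]
  simpa using h3.sqrt

theorem tendsto_adjoint_dualHat (ha : 2 < a) (hL : 0 < L)
    (hLip : LipschitzWith L (gradient (P.hStar hw))) (hv : h.IsMinimal hw v)
    (hls : h.IsMultiplier hw v ls) :
    Filter.Tendsto (fun k => ContinuousLinearMap.adjoint (h.constraintOp hw) (P.dualHat hw a L k))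
      Filter.atTop (𝓝 v) := by
  have h1 := tendsto_adjoint_dualIter ha hL hLip hv hls
  have h2 : Filter.Tendsto (fun k => ContinuousLinearMap.adjoint (h.constraintOp hw)
      (P.dualPair hw a L k).2) Filter.atTop (𝓝 v) :=
    (Filter.tendsto_add_atTop_iff_nat 1).1 h1
  have h3 : Filter.Tendsto (fun k => alpha a k • (ContinuousLinearMap.adjoint (h.constraintOp hw)
      (P.dualIter hw a L k) - ContinuousLinearMap.adjoint (h.constraintOp hw)
      (P.dualPair hw a L k).2)) Filter.atTop (𝓝 0) := by
    have h4 := (h1.sub h2).norm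
    rw [sub_self, norm_zero] at h4
    refine squeeze_zero_norm (fun k => ?_) h4
    obtain ⟨hα0, hα1⟩ := IsAcceleratedDescent.alpha_bounds ha k
    rw [norm_smul, Real.norm_of_nonneg hα0]
    exact mul_le_of_le_one_left (norm_nonneg _) hα1
  have h5 := h1.add h3
  rw [add_zero] at h5
  refine h5.congr fun k => ?_
  rw [dualHat, map_add, map_smul, map_sub]

/-! ### The horizons -/

/-- A constant independent of time is the point, since the evaluations on the weighted space are not
uniformly bounded. Each trajectory tends to zero and is thus bounded, so Banach–Steinhaus applies.
-/
theorem exists_norm_feedbackState_sub_le (h : P.FeedbackFactor Plq K N N' r)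
    (hw : AdmissibleWeight P.A w) :
    ∃ κ : ℝ, ∀ (v v' : WL2 1 (EuclideanSpace ℝ (Fin m))) (i : ℕ),
      ‖P.feedbackState K N' P.xinit v (i + 1) - P.feedbackState K N' P.xinit v' (i + 1)‖ ≤
        κ * ‖v - v'‖ := by
  let g : ℕ → WL2 1 (EuclideanSpace ℝ (Fin m)) →L[ℝ] EuclideanSpace ℝ (Fin n) := fun i =>
    WL2.eval i ∘L P.opB hw ∘L h.inputOp hw
  have hg : ∀ (v v' : WL2 1 (EuclideanSpace ℝ (Fin m))) i, g i (v - v') =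
      P.feedbackState K N' P.xinit v (i + 1) - P.feedbackState K N' P.xinit v' (i + 1) := by
    intro v v' i
    have hstate : ∀ v : WL2 1 (EuclideanSpace ℝ (Fin m)),
        P.feedbackState K N' P.xinit v (i + 1) =
          P.stateSeq hw (h.lqInput hw + h.inputOp hw v) i := fun v => by
      rw [P.stateSeq_apply, h.lqInput_add_inputOp, traj_feedbackInput]
    rw [hstate, hstate, map_sub, stateSeq, stateSeq, map_add, map_add]
    change P.opB hw (h.inputOp hw v) i - P.opB hw (h.inputOp hw v') i = _
    simp only [WL2.add_apply]
    abel
  obtain ⟨κ, hκ⟩ := banach_steinhaus (g := g) fun v => by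
    have h1 : Filter.Tendsto (fun i => ‖g i v‖) Filter.atTop (𝓝 0) := by
      have hz : ∀ v : WL2 1 (EuclideanSpace ℝ (Fin m)), Filter.Tendsto
          (fun i => P.feedbackState K N' P.xinit v (i + 1)) Filter.atTop (𝓝 0) := fun v =>
        (Filter.tendsto_add_atTop_iff_nat 1).2 (h.tendsto_feedbackState v.summable_norm_sq_one)
      have h2 := ((hz v).sub (hz 0)).norm
      rw [sub_self, norm_zero] at h2
      refine h2.congr fun i => ?_
      rw [← hg, sub_zero]
    obtain ⟨b, hb⟩ := h1.bddAbove_range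
    exact ⟨b, fun i => hb ⟨i, rfl⟩⟩
  refine ⟨κ, fun v v' i => ?_⟩
  rw [← hg]
  exact (g i).le_of_opNorm_le (hκ i) _

variable {S : Set (EuclideanSpace ℝ (Fin n))} {cmp : ℝ → ℝ → Prop}

/-- A neighborhood of the origin within the target set on which the constraints hold with the
chosen inequality. -/
theorem exists_mem_nhds_forall_cmp (hS : S ⊆ P.maxInvariantSet K)
    (hS0 : (0 : EuclideanSpace ℝ (Fin n)) ∈ interior S)
    (hcmp : cmp = (· ≤ ·) ∨ (cmp = (· < ·) ∧ (∀ j, 0 < P.cx j) ∧ ∀ j, 0 < P.cu j)) :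
    ∃ W ∈ 𝓝 (0 : EuclideanSpace ℝ (Fin n)), ∀ x ∈ W, x ∈ S ∧
      (∀ j, cmp (P.Cx.toE (P.A.toE x + P.B.toE (K.toE x)) j) (P.cx j)) ∧
      ∀ j, cmp (P.Cu.toE (K.toE x) j) (P.cu j) := by
  have hS' := mem_interior_iff_mem_nhds.1 hS0
  rcases hcmp with rfl | ⟨rfl, hcx, hcu⟩
  · refine ⟨S, hS', fun x hx => ⟨hx, fun j => ?_, fun j => ?_⟩⟩
    · have h1 := (hS hx 1).1 j
      rwa [pow_one, Matrix.toE_add, Matrix.toE_mul] at h1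
    · have h1 := (hS hx 0).2 j
      rwa [pow_zero, Matrix.toE_one] at h1
  · have h1 : ∀ᶠ x in 𝓝 (0 : EuclideanSpace ℝ (Fin n)),
        ∀ j, P.Cx.toE (P.A.toE x + P.B.toE (K.toE x)) j < P.cx j :=
      Filter.eventually_all.2 fun j => by
        have hc : Continuous fun x : EuclideanSpace ℝ (Fin n) =>
            P.Cx.toE (P.A.toE x + P.B.toE (K.toE x)) j := by fun_prop
        exact (hc.tendsto 0).eventually_lt_const (by simpa using hcx j)
    have h2 : ∀ᶠ x in 𝓝 (0 : EuclideanSpace ℝ (Fin n)), ∀ j, P.Cu.toE (K.toE x) j < P.cu j :=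
      Filter.eventually_all.2 fun j => by
        have hc : Continuous fun x : EuclideanSpace ℝ (Fin n) => P.Cu.toE (K.toE x) j := by
          fun_prop
        exact (hc.tendsto 0).eventually_lt_const (by simpa using hcu j)
    exact ⟨_, Filter.inter_mem hS' (h1.and h2), fun x hx => ⟨hx.1, hx.2.1, hx.2.2⟩⟩

/-- The choice `TS = T'` suffices: the deviation is already zero, so the next state is the LQ
successor, whose constraints are part of the description of `W`. -/
theorem mem_horizonCandidates (h : P.FeedbackFactor Plq K N N' r) (hw : AdmissibleWeight P.A w)
    {W : Set (EuclideanSpace ℝ (Fin n))}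
    (hW : ∀ x ∈ W, x ∈ S ∧
      (∀ j, cmp (P.Cx.toE (P.A.toE x + P.B.toE (K.toE x)) j) (P.cx j)) ∧
      ∀ j, cmp (P.Cu.toE (K.toE x) j) (P.cu j))
    {l : WL2 w (EuclideanSpace ℝ (Fin pu ⊕ Fin px))} {T T' : ℕ} (hl : ∀ i, T ≤ i → l i = 0)
    (hTT' : T ≤ T') (hx : P.feedbackState K N' P.xinit
      (ContinuousLinearMap.adjoint (h.constraintOp hw) l) T' ∈ W) :
    T' ∈ P.horizonCandidates cmp Plq K S l T := by
  have hv := h.adjoint_apply_eq_zero hw hl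
  obtain ⟨h1, h2, h3⟩ := hW _ hx
  refine ⟨hTT', _, (h.isPrimalOf_iff hw hl _).2 rfl, T', le_rfl, ?_, fun i hi hi' => ?_⟩
  · rwa [traj_feedbackInput]
  · obtain rfl : i = T' := le_antisymm hi' hi
    rw [traj_feedbackInput, feedbackState, feedbackInput, hv i hTT', map_zero, add_zero]
    exact ⟨h2, h3⟩

/-- From `T'` on, the block of the extrapolated multiplier is zero and the gradient block is the
residual of its primal sequence. This is nonpositive up to `TS` by the candidate condition and
afterwards by invariance. The gradient step is then nonnegative and is clipped to zero. -/
theorem dualIter_succ_apply_eq_zero (h : P.FeedbackFactor Plq K N N' r)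
    (hw : AdmissibleWeight P.A w) (hS : S ⊆ P.maxInvariantSet K)
    (hle : ∀ x y, cmp x y → x ≤ y) {k T T' : ℕ}
    (hl : ∀ i, T ≤ i → P.dualHat hw a L k i = 0)
    (hT' : T' ∈ P.horizonCandidates cmp Plq K S (P.dualHat hw a L k) T) (i : ℕ) (hi : T' ≤ i) :
    P.dualIter hw a L (k + 1) i = 0 := by
  obtain ⟨hTT', u, hu, TS, hTS, hmem, hcons⟩ := hT'
  rw [h.isPrimalOf_iff hw hl] at hu
  have hv := h.adjoint_apply_eq_zero hw hl
  have hres : ∀ j, P.residual u i j ≤ 0 := fun j => by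
    rcases le_or_gt i TS with h1 | h1
    · obtain ⟨h2, h3⟩ := hcons i hi h1
      rcases j with j | j
      · exact sub_nonpos.2 (hle _ _ (h3 j))
      · exact sub_nonpos.2 (hle _ _ (h2 j))
    · subst hu
      rw [traj_feedbackInput] at hmem
      exact residual_nonpos_of_mem_maxInvariantSet
        (fun k hk => hv k ((hTT'.trans hTS).trans hk)) (hS hmem) i h1.le j
  ext j
  change min ((P.dualHat hw a L k - (1 / (L : ℝ)) • gradient (P.hStar hw) (P.dualHat hw a L k)) i j)
    0 = 0
  rw [h.gradient_hStar hw, dualQuadraticGrad, WL2.sub_apply, WL2.smul_apply, h.constraint_apply,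
    hl i (hTT'.trans hi), ← hu]
  refine min_eq_right ?_
  have h1 : 0 ≤ 1 / (L : ℝ) := by positivity
  have h2 := mul_nonpos_of_nonneg_of_nonpos h1 (hres j)
  change 0 ≤ 0 - 1 / (L : ℝ) * P.residual u i j
  linarith

variable {W : Set (EuclideanSpace ℝ (Fin n))}

theorem horizonCandidates_nonempty (h : P.FeedbackFactor Plq K N N' r)
    (hw : AdmissibleWeight P.A w) (hW0 : W ∈ 𝓝 (0 : EuclideanSpace ℝ (Fin n)))
    (hW : ∀ x ∈ W, x ∈ S ∧
      (∀ j, cmp (P.Cx.toE (P.A.toE x + P.B.toE (K.toE x)) j) (P.cx j)) ∧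
      ∀ j, cmp (P.Cu.toE (K.toE x) j) (P.cu j))
    {l : WL2 w (EuclideanSpace ℝ (Fin pu ⊕ Fin px))} {T : ℕ} (hl : ∀ i, T ≤ i → l i = 0) :
    (P.horizonCandidates cmp Plq K S l T).Nonempty := by
  obtain ⟨T', hT', hx⟩ := ((Filter.eventually_ge_atTop T).and ((h.tendsto_feedbackState
    (ContinuousLinearMap.adjoint (h.constraintOp hw) l).summable_norm_sq_one).eventually_mem
    hW0)).exists
  exact ⟨T', h.mem_horizonCandidates hw hW hl hT' hx⟩

theorem dualIter_apply_eq_zero (h : P.FeedbackFactor Plq K N N' r)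
    (hw : AdmissibleWeight P.A w) (hS : S ⊆ P.maxInvariantSet K)
    (hle : ∀ x y, cmp x y → x ≤ y) (hW0 : W ∈ 𝓝 (0 : EuclideanSpace ℝ (Fin n)))
    (hW : ∀ x ∈ W, x ∈ S ∧
      (∀ j, cmp (P.Cx.toE (P.A.toE x + P.B.toE (K.toE x)) j) (P.cx j)) ∧
      ∀ j, cmp (P.Cu.toE (K.toE x) j) (P.cu j)) (k : ℕ) :
    ∀ i, P.horizon cmp Plq K S hw a L k ≤ i →
      P.dualIter hw a L k i = 0 ∧ P.dualHat hw a L k i = 0 := by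
  have hhat : ∀ k i, P.dualIter hw a L k i = 0 → (P.dualPair hw a L k).2 i = 0 →
      P.dualHat hw a L k i = 0 := fun k i h1 h2 => by
    rw [dualHat, WL2.add_apply, WL2.smul_apply, WL2.sub_apply, h1, h2, sub_self, smul_zero,
      add_zero]
  induction k with
  | zero => exact fun i _ => ⟨rfl, hhat 0 i rfl rfl⟩
  | succ k ih =>
    intro i hi
    have hl : ∀ i, P.horizon cmp Plq K S hw a L k ≤ i → P.dualHat hw a L k i = 0 :=
      fun i hi => (ih i hi).2
    have hmem : P.horizon cmp Plq K S hw a L (k + 1) ∈ _ :=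
      Nat.sInf_mem (h.horizonCandidates_nonempty hw hW0 hW hl)
    have h1 := h.dualIter_succ_apply_eq_zero hw hS hle hl hmem i hi
    exact ⟨h1, hhat (k + 1) i h1 (ih i (hmem.1.trans hi)).1⟩

/-- The extrapolated deviations converge to `v`, and the states follow uniformly in time. For `k ≥
k₀` every state from time `i₀ + 1` on lies in `W`, so `max Tᵏ (i₀ + 1)` is a candidate and the next
horizon cannot exceed it. -/
theorem bddAbove_range_horizon (ha : 2 < a) (hL : 0 < L)
    (hLip : LipschitzWith L (gradient (P.hStar hw))) (hv : h.IsMinimal hw v)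
    (hls : h.IsMultiplier hw v ls) (hS : S ⊆ P.maxInvariantSet K)
    (hle : ∀ x y, cmp x y → x ≤ y) (hW0 : W ∈ 𝓝 (0 : EuclideanSpace ℝ (Fin n)))
    (hW : ∀ x ∈ W, x ∈ S ∧
      (∀ j, cmp (P.Cx.toE (P.A.toE x + P.B.toE (K.toE x)) j) (P.cx j)) ∧
      ∀ j, cmp (P.Cu.toE (K.toE x) j) (P.cu j)) :
    BddAbove (Set.range (P.horizon cmp Plq K S hw a L)) := by
  have hl := fun k i hi =>
    (h.dualIter_apply_eq_zero (a := a) (L := L) (cmp := cmp) hw hS hle hW0 hW k i hi).2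
  have hmono : Monotone (P.horizon cmp Plq K S hw a L) := monotone_nat_of_le_succ fun k =>
    (Nat.sInf_mem (h.horizonCandidates_nonempty hw hW0 hW (hl k))).1
  obtain ⟨ε, hε, hball⟩ := Metric.mem_nhds_iff.1 hW0
  obtain ⟨κ, hκ⟩ := h.exists_norm_feedbackState_sub_le hw
  have h0 := ((Filter.tendsto_add_atTop_iff_nat 1).2
    (h.tendsto_feedbackState v.summable_norm_sq_one)).norm
  rw [norm_zero] at h0
  obtain ⟨i₀, hi₀⟩ := Filter.eventually_atTop.1 (h0.eventually_lt_const (half_pos hε))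
  have h1 : Filter.Tendsto (fun k => κ * ‖ContinuousLinearMap.adjoint (h.constraintOp hw)
      (P.dualHat hw a L k) - v‖) Filter.atTop (𝓝 0) := by
    simpa using (tendsto_iff_norm_sub_tendsto_zero.1
      (tendsto_adjoint_dualHat ha hL hLip hv hls)).const_mul κ
  obtain ⟨k₀, hk₀⟩ := Filter.eventually_atTop.1 (h1.eventually_lt_const (half_pos hε))
  have hW' : ∀ k, k₀ ≤ k → ∀ i, i₀ + 1 ≤ i → P.feedbackState K N' P.xinit
      (ContinuousLinearMap.adjoint (h.constraintOp hw) (P.dualHat hw a L k)) i ∈ W := by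
    intro k hk i hi
    obtain ⟨i, rfl⟩ : ∃ i', i = i' + 1 := ⟨i - 1, by omega⟩
    refine hball (mem_ball_zero_iff.2 ?_)
    have h2 := hκ (ContinuousLinearMap.adjoint (h.constraintOp hw) (P.dualHat hw a L k)) v i
    have h3 := hk₀ k hk
    have h4 := hi₀ i (by omega)
    have h5 := norm_le_norm_sub_add (P.feedbackState K N' P.xinit
      (ContinuousLinearMap.adjoint (h.constraintOp hw) (P.dualHat hw a L k)) (i + 1))
      (P.feedbackState K N' P.xinit v (i + 1))
    linarith
  refine ⟨max (P.horizon cmp Plq K S hw a L k₀) (i₀ + 1), ?_⟩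
  rintro _ ⟨k, rfl⟩
  rcases le_total k k₀ with hk | hk
  · exact (hmono hk).trans (le_max_left _ _)
  · induction k, hk using Nat.le_induction with
    | base => exact le_max_left _ _
    | succ k hk ih =>
      refine (Nat.sInf_le (h.mem_horizonCandidates hw hW (hl k)
        (le_max_left _ (i₀ + 1)) (hW' k hk _ (le_max_right _ _)))).trans ?_
      exact max_le ih (le_max_right _ _)

end FeedbackFactor

end Iterates

end CLQR

namespace CLQR

variable {n m px pu : ℕ} {P : CLQR n m px pu}

/-! ### Convergence -/

section Convergence

variable {K : Matrix (Fin m) (Fin n) ℝ}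
  {N N' : EuclideanSpace ℝ (Fin m) →L[ℝ] EuclideanSpace ℝ (Fin m)}
  {Plq : Matrix (Fin n) (Fin n) ℝ} {r : ℝ} {w : ℝ} [Fact (0 < w)]

namespace FeedbackFactor

variable {hw : AdmissibleWeight P.A w} {a : ℝ} {L : ℝ≥0}

theorem dualObjective_eq (h : P.FeedbackFactor Plq K N N' r) (hw : AdmissibleWeight P.A w)
    {l : WL2 w (EuclideanSpace ℝ (Fin pu ⊕ Fin px))} (hl : ∀ i j, l i j ≤ 0) :
    P.dualObjective hw l = ((dualQuadratic (h.constraintOp hw) (h.constraintVec hw) l -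
      lqCost Plq P.xinit : ℝ) : EReal) := by
  rw [dualObjective, if_pos hl, h.hStarE_eq hw]

theorem isDualOptimal_iff (h : P.FeedbackFactor Plq K N N' r) (hw : AdmissibleWeight P.A w)
    (l : WL2 w (EuclideanSpace ℝ (Fin pu ⊕ Fin px))) :
    P.IsDualOptimal hw l ↔ (∀ i j, l i j ≤ 0) ∧ ∀ z, (∀ i j, z i j ≤ 0) →
      dualQuadratic (h.constraintOp hw) (h.constraintVec hw) l ≤
        dualQuadratic (h.constraintOp hw) (h.constraintVec hw) z := by
  constructor
  · intro hopt
    have hl : ∀ i j, l i j ≤ 0 := by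
      by_contra hcon
      have h1 := hopt 0
      rw [h.dualObjective_eq hw (l := 0) fun i j => le_rfl, dualObjective, if_neg hcon] at h1
      exact EReal.coe_ne_top _ (top_le_iff.1 h1)
    refine ⟨hl, fun z hz => ?_⟩
    have h1 := hopt z
    rw [h.dualObjective_eq hw hl, h.dualObjective_eq hw hz, EReal.coe_le_coe_iff] at h1
    linarith
  · rintro ⟨hl, hmin⟩ z
    by_cases hz : ∀ i j, z i j ≤ 0
    · rw [h.dualObjective_eq hw hl, h.dualObjective_eq hw hz, EReal.coe_le_coe_iff]
      linarith [hmin z hz]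
    · rw [dualObjective, dualObjective, if_neg hz]
      exact le_top

variable {v : WL2 1 (EuclideanSpace ℝ (Fin m))}
  {ls l : WL2 w (EuclideanSpace ℝ (Fin pu ⊕ Fin px))} {h : P.FeedbackFactor Plq K N N' r}

theorem IsMultiplier.isDualOptimal (hls : h.IsMultiplier hw v ls) (hv : h.IsMinimal hw v) :
    P.IsDualOptimal hw ls :=
  (h.isDualOptimal_iff hw ls).2 ⟨hls.nonpos, hls.isMinimizer hv⟩

/-- Complementarity gives `⟨ls, d⟩ = -‖v‖²`. Up to the constant this is strong duality. -/
theorem IsMultiplier.dualQuadratic_eq (hls : h.IsMultiplier hw v ls) :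
    dualQuadratic (h.constraintOp hw) (h.constraintVec hw) ls = -(1 / 2) * ‖v‖ ^ 2 := by
  have h1 := hls.complementary
  rw [inner_add_right, ← ContinuousLinearMap.adjoint_inner_left, hls.adjoint_eq,
    real_inner_self_eq_norm_sq] at h1
  rw [dualQuadratic, hls.adjoint_eq]
  linarith

theorem IsMultiplier.dualQuadratic_eq_of_isDualOptimal (hls : h.IsMultiplier hw v ls)
    (hv : h.IsMinimal hw v) (hl : P.IsDualOptimal hw l) :
    dualQuadratic (h.constraintOp hw) (h.constraintVec hw) l =
      dualQuadratic (h.constraintOp hw) (h.constraintVec hw) ls := by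
  obtain ⟨h1, h2⟩ := (h.isDualOptimal_iff hw l).1 hl
  exact le_antisymm (h2 _ hls.nonpos) (hls.isMinimizer hv _ h1)

theorem IsMultiplier.adjoint_eq_of_isDualOptimal (hls : h.IsMultiplier hw v ls)
    (hv : h.IsMinimal hw v) (hl : P.IsDualOptimal hw l) :
    ContinuousLinearMap.adjoint (h.constraintOp hw) l = v := by
  have h1 := hls.le_dualQuadratic hv ((h.isDualOptimal_iff hw l).1 hl).1
  rw [hls.dualQuadratic_eq_of_isDualOptimal hv hl] at h1
  have h2 : ‖ContinuousLinearMap.adjoint (h.constraintOp hw) l - v‖ ^ 2 = 0 :=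
    le_antisymm (by linarith) (sq_nonneg _)
  exact sub_eq_zero.1 (norm_eq_zero.1 ((pow_eq_zero_iff two_ne_zero).1 h2))

theorem dualQuadratic_dualIter_le (ha : 2 < a) (hL : 0 < L)
    (hLip : LipschitzWith L (gradient (P.hStar hw))) (hv : h.IsMinimal hw v)
    (hls : h.IsMultiplier hw v ls) (hl : P.IsDualOptimal hw l) (k : ℕ) :
    dualQuadratic (h.constraintOp hw) (h.constraintVec hw) (P.dualIter hw a L k) -
        dualQuadratic (h.constraintOp hw) (h.constraintVec hw) l ≤
      a ^ 2 * L / (2 * (k + a - 1) ^ 2) * ‖P.dualIter hw a L 0 - l‖ ^ 2 := by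
  cases k with
  | zero =>
    have h0 : P.dualIter hw a L 0 = 0 := rfl
    rw [hls.dualQuadratic_eq_of_isDualOptimal hv hl, hls.dualQuadratic_eq, h0, zero_sub, norm_neg,
      ← hls.adjoint_eq_of_isDualOptimal hv hl]
    rw [h.gradient_hStar hw] at hLip
    have h1 := norm_adjoint_sq_le_of_lipschitz _ _ hLip l
    -- The accelerated rate starts at index one. At index zero the gap is `½ ‖D⋆ l‖² ≤ (L / 2)
    -- ‖l‖²`, and `(a - 1)² ≤ a²` brings this below the claimed bound.
    have h2 : (L : ℝ) / 2 ≤ a ^ 2 * L / (2 * (((0 : ℕ) : ℝ) + a - 1) ^ 2) := by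
      have h3 : 0 < a - 1 := by linarith
      rw [Nat.cast_zero, zero_add, div_le_div_iff₀ two_pos (by positivity)]
      have h4 : (a - 1) ^ 2 ≤ a ^ 2 := by nlinarith
      nlinarith [mul_le_mul_of_nonneg_left h4 L.2]
    have h5 := mul_le_mul_of_nonneg_right h2 (sq_nonneg ‖l‖)
    have h6 : dualQuadratic (h.constraintOp hw) (h.constraintVec hw) 0 = 0 := by
      simp [dualQuadratic]
    rw [h6]
    linarith
  | succ k =>
    obtain ⟨h1, h2⟩ := (h.isDualOptimal_iff hw l).1 hl
    exact (h.isAcceleratedDescent ha hL hLip).rate h1 h2 k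

/-- Opial's lemma needs minimality of the weak cluster points. The orthant is weakly closed by the
projection inequality, and convexity bounds the values from below by the affine expansion at the
cluster point. -/
theorem exists_weak_limit (ha : 2 < a) (hL : 0 < L)
    (hLip : LipschitzWith L (gradient (P.hStar hw))) (hl : P.IsDualOptimal hw l)
    (h : P.FeedbackFactor Plq K N N' r) :
    ∃ z, P.IsDualOptimal hw z ∧ ∀ y, Filter.Tendsto
      (fun k => (inner ℝ y (P.dualIter hw a L k) : ℝ)) Filter.atTop (𝓝 (inner ℝ y z)) := by
  have hacc := h.isAcceleratedDescent ha hL hLip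
  obtain ⟨hl1, hl2⟩ := (h.isDualOptimal_iff hw l).1 hl
  refine exists_weak_limit_of_opial (S := {z | P.IsDualOptimal hw z}) ⟨l, hl⟩
    (fun s hs => ?_) fun U z hU hz => ?_
  · obtain ⟨hs1, hs2⟩ := (h.isDualOptimal_iff hw s).1 hs
    exact hacc.exists_tendsto_dist hs1 hs2
  · refine (h.isDualOptimal_iff hw z).2 ⟨?_, fun y hy => ?_⟩
    · have h1 : (inner ℝ (z - WL2.clip z) (z - WL2.clip z) : ℝ) ≤ 0 := by
        have h2 := (hz (z - WL2.clip z)).sub_const (inner ℝ (z - WL2.clip z) (WL2.clip z))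
        rw [← inner_sub_right] at h2
        refine le_of_tendsto h2 (Filter.Eventually.of_forall fun k => ?_)
        rw [← inner_sub_right]
        exact WL2.inner_sub_clip_nonpos z _ (hacc.mem k)
      have h3 : z = WL2.clip z :=
        sub_eq_zero.1 (inner_self_eq_zero.1 (le_antisymm h1 real_inner_self_nonneg))
      intro i j
      rw [h3]
      exact min_le_right _ _
    · have h1 := (hacc.tendsto_values hl1 hl2).mono_left hU
      have h2 := ((hz (dualQuadraticGrad (h.constraintOp hw) (h.constraintVec hw) z)).sub_const
        (inner ℝ (dualQuadraticGrad (h.constraintOp hw) (h.constraintVec hw) z) z)).const_add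
        (dualQuadratic (h.constraintOp hw) (h.constraintVec hw) z)
      rw [sub_self, add_zero] at h2
      refine (le_of_tendsto_of_tendsto h2 h1 (Filter.Eventually.of_forall fun k => ?_)).trans
        (hl2 y hy)
      simp only
      rw [dualQuadratic_expand _ _ (P.dualIter hw a L k) z, inner_sub_right]
      have := sq_nonneg ‖ContinuousLinearMap.adjoint (h.constraintOp hw)
        (P.dualIter hw a L k - z)‖
      linarith

/-- The modulus bounds the input error by the deviation error, whose square is at most twice the
dual gap. The factor `2` cancels the one in the dual rate. -/
theorem norm_inputOp_sub_le (ha : 2 < a) (hL : 0 < L)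
    (hLip : LipschitzWith L (gradient (P.hStar hw))) (hv : h.IsMinimal hw v)
    (hls : h.IsMultiplier hw v ls) {μ : ℝ} (hμ : 0 < μ) (hmod : P.IsStrongConvexityModulus w μ)
    (hl : P.IsDualOptimal hw l) (k : ℕ) :
    ‖h.inputOp hw (ContinuousLinearMap.adjoint (h.constraintOp hw) (P.dualIter hw a L k) - v)‖ ≤
      a * √(L / μ) * (‖P.dualIter hw a L 0 - l‖ / (k + a - 1)) := by
  have hk : (0 : ℝ) ≤ k := Nat.cast_nonneg k
  have h0 : 0 < (k : ℝ) + a - 1 := by linarith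
  have ha0 : 0 ≤ a := by linarith
  refine le_of_sq_le_sq ?_ (by positivity)
  have h1 := h.norm_inputOp_sq_le hw hmod
    (ContinuousLinearMap.adjoint (h.constraintOp hw) (P.dualIter hw a L k) - v)
  have h2 := hls.le_dualQuadratic hv ((h.isAcceleratedDescent ha hL hLip).mem k)
  rw [← hls.dualQuadratic_eq_of_isDualOptimal hv hl] at h2
  have h3 := dualQuadratic_dualIter_le ha hL hLip hv hls hl k
  rw [mul_pow, mul_pow, Real.sq_sqrt (by positivity), div_pow]
  have h4 : a ^ 2 * (L / μ) * (‖P.dualIter hw a L 0 - l‖ ^ 2 / (k + a - 1) ^ 2) =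
      μ⁻¹ * (2 * (a ^ 2 * L / (2 * (k + a - 1) ^ 2) * ‖P.dualIter hw a L 0 - l‖ ^ 2)) := by
    field_simp
  rw [h4, le_inv_mul_iff₀ hμ]
  linarith

end FeedbackFactor

end Convergence

end CLQR

/-! ### Assembly of the theorem -/

theorem theorem1 {n m px pu : ℕ} (P : CLQR n m px pu)
    -- the standing assumptions
    (hP : P.StandingAssumption) (hdet : Detectable P.A P.Q)
    -- the unconstrained LQ controller
    (Plq : Matrix (Fin n) (Fin n) ℝ) (K : Matrix (Fin m) (Fin n) ℝ) (hLQ : P.IsLQSolution Plq K)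
    -- the target set
    (S : Set (EuclideanSpace ℝ (Fin n))) (hS : S ⊆ P.maxInvariantSet K)
    (hS0 : (0 : EuclideanSpace ℝ (Fin n)) ∈ interior S)
    -- the inequality used in the determination of the horizons
    (cmp : ℝ → ℝ → Prop)
    (hcmp : cmp = (· ≤ ·) ∨ (cmp = (· < ·) ∧ (∀ j, 0 < P.cx j) ∧ ∀ j, 0 < P.cu j))
    -- the weight, the parameters of the iteration, and the strong convexity modulus
    (w : ℝ) [Fact (0 < w)] (hw : AdmissibleWeight P.A w) (a : ℝ) (ha : 2 < a)
    (L : ℝ≥0) (hL : 0 < L) (hLip : LipschitzWith L (gradient (P.hStar hw)))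
    (μ : ℝ) (hμ : 0 < μ) (hmod : P.IsStrongConvexityModulus w μ) :
    -- `h⋆` is finite and differentiable everywhere
    (∀ l, P.hStarE hw l ≠ ⊤ ∧ P.hStarE hw l ≠ ⊥) ∧ Differentiable ℝ (P.hStar hw) ∧
    -- (i)
    (∀ lInf, P.IsDualOptimal hw lInf → ∀ k : ℕ,
      P.dualObjective hw (P.dualIter hw a L k) ≤ P.dualObjective hw lInf +
        ((a ^ 2 * L / (2 * (k + a - 1) ^ 2) * ‖P.dualIter hw a L 0 - lInf‖ ^ 2 : ℝ) : EReal)) ∧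
    -- (ii)
    (∃ lInf, P.IsDualOptimal hw lInf ∧ ∀ y, Filter.Tendsto
      (fun k => (inner ℝ y (P.dualIter hw a L k) : ℝ)) Filter.atTop (𝓝 (inner ℝ y lInf))) ∧
    -- (iii) and (iv)
    (∃ (uSeq : ℕ → WL2 w (EuclideanSpace ℝ (Fin m))) (uInf : WL2 w (EuclideanSpace ℝ (Fin m))),
      (∀ (k : ℕ) (v : ℕ → EuclideanSpace ℝ (Fin m)),
        P.IsPrimalOf Plq K (P.dualIter hw a L k) (P.horizon cmp Plq K S hw a L k) v ↔
          v = uSeq k) ∧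
      (∀ v : ℕ → EuclideanSpace ℝ (Fin m), P.IsOptimal v ↔ v = uInf) ∧
      Filter.Tendsto uSeq Filter.atTop (𝓝 uInf) ∧
      Filter.Tendsto (fun k => P.stateSeq hw (uSeq k)) Filter.atTop (𝓝 (P.stateSeq hw uInf)) ∧
      ∀ lInf, P.IsDualOptimal hw lInf → ∀ k : ℕ,
        ‖uSeq k - uInf‖ ≤
          a * √(L / μ) * (‖P.dualIter hw a L 0 - lInf‖ / (k + a - 1)) ∧
        ‖P.stateSeq hw (uSeq k) - P.stateSeq hw uInf‖ ≤
          a * √(‖P.opB hw‖ ^ 2 * L / μ) * (‖P.dualIter hw a L 0 - lInf‖ / (k + a - 1))) ∧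
    -- (v)
    (∀ k, (P.horizonCandidates cmp Plq K S (P.dualHat hw a L k)
        (P.horizon cmp Plq K S hw a L k)).Nonempty) ∧
      (∀ k i, P.horizon cmp Plq K S hw a L k ≤ i →
        P.dualIter hw a L k i = 0 ∧ P.dualHat hw a L k i = 0) ∧
      BddAbove (Set.range (P.horizon cmp Plq K S hw a L)) := by
  obtain ⟨N, N', r, h⟩ := hLQ.exists_feedbackFactor hP.Q_psd hP.R_posDef hdet
  obtain ⟨hx0, v, hv⟩ := h.exists_isMinimal hw hP.value_finite
  obtain ⟨ls, hls⟩ := hv.exists_isMultiplier (interior_mono hS hS0)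
  obtain ⟨W, hW0, hW⟩ := CLQR.FeedbackFactor.exists_mem_nhds_forall_cmp hS hS0 hcmp
  have hle : ∀ x y, cmp x y → x ≤ y := by
    rcases hcmp with rfl | ⟨rfl, -⟩
    · exact fun _ _ => id
    · exact fun _ _ => le_of_lt
  have hzero := h.dualIter_apply_eq_zero (a := a) (L := L) hw hS hle hW0 hW
  have htendsto := CLQR.FeedbackFactor.tendsto_adjoint_dualIter ha hL hLip hv hls
  refine ⟨fun l => ?_, fun l => (h.hasGradientAt_hStar hw l).differentiableAt,
    fun lInf hlInf k => ?_,
    CLQR.FeedbackFactor.exists_weak_limit ha hL hLip (hls.isDualOptimal hv) h,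
    ⟨fun k => h.lqInput hw + h.inputOp hw
        (ContinuousLinearMap.adjoint (h.constraintOp hw) (P.dualIter hw a L k)),
      h.lqInput hw + h.inputOp hw v, fun k u => ?_, fun u => ?_, ?_, ?_,
      fun lInf hlInf k => ?_⟩,
    fun k => h.horizonCandidates_nonempty hw hW0 hW fun i hi => (hzero k i hi).2, hzero,
    CLQR.FeedbackFactor.bddAbove_range_horizon ha hL hLip hv hls hS hle hW0 hW⟩
  · rw [h.hStarE_eq hw]
    exact ⟨EReal.coe_ne_top _, EReal.coe_ne_bot _⟩
  · rw [h.dualObjective_eq hw ((h.isAcceleratedDescent ha hL hLip).mem k),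
      h.dualObjective_eq hw ((h.isDualOptimal_iff hw lInf).1 hlInf).1, ← EReal.coe_add,
      EReal.coe_le_coe_iff]
    linarith [CLQR.FeedbackFactor.dualQuadratic_dualIter_le ha hL hLip hv hls hlInf k]
  · rw [h.lqInput_add_inputOp]
    exact h.isPrimalOf_iff hw (fun i hi => (hzero k i hi).1) u
  · rw [h.lqInput_add_inputOp]
    exact hv.isOptimal_iff hx0 u
  · exact (((h.inputOp hw).continuous.tendsto v).comp htendsto).const_add _
  · have h1 := (((P.opB hw).continuous.tendsto _).comp
      ((((h.inputOp hw).continuous.tendsto v).comp htendsto).const_add (h.lqInput hw)))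
    exact h1.const_add (P.freeResponse hw)
  · have h1 := CLQR.FeedbackFactor.norm_inputOp_sub_le ha hL hLip hv hls hμ hmod hlInf k
    have h2 : P.stateSeq hw (h.lqInput hw + h.inputOp hw
        (ContinuousLinearMap.adjoint (h.constraintOp hw) (P.dualIter hw a L k))) -
        P.stateSeq hw (h.lqInput hw + h.inputOp hw v) = P.opB hw (h.inputOp hw
        (ContinuousLinearMap.adjoint (h.constraintOp hw) (P.dualIter hw a L k) - v)) := by
      simp only [CLQR.stateSeq, map_add, map_sub]
      abel
    rw [h2, add_sub_add_left_eq_sub, ← map_sub]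
    refine ⟨h1, ((P.opB hw).le_opNorm _).trans ?_⟩
    rw [mul_div_assoc, Real.sqrt_mul (sq_nonneg _), Real.sqrt_sq (norm_nonneg (P.opB hw))]
    calc _ ≤ _ := mul_le_mul_of_nonneg_left h1 (norm_nonneg (P.opB hw))
      _ = _ := by ring
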